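/- Let $s=s_1\dots s_n$ be a sequence over an ordered alphabet $\Sigma$ of size $\sigma\le n$, given by the ranks of its letters, and let $n \ge 2$. For $1\le i\le j\le n$ let $C_s(i,j)$ be the set of distinct letters in $s_i\dots s_j$ (a fingerprint of $s$). Let $\mathcal F$ be the set of all fingerprints of $s$. Let $\mathcal L$ be the set of its maximal locations, i.e. of the pairs $\langle i,j\rangle$ with $1\le i\le j\le n$ such that $s_{i-1}\notin C_s(i,j)$ if $i>1$ and $s_{j+1}\notin C_s(i,j)$ if $j<n$. The model is the unit-cost word RAM with word length $w=\Theta(\log n)$, where $w\ge a\log_2 n$ for a suitable absolute constant $a$, with the usual arithmetic and logic operations and an instruction that draws a uniformly random word. Space is counted in bits, and includes input and output. Then for every constant $c$ the following holds. (1) There is a Monte Carlo algorithm (one fixed program, depending only on $c$) that always stops within time $O(n+|\mathcal L|)$, always uses at most $O((n+|\mathcal F|)\log n)$ bits of space, and computes $\mathcal F$ with error probability $O(n^{-c})$. Here $\mathcal F$ is returned as a list of maximal locations such that every fingerprint of $s$ is the fingerprint of exactly one location in the list. (2) There is a Monte Carlo algorithm (one fixed program, depending only on $c$) that always stops within time $O(n+|\mathcal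 L|)$, always uses at most $O((n+|\mathcal L|)\log n)$ bits of space, and computes $\mathcal L$ with error probability $O(n^{-c})$. Here $\mathcal L$ is returned as a list of all maximal locations, each listed once and accompanied by a name of its fingerprint, two locations having equal names if and only if their fingerprints are equal. The constants in the $O$-bounds depend only on $c$ and on the constant $A$ in $w\le A\log_2 n$. -/

import Mathlib

/-! ### Fingerprints and maximal locations

A sequence `s_1 .. s_n` over an alphabet of `σ` letters (given by their ranks `0, .., σ - 1`) is a
function `s : Fin n → Fin σ`; the letter at position `p ∈ {1, .., n}` is `s ⟨p - 1, _⟩`.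
Positions are 1-based natural numbers throughout. -/

namespace TextFingerprint

/-- `C_s(i, j)`: the set of distinct letters among `s_i, .., s_j`. -/
def fingerprint {n σ : ℕ} (s : Fin n → Fin σ) (i j : ℕ) : Finset (Fin σ) :=
  (Finset.univ.filter fun p : Fin n => i ≤ (p : ℕ) + 1 ∧ (p : ℕ) + 1 ≤ j).image s

/-- The set `F` of the fingerprints of all nonempty substrings of `s`. -/
def fingerprints {n σ : ℕ} (s : Fin n → Fin σ) : Finset (Finset (Fin σ)) :=
  ((Finset.Icc 1 n ×ˢ Finset.Icc 1 n).filter fun q : ℕ × ℕ => q.1 ≤ q.2).image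
    fun q => fingerprint s q.1 q.2

/-- `⟨i, j⟩` is a maximal location: `1 ≤ i ≤ j ≤ n`, and neither `s_{i-1}` (if `i > 1`) nor
`s_{j+1}` (if `j < n`) belongs to `C_s(i, j)`. -/
def IsMaximalLocation {n σ : ℕ} (s : Fin n → Fin σ) (i j : ℕ) : Prop :=
  1 ≤ i ∧ i ≤ j ∧ j ≤ n ∧
    (∀ p : Fin n, (p : ℕ) + 1 = i - 1 → s p ∉ fingerprint s i j) ∧
    (∀ p : Fin n, (p : ℕ) + 1 = j + 1 → s p ∉ fingerprint s i j)

instance {n σ : ℕ} (s : Fin n → Fin σ) (i j : ℕ) : Decidable (IsMaximalLocation s i j) := by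
  unfold IsMaximalLocation
  infer_instance

/-- The set `L` of all maximal locations of `s`. -/
def maximalLocations {n σ : ℕ} (s : Fin n → Fin σ) : Finset (ℕ × ℕ) :=
  (Finset.Icc 1 n ×ˢ Finset.Icc 1 n).filter fun q : ℕ × ℕ => IsMaximalLocation s q.1 q.2

end TextFingerprint

/-! ### A randomized unit-cost word RAM -/

namespace WordRAM

/-- The binary operations of the machine. -/
inductive Op where
  | add | sub | mul | div | mod | and | or | xor | shl | shr

/-- The value of an operation on two `w`-bit words (natural numbers below `2 ^ w`). -/
def Op.eval (w : ℕ) : Op → ℕ → ℕ → ℕ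
  | .add, x, y => (x + y) % 2 ^ w
  | .sub, x, y => (x + (2 ^ w - y)) % 2 ^ w
  | .mul, x, y => (x * y) % 2 ^ w
  | .div, x, y => (x / y) % 2 ^ w
  | .mod, x, y => (x % y) % 2 ^ w
  | .and, x, y => (x &&& y) % 2 ^ w
  | .or, x, y => (x ||| y) % 2 ^ w
  | .xor, x, y => (x ^^^ y) % 2 ^ w
  | .shl, x, y => (x <<< y) % 2 ^ w
  | .shr, x, y => (x >>> y) % 2 ^ w

/-- The instructions of a machine with `k` registers. -/
inductive Instr (k : ℕ) where
  /-- `r_d := v` -/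
  | const (d : Fin k) (v : ℕ)
  /-- `r_d := r_x ∘ r_y` -/
  | op (o : Op) (d x y : Fin k)
  /-- `r_d := mem[r_x]` -/
  | load (d x : Fin k)
  /-- `mem[r_x] := r_y` -/
  | store (x y : Fin k)
  /-- `r_d := ` a fresh uniformly random word -/
  | rand (d : Fin k)
  /-- go to line `l` if `r_x = r_y` -/
  | jeq (x y : Fin k) (l : ℕ)
  /-- go to line `l` if `r_x < r_y` -/
  | jlt (x y : Fin k) (l : ℕ)

/-- A program: a number of registers and a finite list of instructions.  It mentions neither the
length of the input nor the word length. -/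
structure Program where
  k : ℕ
  code : List (Instr k)

/-- A configuration. -/
structure Config (k : ℕ) where
  /-- the current line -/
  pc : ℕ
  /-- the registers -/
  reg : Fin k → ℕ
  /-- the memory -/
  mem : ℕ → ℕ
  /-- the number of memory cells in use: the cells `0, .., hi - 1` contain the input and every
  cell accessed so far -/
  hi : ℕ
  /-- the number of random words drawn so far -/
  coins : ℕ

/-- The effect of one instruction, for word length `w` and the stream `ω` of random words. -/
def exec {k : ℕ} (w : ℕ) (ω : ℕ → Fin (2 ^ w)) (γ : Config k) : Instr k → Config k
  | .const d v => { γ with pc := γ.pc + 1, reg := Function.update γ.reg d (v % 2 ^ w) }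
  | .op o d x y =>
      { γ with pc := γ.pc + 1, reg := Function.update γ.reg d (o.eval w (γ.reg x) (γ.reg y)) }
  | .load d x =>
      { γ with
        pc := γ.pc + 1
        reg := Function.update γ.reg d (γ.mem (γ.reg x))
        hi := max γ.hi (γ.reg x + 1) }
  | .store x y =>
      { γ with
        pc := γ.pc + 1
        mem := Function.update γ.mem (γ.reg x) (γ.reg y)
        hi := max γ.hi (γ.reg x + 1) }
  | .rand d =>
      { γ with
        pc := γ.pc + 1
        reg := Function.update γ.reg d (ω γ.coins : ℕ)
        coins := γ.coins + 1 }
  | .jeq x y l => { γ with pc := if γ.reg x = γ.reg y then l else γ.pc + 1 }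
  | .jlt x y l => { γ with pc := if γ.reg x < γ.reg y then l else γ.pc + 1 }

/-- One step of the machine; a configuration whose line lies beyond the program is final. -/
def step (P : Program) (w : ℕ) (ω : ℕ → Fin (2 ^ w)) (γ : Config P.k) : Config P.k :=
  match P.code[γ.pc]? with
  | some I => exec w ω γ I
  | none => γ

/-- The machine has stopped. -/
def Config.Halted (P : Program) (γ : Config P.k) : Prop := P.code.length ≤ γ.pc

/-- The initial configuration on the sequence `s_1 .. s_n`: cell `0` contains `n`, cell `p` contains
the rank of `s_p` for `1 ≤ p ≤ n`, all else is `0`. -/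
def init {n σ : ℕ} (P : Program) (s : Fin n → Fin σ) : Config P.k where
  pc := 0
  reg := fun _ => 0
  mem := fun q => if q = 0 then n else if h : q - 1 < n then (s ⟨q - 1, h⟩ : ℕ) else 0
  hi := n + 1
  coins := 0

/-- The configuration after `t` steps (or the final one, if the machine stops earlier). -/
def run {n σ : ℕ} (P : Program) (w : ℕ) (s : Fin n → Fin σ) (ω : ℕ → Fin (2 ^ w)) (t : ℕ) :
    Config P.k :=
  (step P w ω)^[t] (init P s)

/-- The space used up to a configuration, in bits: `w` bits for every register and for every memory
cell up to the largest address in use. -/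
def Config.bits (w : ℕ) {k : ℕ} (γ : Config k) : ℕ := w * (k + γ.hi)

/-- The law of the random words: independent, each one uniform on the `w`-bit words. -/
noncomputable def coinLaw (w : ℕ) : MeasureTheory.Measure (ℕ → Fin (2 ^ w)) :=
  MeasureTheory.Measure.infinitePi fun _ : ℕ => (PMF.uniformOfFintype (Fin (2 ^ w))).toMeasure

/-- On input `s` and with word length `w`, whatever the random words are, the program `P` stops
within time `T` after using at most `S` bits of space, and the probability that the memory it leaves
does not satisfy `Good` is at most `ε`. -/
def MonteCarlo {n σ : ℕ} (P : Program) (w : ℕ) (s : Fin n → Fin σ) (Good : (ℕ → ℕ) → Prop)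
    (T S ε : ℝ) : Prop :=
  ∃ t : ℕ, (t : ℝ) ≤ T ∧
    (∀ ω, (run P w s ω t).Halted ∧ ((run P w s ω t).bits w : ℝ) ≤ S) ∧
    (coinLaw w).real {ω | ¬ Good (run P w s ω t).mem} ≤ ε

end WordRAM

/-! ### The two outputs -/

namespace TextFingerprint

/-- The memory contains the set `F`, every fingerprint being given by one of its maximal locations:
cell `0` contains a number `m`, and the following cells contain `m` pairs `(i, j)`, which are maximal
locations such that every fingerprint of `s` is the fingerprint of exactly one of them. -/
def HoldsFingerprints {n σ : ℕ} (s : Fin n → Fin σ) (mem : ℕ → ℕ) : Prop :=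
  (∀ q < mem 0, (mem (2 * q + 1), mem (2 * q + 2)) ∈ maximalLocations s) ∧
    Set.BijOn (fun q => fingerprint s (mem (2 * q + 1)) (mem (2 * q + 2)))
      (Set.Iio (mem 0)) (fingerprints s : Set (Finset (Fin σ)))

/-- The memory contains the set `L`, every maximal location together with a name of its fingerprint:
cell `0` contains a number `m`, and the following cells contain `m` triples `(i, j, name)`, such that
the pairs `(i, j)` are the maximal locations of `s`, each one listed once, and two of them have the
same name if and only if they have the same fingerprint. -/
def HoldsMaximalLocations {n σ : ℕ} (s : Fin n → Fin σ) (mem : ℕ → ℕ) : Prop :=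
  Set.BijOn (fun q => (mem (3 * q + 1), mem (3 * q + 2)))
      (Set.Iio (mem 0)) (maximalLocations s : Set (ℕ × ℕ)) ∧
    ∀ q < mem 0, ∀ r < mem 0,
      mem (3 * q + 3) = mem (3 * r + 3) ↔
        fingerprint s (mem (3 * q + 1)) (mem (3 * q + 2)) =
          fingerprint s (mem (3 * r + 1)) (mem (3 * r + 2))

end TextFingerprint

set_option linter.constructorNameAsVariable false

namespace WordRAM

/-! ### A structured language on top of the word RAM -/

/-! Fix a start `i`. A location from `i` to `j` cannot be extended to the right exactly if `j = n`
or `j + 1` carries a first occurrence of its letter from `i` on. It cannot be extended to the left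
exactly if the letter before `i` does not occur in it. So the maximal locations that start at `i`
correspond to the first occurrences that precede the next copy of the letter before `i`. For `i = n,
.., 1` a linked list of first occurrences is kept (`IsFirstList`). Traversing it up to that copy
costs one round per maximal location (`emitted_link`, `emitted_end`); then the copy is unlinked and
`i - 1` is put in front (`IsFirstList.pred`). This takes `n + |L|` rounds in all.

A fingerprint is represented by `D = ⌈c⌉₊ + 4` digits, each the sum modulo `n` of random values of
its letters, so that adding a letter takes constant time. If two different fingerprints collide, the
`D` words of a letter that lies in only one of them have residues modulo `n` determined by the other
words, which has probability at most `(2 / n) ^ D` (`coinLaw_collision_le`). At most `n ^ 4` pairs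
give an error of `2 ^ D * n ^ (-c)`. Collisions spoil only the correctness of the output; the time
and space bounds hold for all random words.

Names come from refining a partition of the records digit by digit with `n` buckets, in time `O(n +
m)` per digit (`rename_spec`). For `L` this is done once, at the end. For `F` the list of records
has to stay short: duplicates are removed whenever it reaches length `2 * u + n`, where `u` records
survived the previous removal. Equal fingerprints have equal digits, so `u ≤ |F|`
(`Records.card_le`), and the `u + n` records added since then pay for the removal
(`flushIfFull_recorder`). Every fingerprint has a maximal location (`exists_maximalLocation`), so
the records cover `F`, and `|F| ≤ |L|`.

The programs are written in a structured language with a weakest-precondition semantics that counts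
loop iterations; compiled code takes at most its length times `1 + ticks` steps (`Cmd.sound`). The
arrays are interleaved row by row, so memory grows with the number of rows in use and no array size
has to be known in advance. Inputs below a constant length are ignored, and the constants absorb the
error (`monteCarlo_mainCmd`). -/

/-- The variables of the structured language; each one is kept in a register. -/
inductive Var where
  | n | i | p | q | y | m | cap | u | r | d | x | z
  deriving DecidableEq

/-- The register of a variable. -/
def Var.reg : Var → Fin 20
  | .n => 0 | .i => 1 | .p => 2 | .q => 3 | .y => 4 | .m => 5 | .cap => 6 | .u => 7 | .r => 8
  | .d => 9 | .x => 10 | .z => 11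

/-- The registers for intermediate results. -/
def tmp (d : ℕ) : Fin 20 := ⟨12 + d % 8, by omega⟩

/-- The arrays of the structured language.  They are interleaved in memory: entry `i` of an array
of code `f` is kept in cell `W * i + f`. -/
inductive Arr where
  | S | NX | I | J | HD | LK | NM | NW
  | R (t : ℕ) | K (t : ℕ) | CU (t : ℕ)
  deriving DecidableEq

/-- The code of an array. -/
def Arr.code : Arr → ℕ
  | .S => 0 | .NX => 1 | .I => 2 | .J => 3 | .HD => 4 | .LK => 5 | .NM => 6 | .NW => 7
  | .R t => 8 + 3 * t | .K t => 9 + 3 * t | .CU t => 10 + 3 * t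

/-- The array of a code. -/
def decode : ℕ → Arr
  | 0 => .S | 1 => .NX | 2 => .I | 3 => .J | 4 => .HD | 5 => .LK | 6 => .NM | 7 => .NW
  | f + 8 => if f % 3 = 0 then .R (f / 3) else if f % 3 = 1 then .K (f / 3) else .CU (f / 3)

theorem code_decode (f : ℕ) : (decode f).code = f := by
  unfold decode
  split <;> try rfl
  split_ifs <;> simp only [Arr.code] <;> omega

theorem decode_code (a : Arr) : decode a.code = a := by
  cases a <;> try rfl
  all_goals
    rename_i t
    simp only [Arr.code]
  · rw [show 8 + 3 * t = 3 * t + 8 by omega, decode, if_pos (by omega)]; congr 1; omega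
  · rw [show 9 + 3 * t = (3 * t + 1) + 8 by omega, decode, if_neg (by omega), if_pos (by omega)]
    congr 1; omega
  · rw [show 10 + 3 * t = (3 * t + 2) + 8 by omega, decode, if_neg (by omega), if_neg (by omega)]
    congr 1; omega

theorem decode_injective : Function.Injective decode := fun f g h => by
  rw [← code_decode f, h, code_decode]

/-- Expressions. -/
inductive Ex where
  | c (n : ℕ)
  | v (x : Var)
  | op (o : Op) (e f : Ex)
  /-- the entry of an array -/
  | ld (a : Arr) (e : Ex)
  /-- the contents of a memory cell -/
  | raw (e : Ex)

/-- The states of the structured language. -/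
structure St where
  v : Var → ℕ
  a : Arr → ℕ → ℕ
  coins : ℕ
  /-- the number of loop iterations so far -/
  ticks : ℕ

/-- The parameters of a computation: word length, number of digits of a hash value, number of
cells that may be accessed, stream of random words. -/
structure Env where
  w : ℕ
  D : ℕ
  B : ℕ
  ω : ℕ → Fin (2 ^ w)

/-- The number of arrays. -/
abbrev Env.W (E : Env) : ℕ := 8 + 3 * E.D

/-- Row `i` of the arrays is accessible. -/
def Env.okRow (E : Env) (i : ℕ) : Prop := E.W < 2 ^ E.w ∧ E.W * i + E.W ≤ E.B

/-- The contents of cell `p`. -/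
def St.cell (E : Env) (s : St) (p : ℕ) : ℕ := s.a (decode (p % E.W)) (p / E.W)

/-- Assigning to a variable. -/
def St.setV (s : St) (x : Var) (n : ℕ) : St := { s with v := Function.update s.v x n }

/-- Assigning to an array entry. -/
def St.setA (s : St) (a : Arr) (i n : ℕ) : St :=
  { s with a := Function.update s.a a (Function.update (s.a a) i n) }

/-- Drawing a random word. -/
def St.draw (E : Env) (s : St) (x : Var) : St :=
  { s with v := Function.update s.v x (E.ω s.coins), coins := s.coins + 1 }

/-- Counting a loop iteration. -/
def St.tick (s : St) : St := { s with ticks := s.ticks + 1 }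

/-- The value of an arithmetic operation that does not overflow. -/
def Op.val : Op → ℕ → ℕ → ℕ
  | .add, x, y => x + y
  | .sub, x, y => x - y
  | .mul, x, y => x * y
  | .div, x, y => x / y
  | .mod, x, y => x % y
  | _, _, _ => 0

/-- An arithmetic operation does not overflow. -/
def Op.ok (M : ℕ) : Op → ℕ → ℕ → Prop
  | .add, x, y => x + y < M
  | .sub, x, y => y ≤ x
  | .mul, x, y => x * y < M
  | .div, _, _ => True
  | .mod, _, _ => True
  | _, _, _ => False

/-- The value of an expression. -/
def Ex.eval (E : Env) (s : St) : Ex → ℕ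
  | .c n => n
  | .v x => s.v x
  | .op o e f => o.val (e.eval E s) (f.eval E s)
  | .ld a e => s.a a (e.eval E s)
  | .raw e => s.cell E (e.eval E s)

/-- The evaluation of an expression neither overflows nor leaves the accessible memory. -/
def Ex.ok (E : Env) (s : St) : Ex → Prop
  | .c n => n < 2 ^ E.w
  | .v _ => True
  | .op o e f => e.ok E s ∧ f.ok E s ∧ o.ok (2 ^ E.w) (e.eval E s) (f.eval E s)
  | .ld _ e => e.ok E s ∧ E.okRow (e.eval E s)
  | .raw e => e.ok E s ∧ e.eval E s < E.B

/-- The number of intermediate results that an expression needs; the arrays must exist. -/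
def Ex.wf (D : ℕ) : Ex → ℕ → Prop
  | .c _, d => d < 8
  | .v _, d => d < 8
  | .op _ e f, d => d < 8 ∧ e.wf D d ∧ f.wf D (d + 1)
  | .ld a e, d => d < 7 ∧ a.code < 8 + 3 * D ∧ e.wf D d
  | .raw e, d => e.wf D d

/-- Commands. -/
inductive Cmd where
  | skip
  | asg (x : Var) (e : Ex)
  | st (a : Arr) (e f : Ex)
  | raw (e f : Ex)
  | rand (x : Var)
  | seq (c d : Cmd)
  /-- `if e = f then c else d` -/
  | ite (e f : Ex) (c d : Cmd)
  /-- `while e ≠ f do c` -/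
  | loop (e f : Ex) (c : Cmd)

/-- Well-formed commands. -/
def Cmd.wf (D : ℕ) : Cmd → Prop
  | .skip => True
  | .asg _ e => e.wf D 0
  | .st a e f => a.code < 8 + 3 * D ∧ e.wf D 0 ∧ f.wf D 1
  | .raw e f => e.wf D 0 ∧ f.wf D 1
  | .rand _ => True
  | .seq c d => c.wf D ∧ d.wf D
  | .ite e f c d => e.wf D 0 ∧ f.wf D 1 ∧ c.wf D ∧ d.wf D
  | .loop e f c => e.wf D 0 ∧ f.wf D 1 ∧ c.wf D

/-- The command stops without errors, after `k` rounds, in a state with property `Q`, where `F`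
transforms properties like the body of the loop. -/
def loopWp (E : Env) (e f : Ex) (F : (St → Prop) → St → Prop) (Q : St → Prop) : ℕ → St → Prop
  | 0, s => e.ok E s ∧ f.ok E s ∧ e.eval E s = f.eval E s ∧ Q s
  | k + 1, s => e.ok E s ∧ f.ok E s ∧ e.eval E s ≠ f.eval E s ∧ F (loopWp E e f F Q k) s.tick

/-- The weakest precondition: the command stops without errors in a state with property `Q`. -/
def wp (E : Env) : Cmd → (St → Prop) → St → Prop
  | .skip, Q, s => Q s
  | .asg x e, Q, s => e.ok E s ∧ Q (s.setV x (e.eval E s))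
  | .st a e f, Q, s =>
      e.ok E s ∧ f.ok E s ∧ E.okRow (e.eval E s) ∧ Q (s.setA a (e.eval E s) (f.eval E s))
  | .raw e f, Q, s =>
      e.ok E s ∧ f.ok E s ∧ e.eval E s < E.B ∧
        Q (s.setA (decode (e.eval E s % E.W)) (e.eval E s / E.W) (f.eval E s))
  | .rand x, Q, s => Q (s.draw E x)
  | .seq c d, Q, s => wp E c (wp E d Q) s
  | .ite e f c d, Q, s =>
      e.ok E s ∧ f.ok E s ∧ (e.eval E s = f.eval E s → wp E c Q s) ∧
        (e.eval E s ≠ f.eval E s → wp E d Q s)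
  | .loop e f c, Q, s => ∃ k, loopWp E e f (wp E c) Q k s

/-! ### Compilation -/

/-- The code of an expression, leaving its value in `tmp d`. -/
def Ex.comp (D : ℕ) : Ex → ℕ → List (Instr 20)
  | .c n, d => [.const (tmp d) n]
  -- The machine has no copy instruction; the bitwise `or` of a word with itself serves as one.
  | .v x, d => [.op .or (tmp d) x.reg x.reg]
  | .op o e f, d => e.comp D d ++ (f.comp D (d + 1) ++ [.op o (tmp d) (tmp d) (tmp (d + 1))])
  | .ld a e, d => e.comp D d ++
      [.const (tmp (d + 1)) (8 + 3 * D), .op .mul (tmp d) (tmp d) (tmp (d + 1)),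
        .const (tmp (d + 1)) a.code, .op .add (tmp d) (tmp d) (tmp (d + 1)),
        .load (tmp d) (tmp d)]
  | .raw e, d => e.comp D d ++ [.load (tmp d) (tmp d)]

/-- The length of the code of a command. -/
def Cmd.len (D : ℕ) : Cmd → ℕ
  | .skip => 0
  | .asg _ e => (e.comp D 0).length + 1
  | .st _ e f => (e.comp D 0).length + 4 + ((f.comp D 1).length + 1)
  | .raw e f => (e.comp D 0).length + ((f.comp D 1).length + 1)
  | .rand _ => 1
  | .seq c d => c.len D + d.len D
  | .ite e f c d => (e.comp D 0).length + ((f.comp D 1).length + (1 + (d.len D + (1 + c.len D))))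
  | .loop e f c => (e.comp D 0).length + ((f.comp D 1).length + (1 + (c.len D + 1)))

/-- The code of a command that starts at line `o`. -/
def Cmd.comp (D : ℕ) : Cmd → ℕ → List (Instr 20)
  | .skip, _ => []
  | .asg x e, _ => e.comp D 0 ++ [.op .or x.reg (tmp 0) (tmp 0)]
  | .st a e f, _ => e.comp D 0 ++
      [.const (tmp 1) (8 + 3 * D), .op .mul (tmp 0) (tmp 0) (tmp 1),
        .const (tmp 1) a.code, .op .add (tmp 0) (tmp 0) (tmp 1)] ++
      (f.comp D 1 ++ [.store (tmp 0) (tmp 1)])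
  | .raw e f, _ => e.comp D 0 ++ (f.comp D 1 ++ [.store (tmp 0) (tmp 1)])
  | .rand x, _ => [.rand x.reg]
  | .seq c d, o => c.comp D o ++ d.comp D (o + c.len D)
  | .ite e f c d, o =>
      let o' := o + (e.comp D 0).length + (f.comp D 1).length + 1
      e.comp D 0 ++ (f.comp D 1 ++ ([.jeq (tmp 0) (tmp 1) (o' + d.len D + 1)] ++
        -- The code of the `else` branch comes first. Comparing a register with itself is an
        -- unconditional jump past the other branch.
        (d.comp D o' ++ ([.jeq (tmp 0) (tmp 0) (o' + d.len D + 1 + c.len D)] ++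
          c.comp D (o' + d.len D + 1)))))
  | .loop e f c, o =>
      let o' := o + (e.comp D 0).length + (f.comp D 1).length + 1
      e.comp D 0 ++ (f.comp D 1 ++ ([.jeq (tmp 0) (tmp 1) (o' + c.len D + 1)] ++
        (c.comp D o' ++ [.jeq (tmp 0) (tmp 0) o])))

theorem Cmd.comp_length (D : ℕ) (c : Cmd) : ∀ o, (c.comp D o).length = c.len D := by
  induction c <;> intro o <;>
    simp_all only [Cmd.comp, Cmd.len, List.length_append, List.length_cons, List.length_nil,
      zero_add]

/-! ### Simulation of structured states by machine configurations -/

/-- The list `l` occupies the lines of `code` from `o` on. -/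
def Seg {k : ℕ} (code : List (Instr k)) (o : ℕ) (l : List (Instr k)) : Prop :=
  ∀ j, j < l.length → code[o + j]? = l[j]?

theorem Seg.left {k : ℕ} {code : List (Instr k)} {o : ℕ} {l l' : List (Instr k)}
    (h : Seg code o (l ++ l')) : Seg code o l := fun j hj => by
  rw [h j (by simp; omega), List.getElem?_append_left hj]

theorem Seg.right {k : ℕ} {code : List (Instr k)} {o : ℕ} {l l' : List (Instr k)}
    (h : Seg code o (l ++ l')) : Seg code (o + l.length) l' := fun j hj => by
  have := h (l.length + j) (by simp; omega)
  rw [List.getElem?_append_right (by omega)] at this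
  simpa [add_assoc] using this

theorem Seg.head {k : ℕ} {code : List (Instr k)} {o : ℕ} {i : Instr k} {l : List (Instr k)}
    (h : Seg code o (i :: l)) : code[o]? = some i := by
  simpa using h 0 (by simp)

theorem Seg.tail {k : ℕ} {code : List (Instr k)} {o : ℕ} {i : Instr k} {l : List (Instr k)}
    (h : Seg code o (i :: l)) : Seg code (o + 1) l := by
  have : Seg code o ([i] ++ l) := h
  simpa using this.right

/-- The machine configuration `γ` represents the state `s`. -/
structure Rel (E : Env) (s : St) (γ : Config 20) : Prop where
  var : ∀ x : Var, γ.reg x.reg = s.v x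
  mem : ∀ p, γ.mem p = s.cell E p
  coins : γ.coins = s.coins
  reg_lt : ∀ x, γ.reg x < 2 ^ E.w
  mem_lt : ∀ p, γ.mem p < 2 ^ E.w
  hi : γ.hi ≤ E.B

theorem tmp_ne_reg (d : ℕ) (x : Var) : x.reg ≠ tmp d := by
  have h : (x.reg : ℕ) < 12 := by cases x <;> decide
  intro e
  have := congrArg Fin.val e
  simp only [tmp] at this
  omega

theorem reg_injective : Function.Injective Var.reg := by
  intro x y h
  cases x <;> cases y <;> first | rfl | (exact absurd h (by decide))

theorem tmp_ne {c d : ℕ} (hc : c < 8) (hd : d < 8) (h : c ≠ d) : tmp c ≠ tmp d := by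
  intro e
  have := congrArg Fin.val e
  simp only [tmp] at this
  omega

/-- Changing an intermediate result. -/
theorem Rel.set {E : Env} {s : St} {γ : Config 20} (h : Rel E s γ) (d pc v : ℕ)
    (hv : v < 2 ^ E.w) :
    Rel E s { γ with pc := pc, reg := Function.update γ.reg (tmp d) v } where
  var x := by simp [Function.update_of_ne (tmp_ne_reg d x), h.var]
  mem := h.mem
  coins := h.coins
  reg_lt x := by
    by_cases e : x = tmp d
    · subst e; simpa using hv
    · simpa [Function.update_of_ne e] using h.reg_lt x
  mem_lt := h.mem_lt
  hi := h.hi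

theorem Rel.setHi {E : Env} {s : St} {γ : Config 20} (h : Rel E s γ) (d pc v a : ℕ)
    (hv : v < 2 ^ E.w) (ha : a < E.B) :
    Rel E s { γ with pc := pc, reg := Function.update γ.reg (tmp d) v, hi := max γ.hi (a + 1) } :=
  { h.set d pc v hv with hi := max_le h.hi ha }

/-- Changing a variable. -/
theorem Rel.setVar {E : Env} {s : St} {γ : Config 20} (h : Rel E s γ) (x : Var) (pc v : ℕ)
    (hv : v < 2 ^ E.w) :
    Rel E (s.setV x v) { γ with pc := pc, reg := Function.update γ.reg x.reg v } where
  var y := by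
    by_cases e : y = x
    · subst e; simp [St.setV]
    · simp [St.setV, Function.update_of_ne e, Function.update_of_ne (reg_injective.ne e), h.var]
  mem := h.mem
  coins := h.coins
  reg_lt y := by
    by_cases e : y = x.reg
    · subst e; simpa using hv
    · simpa [Function.update_of_ne e] using h.reg_lt y
  mem_lt := h.mem_lt
  hi := h.hi

/-- Quotient and remainder by the row width identify a cell with one array entry, and `decode` is
injective, so that a store changes no other cell. -/
theorem cell_setA (E : Env) (s : St) (b p v : ℕ) :
    (s.setA (decode (b % E.W)) (b / E.W) v).cell E p = if p = b then v else s.cell E p := by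
  simp only [St.cell, St.setA]
  by_cases h : p = b
  · subst h; simp
  · rw [if_neg h]
    by_cases h1 : p % E.W = b % E.W
    · have h2 : p / E.W ≠ b / E.W := fun h2 => h (by
        rw [← Nat.div_add_mod p E.W, ← Nat.div_add_mod b E.W, h1, h2])
      rw [h1, Function.update_self, Function.update_of_ne h2]
    · rw [Function.update_of_ne (decode_injective.ne h1)]

/-- Changing a memory cell. -/
theorem Rel.setMem {E : Env} {s : St} {γ : Config 20} (h : Rel E s γ) (b pc v : ℕ)
    (hv : v < 2 ^ E.w) (hb : b < E.B) :
    Rel E (s.setA (decode (b % E.W)) (b / E.W) v)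
      { γ with pc := pc, mem := Function.update γ.mem b v, hi := max γ.hi (b + 1) } where
  var := h.var
  mem p := by
    rw [cell_setA, ← h.mem]
    simp [Function.update_apply]
  coins := h.coins
  reg_lt := h.reg_lt
  mem_lt p := by
    by_cases e : p = b
    · subst e; simpa using hv
    · simpa [Function.update_of_ne e] using h.mem_lt p
  hi := max_le h.hi hb

theorem Rel.pc {E : Env} {s : St} {γ : Config 20} (h : Rel E s γ) (pc : ℕ) :
    Rel E s { γ with pc := pc } := ⟨h.var, h.mem, h.coins, h.reg_lt, h.mem_lt, h.hi⟩

theorem row_div {W i a : ℕ} (ha : a < W) : (W * i + a) / W = i := by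
  rw [Nat.mul_add_div (by omega), Nat.div_eq_of_lt ha, add_zero]

theorem row_mod {W i a : ℕ} (ha : a < W) : (W * i + a) % W = a := by
  rw [Nat.mul_add_mod, Nat.mod_eq_of_lt ha]

theorem Op.eval_eq {w x y : ℕ} {o : Op} (h : o.ok (2 ^ w) x y) (hx : x < 2 ^ w)
    (hy : y < 2 ^ w) : o.eval w x y = o.val x y := by
  cases o <;> simp only [Op.ok, Op.eval, Op.val] at h ⊢
  · exact Nat.mod_eq_of_lt h
  · rw [show x + (2 ^ w - y) = (x - y) + 2 ^ w by omega, Nat.add_mod_right]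
    exact Nat.mod_eq_of_lt (by omega)
  · exact Nat.mod_eq_of_lt h
  · exact Nat.mod_eq_of_lt ((Nat.div_le_self _ _).trans_lt hx)
  · exact Nat.mod_eq_of_lt ((Nat.mod_le _ _).trans_lt hx)

theorem Op.eval_lt (w x y : ℕ) (o : Op) : o.eval w x y < 2 ^ w := by
  cases o <;> exact Nat.mod_lt _ (by positivity)

/-! ### Correctness of compiled expressions -/

section

variable {E : Env} {code : List (Instr 20)}

/-- `n` steps of the machine lead from `γ` to `γ'`. -/
def Steps (E : Env) (code : List (Instr 20)) (n : ℕ) (γ γ' : Config 20) : Prop :=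
  (step ⟨20, code⟩ E.w E.ω)^[n] γ = γ'

theorem Steps.refl (γ : Config 20) : Steps E code 0 γ γ := rfl

theorem Steps.trans {m n : ℕ} {γ γ' γ'' : Config 20} (h : Steps E code m γ γ')
    (h' : Steps E code n γ' γ'') : Steps E code (m + n) γ γ'' := by
  unfold Steps at *
  rw [add_comm, Function.iterate_add_apply, h, h']

theorem Steps.one {γ : Config 20} {i : Instr 20} (h : code[γ.pc]? = some i) :
    Steps E code 1 γ (exec E.w E.ω γ i) := by
  simp [Steps, step, h]

/-- The address of an array entry is computed correctly. -/
theorem address_steps {s : St} {γ : Config 20} {a : Arr} {i d : ℕ} (hd : d < 7)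
    (hR : Rel E s γ) (ha : a.code < 8 + 3 * E.D) (hi : E.okRow i) (hr : γ.reg (tmp d) = i)
    (hs : Seg code γ.pc [.const (tmp (d + 1)) (8 + 3 * E.D),
      .op .mul (tmp d) (tmp d) (tmp (d + 1)), .const (tmp (d + 1)) a.code,
      .op .add (tmp d) (tmp d) (tmp (d + 1))]) (hB : E.B ≤ 2 ^ E.w) :
    ∃ γ', Steps E code 4 γ γ' ∧ γ'.pc = γ.pc + 4 ∧ Rel E s γ' ∧
      γ'.reg (tmp d) = E.W * i + a.code ∧ ∀ j < d, γ'.reg (tmp j) = γ.reg (tmp j) := by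
  obtain ⟨h1, h2⟩ := hi
  have hne : tmp d ≠ tmp (d + 1) := tmp_ne (by omega) (by omega) (by omega)
  have e1 := Op.eval_eq (w := E.w) (o := .mul) (x := i) (y := 8 + 3 * E.D)
    (by simp only [Op.ok]; rw [mul_comm]; simp only [Env.W] at h2; omega)
    (hr ▸ hR.reg_lt _) h1
  have hc : a.code < 2 ^ E.w := by simp only [Env.W] at h1; omega
  have e2 := Op.eval_eq (w := E.w) (o := .add) (x := i * (8 + 3 * E.D)) (y := a.code)
    (by simp only [Op.ok]; rw [mul_comm]; simp only [Env.W] at h2; omega)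
    (by rw [mul_comm]; simp only [Env.W] at h2; omega) hc
  have s1 := Steps.one (E := E) hs.head
  have s2 := s1.trans (Steps.one (E := E) (i := .op .mul (tmp d) (tmp d) (tmp (d + 1)))
    hs.tail.head)
  have s3 := s2.trans (Steps.one (E := E) (i := .const (tmp (d + 1)) a.code) hs.tail.tail.head)
  have s4 := s3.trans (Steps.one (E := E) (i := .op .add (tmp d) (tmp d) (tmp (d + 1)))
    hs.tail.tail.tail.head)
  refine ⟨_, s4, rfl, ?_, ?_, ?_⟩
  · exact Rel.set (Rel.set (Rel.set (Rel.set hR (d + 1) _ _ (Nat.mod_lt _ (by positivity))) d _ _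
      (Op.eval_lt ..)) (d + 1) _ _ (Nat.mod_lt _ (by positivity))) d _ _ (Op.eval_lt ..)
  · simp only [exec, Function.update_self, Function.update_of_ne hne, hr]
    rw [Nat.mod_eq_of_lt h1, Nat.mod_eq_of_lt hc, e1, Op.val, e2, Op.val]
    ring
  · intro j hj
    simp only [exec]
    simp [Function.update_of_ne (tmp_ne (show j < 8 by omega) (show d < 8 by omega) (by omega)),
      Function.update_of_ne (tmp_ne (show j < 8 by omega) (show d + 1 < 8 by omega) (by omega))]

/-- The code of an expression computes its value. -/
theorem Ex.sound (hB : E.B ≤ 2 ^ E.w) {s : St} (e : Ex) : ∀ (d : ℕ) (γ : Config 20), Rel E s γ →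
    e.ok E s → e.wf E.D d → Seg code γ.pc (e.comp E.D d) →
    ∃ γ', Steps E code (e.comp E.D d).length γ γ' ∧ γ'.pc = γ.pc + (e.comp E.D d).length ∧
      Rel E s γ' ∧ γ'.reg (tmp d) = e.eval E s ∧ ∀ j < d, γ'.reg (tmp j) = γ.reg (tmp j) := by
  induction e with
  | c n =>
    intro d γ hR hok hwf hs
    refine ⟨_, Steps.one hs.head, rfl, hR.set _ _ _ (Nat.mod_lt _ (by positivity)), ?_, ?_⟩
    · simpa [exec, Ex.eval] using Nat.mod_eq_of_lt hok
    · intro j hj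
      simp only [Ex.wf] at hwf
      simp [exec, Function.update_of_ne (tmp_ne (show j < 8 by omega) hwf (by omega))]
  | v x =>
    intro d γ hR hok hwf hs
    refine ⟨_, Steps.one hs.head, rfl, hR.set _ _ _ (Op.eval_lt ..), ?_, ?_⟩
    · simp only [exec, Ex.eval, Op.eval, Function.update_self, Nat.or_self, ← hR.var]
      exact Nat.mod_eq_of_lt (hR.reg_lt _)
    · intro j hj
      simp only [Ex.wf] at hwf
      simp [exec, Function.update_of_ne (tmp_ne (show j < 8 by omega) hwf (by omega))]
  | op o e f ihe ihf =>
    intro d γ hR hok hwf hs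
    obtain ⟨hd, hwe, hwf⟩ := hwf
    obtain ⟨hoe, hof, hoo⟩ := hok
    -- Well-formedness bounds the register index of an expression directly, except for `raw`, which
    -- passes it on to its argument.
    have hd' : d + 1 < 8 := by
      clear ihe ihf hs hof hoo
      induction f generalizing d <;> simp only [Ex.wf] at hwf <;> try omega
      rename_i ih
      exact ih d ‹_› ‹_› hwf
    obtain ⟨γ1, s1, p1, R1, v1, k1⟩ := ihe d γ hR hoe hwe hs.left
    obtain ⟨γ2, s2, p2, R2, v2, k2⟩ := ihf (d + 1) γ1 R1 hof hwf (p1 ▸ hs.right.left)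
    have hlast : code[γ2.pc]? = some (.op o (tmp d) (tmp d) (tmp (d + 1))) := by
      rw [p2, p1]; exact hs.right.right.head
    have st := (s1.trans s2).trans (Steps.one hlast)
    simp only [exec, k2 d (by omega), v1, v2] at st
    refine ⟨_, by rw [Ex.comp, List.length_append, List.length_append, ← add_assoc]; exact st, ?_, R2.set d _ _ (Op.eval_lt ..), ?_, ?_⟩
    · simp [Ex.comp, p2, p1, add_assoc]
    · simp only [Function.update_self]
      exact Op.eval_eq hoo (v1 ▸ R1.reg_lt _) (v2 ▸ R2.reg_lt _)
    · intro j hj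
      simp only [Function.update_of_ne (tmp_ne (show j < 8 by omega) hd (by omega))]
      rw [k2 j (by omega), k1 j hj]
  | ld a e ih =>
    intro d γ hR hok hwf hs
    obtain ⟨hd, ha, hwe⟩ := hwf
    obtain ⟨hoe, hrow⟩ := hok
    obtain ⟨γ1, s1, p1, R1, v1, k1⟩ := ih d γ hR hoe hwe hs.left
    have hs2 := hs.right
    rw [← p1] at hs2
    obtain ⟨γ2, s2, p2, R2, v2, k2⟩ := address_steps hd R1 ha hrow v1
      (hs2.left (l' := [.load (tmp d) (tmp d)])) hB
    have hlast : code[γ2.pc]? = some (.load (tmp d) (tmp d)) := by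
      rw [p2]
      exact (Seg.right (l := [_, _, _, _]) hs2).head
    have st := (s1.trans s2).trans (Steps.one hlast)
    simp only [exec, v2] at st
    refine ⟨_, by rw [Ex.comp, List.length_append]; exact st, ?_,
      R2.setHi d _ _ (E.W * e.eval E s + a.code) (R2.mem_lt _) ?_, ?_, ?_⟩
    · simp [Ex.comp, p2, p1, add_assoc]
    · have := hrow.2; simp only [Env.W] at this ⊢; omega
    · simp only [Function.update_self, R2.mem, St.cell, Ex.eval, row_div ha, row_mod ha,
        decode_code]
    · intro j hj
      simp only [Function.update_of_ne (tmp_ne (show j < 8 by omega) (show d < 8 by omega)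
        (by omega))]
      rw [k2 j hj, k1 j hj]
  | raw e ih =>
    intro d γ hR hok hwf hs
    obtain ⟨hoe, hb⟩ := hok
    have hd : d < 8 := by
      simp only [Ex.wf] at hwf
      clear ih hs hoe hb
      induction e generalizing d <;> simp only [Ex.wf] at hwf <;> try omega
      rename_i ih
      exact ih d hwf
    obtain ⟨γ1, s1, p1, R1, v1, k1⟩ := ih d γ hR hoe hwf hs.left
    have hlast : code[γ1.pc]? = some (.load (tmp d) (tmp d)) := by
      rw [p1]; exact hs.right.head
    have st := s1.trans (Steps.one hlast)
    simp only [exec, v1] at st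
    refine ⟨_, by rw [Ex.comp, List.length_append]; exact st, ?_,
      R1.setHi d _ _ _ (R1.mem_lt _) hb, ?_, ?_⟩
    · simp [Ex.comp, p1, add_assoc]
    · simp only [Function.update_self, R1.mem, Ex.eval]
    · intro j hj
      simp only [Function.update_of_ne (tmp_ne (show j < 8 by omega) hd (by omega))]
      rw [k1 j hj]

end

end WordRAM

/-! ### Correctness and running time of compiled commands -/

namespace WordRAM

section

variable {E : Env} {code : List (Instr 20)}

/-- The code of a test evaluates both of its sides. -/
theorem test_sound (hB : E.B ≤ 2 ^ E.w) {s : St} {e f : Ex} {γ : Config 20} {l : List (Instr 20)}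
    (hR : Rel E s γ) (he : e.ok E s) (hf : f.ok E s) (we : e.wf E.D 0) (wf : f.wf E.D 1)
    (hs : Seg code γ.pc (e.comp E.D 0 ++ (f.comp E.D 1 ++ l))) :
    ∃ γ', Steps E code ((e.comp E.D 0).length + (f.comp E.D 1).length) γ γ' ∧
      γ'.pc = γ.pc + (e.comp E.D 0).length + (f.comp E.D 1).length ∧ Rel E s γ' ∧
      γ'.reg (tmp 0) = e.eval E s ∧ γ'.reg (tmp 1) = f.eval E s ∧ Seg code γ'.pc l := by
  obtain ⟨γ1, s1, p1, R1, v1, -⟩ := e.sound hB 0 γ hR he we hs.left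
  obtain ⟨γ2, s2, p2, R2, v2, k2⟩ := f.sound hB 1 γ1 R1 hf wf (p1 ▸ hs.right.left)
  refine ⟨γ2, s1.trans s2, by rw [p2, p1], R2, by rw [k2 0 (by omega), v1], v2, ?_⟩
  rw [p2, p1]; exact hs.right.right

/-- The code of a command leads to a state that satisfies every property whose weakest precondition
holds at the start, and the number of steps is bounded by the number of loop iterations. -/
theorem Cmd.sound (hB : E.B ≤ 2 ^ E.w) (c : Cmd) : ∀ (Q : St → Prop) (s : St) (γ : Config 20),
    wp E c Q s → Rel E s γ → c.wf E.D → Seg code γ.pc (c.comp E.D γ.pc) →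
    ∃ t γ' s', Steps E code t γ γ' ∧ γ'.pc = γ.pc + c.len E.D ∧ Rel E s' γ' ∧ Q s' ∧
      t + c.len E.D * s.ticks ≤ c.len E.D * (1 + s'.ticks) ∧ s.ticks ≤ s'.ticks := by
  induction c with
  | skip =>
    intro Q s γ h hR _ _
    exact ⟨0, γ, s, Steps.refl γ, rfl, hR, h, by simp [Cmd.len], le_rfl⟩
  | asg x e =>
    intro Q s γ h hR hwf hs
    obtain ⟨hok, hQ⟩ := h
    obtain ⟨γ1, s1, p1, R1, v1, -⟩ := e.sound hB 0 γ hR hok hwf hs.left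
    have hlast : code[γ1.pc]? = some (.op .or x.reg (tmp 0) (tmp 0)) := by
      rw [p1]; exact hs.right.head
    have hlt : e.eval E s < 2 ^ E.w := v1 ▸ R1.reg_lt _
    have st := s1.trans (Steps.one hlast)
    simp only [exec, v1, Op.eval, Nat.or_self, Nat.mod_eq_of_lt hlt] at st
    refine ⟨_, _, _, st, ?_, R1.setVar x _ _ hlt, hQ, ?_, le_rfl⟩
    · simp [Cmd.len, p1, add_assoc]
    · simp only [Cmd.len, St.setV]; lia
  | st a e f =>
    intro Q s γ h hR hwf hs
    obtain ⟨ha, we, wf⟩ := hwf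
    obtain ⟨he, hf, hrow, hQ⟩ := h
    rw [Cmd.comp, List.append_assoc] at hs
    obtain ⟨γ1, s1, p1, R1, v1, -⟩ := e.sound hB 0 γ hR he we hs.left
    have hs1 := hs.right
    rw [← p1] at hs1
    obtain ⟨γ2, s2, p2, R2, v2, -⟩ := address_steps (d := 0) (by omega) R1 ha hrow v1 hs1.left hB
    have hs2 : Seg code γ2.pc (f.comp E.D 1 ++ [.store (tmp 0) (tmp 1)]) := by
      rw [p2]; exact hs1.right
    obtain ⟨γ3, s3, p3, R3, v3, k3⟩ := f.sound hB 1 γ2 R2 hf wf hs2.left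
    have hlast : code[γ3.pc]? = some (.store (tmp 0) (tmp 1)) := by
      rw [p3]; exact hs2.right.head
    have hlt : f.eval E s < 2 ^ E.w := v3 ▸ R3.reg_lt _
    have hadr : E.W * e.eval E s + a.code < E.B := by
      have := hrow.2; simp only [Env.W] at this ⊢; omega
    have st := ((s1.trans s2).trans s3).trans (Steps.one hlast)
    simp only [exec, v3, k3 0 (by omega), v2] at st
    have R4 := R3.setMem (E.W * e.eval E s + a.code) (γ3.pc + 1) _ hlt hadr
    rw [row_div ha, row_mod ha, decode_code] at R4
    refine ⟨_, _, _, st, ?_, R4, hQ, ?_, le_rfl⟩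
    · simp [Cmd.len, p1, p2, p3, add_assoc]
    · simp only [Cmd.len, St.setA]; lia
  | raw e f =>
    intro Q s γ h hR hwf hs
    obtain ⟨we, wf⟩ := hwf
    obtain ⟨he, hf, hadr, hQ⟩ := h
    obtain ⟨γ1, s1, p1, R1, v1, v2, hs1⟩ := test_sound hB hR he hf we wf hs
    have hlt : f.eval E s < 2 ^ E.w := v2 ▸ R1.reg_lt _
    have st := s1.trans (Steps.one hs1.head)
    simp only [exec, v1, v2] at st
    refine ⟨_, _, _, st, ?_, R1.setMem _ _ _ hlt hadr, hQ, ?_, le_rfl⟩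
    · simp [Cmd.len, p1, add_assoc]
    · simp only [Cmd.len, St.setA]; lia
  | rand x =>
    intro Q s γ h hR _ hs
    have st := Steps.one (E := E) hs.head
    simp only [exec, hR.coins] at st
    refine ⟨_, _, _, st, rfl, ?_, h, ?_, le_rfl⟩
    · have := hR.setVar x (γ.pc + 1) (E.ω s.coins) (E.ω s.coins).2
      exact ⟨this.var, this.mem, by simp [St.draw], this.reg_lt, this.mem_lt, this.hi⟩
    · simp only [Cmd.len, St.draw]; lia
  | seq c d ihc ihd =>
    intro Q s γ h hR hwf hs
    obtain ⟨t1, γ1, σ1, s1, p1, R1, h1, b1, m1⟩ := ihc _ s γ h hR hwf.1 hs.left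
    have hs2 := hs.right
    rw [Cmd.comp_length, ← p1] at hs2
    obtain ⟨t2, γ2, σ2, s2, p2, R2, h2, b2, m2⟩ := ihd _ σ1 γ1 h1 R1 hwf.2 hs2
    refine ⟨_, γ2, σ2, s1.trans s2, by rw [p2, p1, Cmd.len, add_assoc], R2, h2, ?_, m1.trans m2⟩
    simp only [Cmd.len]
    nlinarith [Nat.mul_le_mul_left (c.len E.D) m2, Nat.mul_le_mul_left (d.len E.D) m1]
  | ite e f c d ihc ihd =>
    intro Q s γ h hR hwf hs
    obtain ⟨we, wf, wc, wd⟩ := hwf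
    obtain ⟨he, hf, hc, hd⟩ := h
    obtain ⟨γ1, s1, p1, R1, v1, v2, hs1⟩ := test_sound hB hR he hf we wf hs
    have st1 := s1.trans (Steps.one hs1.left.head)
    have hs2 := hs1.right
    by_cases hb : e.eval E s = f.eval E s
    · simp only [exec, v1, v2, if_pos hb] at st1
      have hs3 := hs2.right.right
      obtain ⟨t, γ3, σ3, s3, p3, R3, h3, b3, m3⟩ := ihc _ s
        { γ1 with pc := γ.pc + (e.comp E.D 0).length + (f.comp E.D 1).length + 1 + d.len E.D + 1 }
        (hc hb) (R1.pc _) wc (by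
          rw [Cmd.comp_length, p1] at hs3
          exact hs3)
      refine ⟨_, γ3, σ3, st1.trans s3, ?_, R3, h3, ?_, m3⟩
      · rw [p3]; simp only [Cmd.len]; omega
      · simp only [Cmd.len]
        nlinarith [Nat.mul_le_mul_left (d.len E.D) m3,
          Nat.mul_le_mul_left ((e.comp E.D 0).length) m3,
          Nat.mul_le_mul_left ((f.comp E.D 1).length) m3]
    · simp only [exec, v1, v2, if_neg hb] at st1
      obtain ⟨t, γ3, σ3, s3, p3, R3, h3, b3, m3⟩ := ihd _ s { γ1 with pc := γ1.pc + 1 } (hd hb)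
        (R1.pc _) wd (by
          have := hs2.left
          rw [← p1] at this
          exact this)
      have hlast : code[γ3.pc]? = some (.jeq (tmp 0) (tmp 0) (γ.pc + (e.comp E.D 0).length +
          (f.comp E.D 1).length + 1 + d.len E.D + 1 + c.len E.D)) := by
        have := hs2.right.left.head
        rw [Cmd.comp_length] at this
        rw [p3]; exact this
      have st := (st1.trans s3).trans (Steps.one hlast)
      simp only [exec, if_true] at st
      refine ⟨_, _, σ3, st, ?_, R3.pc _, h3, ?_, m3⟩
      · simp only [Cmd.len]; omega
      · simp only [Cmd.len]
        nlinarith [Nat.mul_le_mul_left (c.len E.D) m3,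
          Nat.mul_le_mul_left ((e.comp E.D 0).length) m3,
          Nat.mul_le_mul_left ((f.comp E.D 1).length) m3]
  | loop e f c ih =>
    intro Q s γ h hR hwf hs
    obtain ⟨k, h⟩ := h
    obtain ⟨we, wf, wc⟩ := hwf
    suffices key : ∀ k s (γ : Config 20), loopWp E e f (wp E c) Q k s → Rel E s γ →
        Seg code γ.pc ((Cmd.loop e f c).comp E.D γ.pc) →
        ∃ t γ' s', Steps E code t γ γ' ∧ γ'.pc = γ.pc + (Cmd.loop e f c).len E.D ∧ Rel E s' γ' ∧
          Q s' ∧ t + (Cmd.loop e f c).len E.D * s.ticks ≤ (Cmd.loop e f c).len E.D *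
          (1 + s'.ticks) ∧ s.ticks ≤ s'.ticks from key k s γ h hR hs
    intro k
    induction k with
    | zero =>
      intro s γ h hR hs
      obtain ⟨he, hf, hb, hQ⟩ := h
      obtain ⟨γ1, s1, p1, R1, v1, v2, hs1⟩ := test_sound hB hR he hf we wf hs
      have st1 := s1.trans (Steps.one hs1.left.head)
      simp only [exec, v1, v2, if_pos hb] at st1
      refine ⟨_, _, s, st1, ?_, R1.pc _, hQ, ?_, le_rfl⟩
      · simp only [Cmd.len]; omega
      · simp only [Cmd.len]; nlinarith
    | succ k ihk =>
      intro s γ h hR hs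
      obtain ⟨he, hf, hb, hQ⟩ := h
      obtain ⟨γ1, s1, p1, R1, v1, v2, hs1⟩ := test_sound hB hR he hf we wf hs
      have st1 := s1.trans (Steps.one hs1.left.head)
      have hs2 := hs1.right
      simp only [exec, v1, v2, if_neg hb] at st1
      -- The tick of this round pays for the test, the two jumps and one pass through the code of
      -- the body. Further passes through inner loops are paid for by their own ticks.
      have R1' : Rel E s.tick { γ1 with pc := γ1.pc + 1 } :=
        ⟨R1.var, R1.mem, R1.coins, R1.reg_lt, R1.mem_lt, R1.hi⟩
      obtain ⟨t, γ3, σ3, s3, p3, R3, h3, b3, m3⟩ := ih _ s.tick { γ1 with pc := γ1.pc + 1 } hQ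
        R1' wc (by
          have := hs2.left
          rw [← p1] at this
          exact this)
      have hlast : code[γ3.pc]? = some (.jeq (tmp 0) (tmp 0) γ.pc) := by
        have := hs2.right.head
        rw [Cmd.comp_length] at this
        rw [p3]; exact this
      have st := (st1.trans s3).trans (Steps.one hlast)
      simp only [exec, if_true] at st
      obtain ⟨t', γ4, σ4, s4, p4, R4, h4, b4, m4⟩ := ihk σ3 _ h3 (R3.pc _) hs
      refine ⟨_, γ4, σ4, st.trans s4, p4, R4, h4, ?_, ?_⟩
      · simp only [Cmd.len, St.tick] at b3 b4 m3 ⊢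
        nlinarith [Nat.mul_le_mul_left ((e.comp E.D 0).length) m3,
          Nat.mul_le_mul_left ((f.comp E.D 1).length) m3]
      · simp only [St.tick] at m3; omega

end

end WordRAM

namespace WordRAM

/-! ### Reasoning about commands -/

infixr:60 " ;; " => Cmd.seq
infixl:65 " +ₑ " => Ex.op Op.add
infixl:65 " -ₑ " => Ex.op Op.sub
infixl:70 " /ₑ " => Ex.op Op.div
infixl:70 " %ₑ " => Ex.op Op.mod

attribute [simp] Op.val Op.ok Ex.eval Ex.ok

section

variable (E : Env) (s : St)

@[simp] theorem St.setV_v (x y : Var) (n : ℕ) :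
    (s.setV x n).v y = if y = x then n else s.v y := by simp [St.setV, Function.update_apply]

@[simp] theorem St.setV_a (x : Var) (n : ℕ) : (s.setV x n).a = s.a := rfl

@[simp] theorem St.setV_coins (x : Var) (n : ℕ) : (s.setV x n).coins = s.coins := rfl

@[simp] theorem St.setV_ticks (x : Var) (n : ℕ) : (s.setV x n).ticks = s.ticks := rfl

@[simp] theorem St.setV_cell (x : Var) (n : ℕ) : (s.setV x n).cell E = s.cell E := rfl

@[simp] theorem St.setA_v (a : Arr) (i n : ℕ) : (s.setA a i n).v = s.v := rfl

@[simp] theorem St.setA_a (a b : Arr) (i j n : ℕ) :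
    (s.setA a i n).a b j = if b = a ∧ j = i then n else s.a b j := by
  simp only [St.setA, Function.update_apply]
  split_ifs <;> simp_all

@[simp] theorem St.setA_a_of_ne {a b : Arr} (h : b ≠ a) (i n : ℕ) :
    (s.setA a i n).a b = s.a b := by ext; simp [h]

@[simp] theorem St.setA_coins (a : Arr) (i n : ℕ) : (s.setA a i n).coins = s.coins := rfl

@[simp] theorem St.setA_ticks (a : Arr) (i n : ℕ) : (s.setA a i n).ticks = s.ticks := rfl

@[simp] theorem St.draw_v (x y : Var) :
    (s.draw E x).v y = if y = x then (E.ω s.coins : ℕ) else s.v y := by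
  simp [St.draw, Function.update_apply]

@[simp] theorem St.draw_a (x : Var) : (s.draw E x).a = s.a := rfl

@[simp] theorem St.draw_coins (x : Var) : (s.draw E x).coins = s.coins + 1 := rfl

@[simp] theorem St.draw_ticks (x : Var) : (s.draw E x).ticks = s.ticks := rfl

@[simp] theorem St.tick_v : s.tick.v = s.v := rfl

@[simp] theorem St.tick_a : s.tick.a = s.a := rfl

@[simp] theorem St.tick_coins : s.tick.coins = s.coins := rfl

@[simp] theorem St.tick_ticks : s.tick.ticks = s.ticks + 1 := rfl

@[simp] theorem St.tick_cell : s.tick.cell E = s.cell E := rfl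

variable {E s} {Q : St → Prop}

@[simp] theorem wp_skip : wp E .skip Q s ↔ Q s := Iff.rfl

@[simp] theorem wp_asg {x : Var} {e : Ex} :
    wp E (.asg x e) Q s ↔ e.ok E s ∧ Q (s.setV x (e.eval E s)) := Iff.rfl

@[simp] theorem wp_st {a : Arr} {e f : Ex} :
    wp E (.st a e f) Q s ↔
      e.ok E s ∧ f.ok E s ∧ E.okRow (e.eval E s) ∧ Q (s.setA a (e.eval E s) (f.eval E s)) :=
  Iff.rfl

@[simp] theorem wp_raw {e f : Ex} :
    wp E (.raw e f) Q s ↔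
      e.ok E s ∧ f.ok E s ∧ e.eval E s < E.B ∧
        Q (s.setA (decode (e.eval E s % E.W)) (e.eval E s / E.W) (f.eval E s)) := Iff.rfl

@[simp] theorem wp_rand {x : Var} : wp E (.rand x) Q s ↔ Q (s.draw E x) := Iff.rfl

@[simp] theorem wp_seq {c d : Cmd} : wp E (c ;; d) Q s ↔ wp E c (wp E d Q) s := Iff.rfl

@[simp] theorem wp_ite {e f : Ex} {c d : Cmd} :
    wp E (.ite e f c d) Q s ↔
      e.ok E s ∧ f.ok E s ∧ (e.eval E s = f.eval E s → wp E c Q s) ∧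
        (e.eval E s ≠ f.eval E s → wp E d Q s) := Iff.rfl

/-- A command has a unique final state. -/
theorem wp_final (c : Cmd) : ∀ {Q : St → Prop} {s : St}, wp E c Q s →
    ∃ s', Q s' ∧ ∀ Q' : St → Prop, Q' s' → wp E c Q' s := by
  induction c with
  | skip => intro Q s h; exact ⟨s, h, fun _ h => h⟩
  | asg x e => intro Q s h; exact ⟨_, h.2, fun _ h' => ⟨h.1, h'⟩⟩
  | st a e f => intro Q s h; exact ⟨_, h.2.2.2, fun _ h' => ⟨h.1, h.2.1, h.2.2.1, h'⟩⟩
  | raw e f => intro Q s h; exact ⟨_, h.2.2.2, fun _ h' => ⟨h.1, h.2.1, h.2.2.1, h'⟩⟩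
  | rand x => intro Q s h; exact ⟨_, h, fun _ h' => h'⟩
  | seq c d ihc ihd =>
    intro Q s h
    obtain ⟨s1, h1, k1⟩ := ihc h
    obtain ⟨s2, h2, k2⟩ := ihd h1
    exact ⟨s2, h2, fun Q' h' => k1 _ (k2 _ h')⟩
  | ite e f c d ihc ihd =>
    intro Q s h
    by_cases hb : e.eval E s = f.eval E s
    · obtain ⟨s1, h1, k1⟩ := ihc (h.2.2.1 hb)
      exact ⟨s1, h1, fun Q' h' => ⟨h.1, h.2.1, fun _ => k1 _ h', fun hn => absurd hb hn⟩⟩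
    · obtain ⟨s1, h1, k1⟩ := ihd (h.2.2.2 hb)
      exact ⟨s1, h1, fun Q' h' => ⟨h.1, h.2.1, fun hn => absurd hn hb, fun _ => k1 _ h'⟩⟩
  | loop e f c ih =>
    rintro Q s ⟨k, h⟩
    induction k generalizing s with
    | zero => exact ⟨s, h.2.2.2, fun Q' h' => ⟨0, h.1, h.2.1, h.2.2.1, h'⟩⟩
    | succ k ihk =>
      obtain ⟨s1, h1, k1⟩ := ih h.2.2.2
      obtain ⟨s2, h2, k2⟩ := ihk h1
      refine ⟨s2, h2, fun Q' h' => ?_⟩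
      obtain ⟨j, hj⟩ := k2 Q' h'
      exact ⟨j + 1, h.1, h.2.1, h.2.2.1, k1 _ hj⟩

/-- Execution is deterministic once the random words are fixed, so any precondition is a statement
about the one final state. -/
theorem wp_mono (c : Cmd) {Q Q' : St → Prop} {s : St} (h : wp E c Q s)
    (hQ : ∀ s, Q s → Q' s) : wp E c Q' s :=
  let ⟨s', h', k⟩ := wp_final c h
  k Q' (hQ s' h')

end

/-! ### Frame conditions and loop rules -/

/-- The variables that a command may change. -/
@[simp] def Cmd.wv : Cmd → Var → Prop
  | .skip, _ => False
  | .asg x _, y => y = x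
  | .st _ _ _, _ => False
  | .raw _ _, _ => False
  | .rand x, y => y = x
  | .seq c d, y => c.wv y ∨ d.wv y
  | .ite _ _ c d, y => c.wv y ∨ d.wv y
  | .loop _ _ c, y => c.wv y

/-- The arrays that a command may change. -/
@[simp] def Cmd.wa : Cmd → Arr → Prop
  | .skip, _ => False
  | .asg _ _, _ => False
  | .st a _ _, b => b = a
  | .raw _ _, _ => True
  | .rand _, _ => False
  | .seq c d, y => c.wa y ∨ d.wa y
  | .ite _ _ c d, y => c.wa y ∨ d.wa y
  | .loop _ _ c, y => c.wa y

/-- Two states agree up to what a command may change. -/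
structure Frame (c : Cmd) (s s' : St) : Prop where
  v : ∀ x, ¬ c.wv x → s'.v x = s.v x
  a : ∀ a, ¬ c.wa a → s'.a a = s.a a

/-- A syntactic bound on what is written carries all other facts across a call, so that
specifications mention only what changes. A raw store may hit any array and protects none. -/
theorem wp_frame {E : Env} (c : Cmd) : ∀ {Q : St → Prop} {s : St}, wp E c Q s →
    wp E c (fun s' => Q s' ∧ Frame c s s') s := by
  induction c with
  | skip => intro Q s h; exact ⟨h, ⟨fun _ _ => rfl, fun _ _ => rfl⟩⟩
  | asg x e =>
    intro Q s h
    exact ⟨h.1, h.2, ⟨fun y hy => by simp_all, fun _ _ => rfl⟩⟩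
  | st a e f =>
    intro Q s h
    exact ⟨h.1, h.2.1, h.2.2.1, h.2.2.2, ⟨fun _ _ => rfl, fun y hy => by ext; simp_all⟩⟩
  | raw e f =>
    intro Q s h
    exact ⟨h.1, h.2.1, h.2.2.1, h.2.2.2, ⟨fun _ _ => rfl, fun y hy => by simp_all⟩⟩
  | rand x =>
    intro Q s h
    exact ⟨h, ⟨fun y hy => by simp_all, fun _ _ => rfl⟩⟩
  | seq c d ihc ihd =>
    intro Q s h
    refine wp_mono c (ihc h) ?_
    rintro s1 ⟨h1, f1⟩
    refine wp_mono d (ihd h1) ?_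
    rintro s2 ⟨h2, f2⟩
    refine ⟨h2, fun x hx => ?_, fun x hx => ?_⟩ <;> simp only [Cmd.wv, Cmd.wa, not_or] at hx
    · rw [f2.v x hx.2, f1.v x hx.1]
    · rw [f2.a x hx.2, f1.a x hx.1]
  | ite e f c d ihc ihd =>
    intro Q s h
    refine ⟨h.1, h.2.1, fun hb => wp_mono c (ihc (h.2.2.1 hb)) ?_,
      fun hb => wp_mono d (ihd (h.2.2.2 hb)) ?_⟩ <;>
    · rintro s1 ⟨h1, f1⟩
      refine ⟨h1, fun x hx => ?_, fun x hx => ?_⟩ <;> simp only [Cmd.wv, Cmd.wa, not_or] at hx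
      · exact f1.v x (by tauto)
      · exact f1.a x (by tauto)
  | loop e f c ih =>
    rintro Q s ⟨k, h⟩
    refine ⟨k, ?_⟩
    induction k generalizing s with
    | zero => exact ⟨h.1, h.2.1, h.2.2.1, h.2.2.2, ⟨fun _ _ => rfl, fun _ _ => rfl⟩⟩
    | succ k ihk =>
      refine ⟨h.1, h.2.1, h.2.2.1, wp_mono c (ih h.2.2.2) ?_⟩
      rintro s1 ⟨h1, f1⟩
      have key : ∀ k {P P' : St → Prop} {s : St}, (∀ s, P s → P' s) →
          loopWp E e f (wp E c) P k s → loopWp E e f (wp E c) P' k s := by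
        intro k
        induction k with
        | zero => intro P P' s hP h; exact ⟨h.1, h.2.1, h.2.2.1, hP _ h.2.2.2⟩
        | succ k ihk =>
          intro P P' s hP h
          exact ⟨h.1, h.2.1, h.2.2.1, wp_mono c h.2.2.2 fun s' h' => ihk hP h'⟩
      refine key k ?_ (ihk h1)
      rintro s2 ⟨h2, f2⟩
      exact ⟨h2, fun x hx => by rw [f2.v x hx, f1.v x hx]; rfl,
        fun x hx => by rw [f2.a x hx, f1.a x hx]; rfl⟩

/-- Using a specification of a command. -/
theorem wp_call {E : Env} {c : Cmd} {Q Q' : St → Prop} {s : St} (h : wp E c Q s)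
    (h' : ∀ s', Q s' → Frame c s s' → Q' s') : wp E c Q' s :=
  wp_mono c (wp_frame c h) fun s' hs => h' s' hs.1 hs.2

/-- A loop with a known number of rounds. -/
theorem wp_for {E : Env} {e f : Ex} {c : Cmd} (N : ℕ) (Inv : ℕ → St → Prop) {s : St}
    (h0 : Inv 0 s)
    (hstep : ∀ j < N, ∀ s, Inv j s →
      e.ok E s ∧ f.ok E s ∧ e.eval E s ≠ f.eval E s ∧ wp E c (Inv (j + 1)) s.tick)
    (hend : ∀ s, Inv N s → e.ok E s ∧ f.ok E s ∧ e.eval E s = f.eval E s) :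
    wp E (.loop e f c) (Inv N) s := by
  suffices h : ∀ k, ∀ j, j + k = N → ∀ s, Inv j s → loopWp E e f (wp E c) (Inv N) k s from
    ⟨N, h N 0 (by omega) s h0⟩
  intro k
  induction k with
  | zero =>
    intro j hj s h
    obtain rfl : j = N := by omega
    obtain ⟨h1, h2, h3⟩ := hend s h
    exact ⟨h1, h2, h3, h⟩
  | succ k ih =>
    intro j hj s h
    obtain ⟨h1, h2, h3, h4⟩ := hstep j (by omega) s h
    exact ⟨h1, h2, h3, wp_mono c h4 (ih (j + 1) (by omega))⟩

/-- A loop with an invariant and a decreasing measure. -/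
theorem wp_while {E : Env} {e f : Ex} {c : Cmd} (Inv : St → Prop) (μ : St → ℕ) {s : St}
    (h0 : Inv s)
    (hstep : ∀ s, Inv s → e.ok E s ∧ f.ok E s ∧
      (e.eval E s ≠ f.eval E s → wp E c (fun s' => Inv s' ∧ μ s' < μ s) s.tick)) :
    wp E (.loop e f c) (fun s => Inv s ∧ e.eval E s = f.eval E s) s := by
  suffices h : ∀ m, ∀ s, μ s ≤ m → Inv s →
      wp E (.loop e f c) (fun s => Inv s ∧ e.eval E s = f.eval E s) s from h _ s le_rfl h0
  intro m
  induction m with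
  | zero =>
    intro s hs hI
    obtain ⟨h1, h2, h3⟩ := hstep s hI
    by_cases hb : e.eval E s = f.eval E s
    · exact ⟨0, h1, h2, hb, hI, hb⟩
    · exact ⟨1, h1, h2, hb, wp_mono c (h3 hb) fun s' h' => absurd h'.2 (by omega)⟩
  | succ m ih =>
    intro s hs hI
    obtain ⟨h1, h2, h3⟩ := hstep s hI
    by_cases hb : e.eval E s = f.eval E s
    · exact ⟨0, h1, h2, hb, hI, hb⟩
    · suffices hk : ∃ k, wp E c (loopWp E e f (wp E c)
          (fun s => Inv s ∧ e.eval E s = f.eval E s) k) s.tick from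
        hk.elim fun k hk => ⟨k + 1, h1, h2, hb, hk⟩
      -- The number of remaining rounds depends on the state after the body. As that state is
      -- unique, the number can be chosen before the body runs.
      obtain ⟨s', h', k'⟩ := wp_final c (h3 hb)
      exact (ih s' (by omega) h'.1).imp fun k hk => k' _ hk

/-- The commands `f 0, .., f (N - 1)` in sequence. -/
def Cmd.rep : ℕ → (ℕ → Cmd) → Cmd
  | 0, _ => .skip
  | N + 1, f => rep N f ;; f N

theorem Cmd.rep_wf {D : ℕ} (N : ℕ) (f : ℕ → Cmd) : (Cmd.rep N f).wf D ↔ ∀ t < N, (f t).wf D := by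
  induction N with
  | zero => simp [Cmd.rep, Cmd.wf]
  | succ N ih =>
    simp only [Cmd.rep, Cmd.wf, ih, Nat.lt_succ_iff_lt_or_eq]
    exact ⟨fun h t ht => ht.elim (h.1 t) fun e => e ▸ h.2,
      fun h => ⟨fun t ht => h t (.inl ht), h N (.inr rfl)⟩⟩

@[simp] theorem Cmd.rep_wv (N : ℕ) (f : ℕ → Cmd) (x : Var) :
    (Cmd.rep N f).wv x ↔ ∃ t < N, (f t).wv x := by
  induction N with
  | zero => simp [Cmd.rep]
  | succ N ih =>
    simp only [Cmd.rep, Cmd.wv, ih, Nat.lt_succ_iff_lt_or_eq]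
    exact ⟨fun h => h.elim (fun ⟨t, ht, h⟩ => ⟨t, .inl ht, h⟩) fun h => ⟨N, .inr rfl, h⟩,
      fun ⟨t, ht, h⟩ => ht.elim (fun ht => .inl ⟨t, ht, h⟩) fun e => .inr (e ▸ h)⟩

@[simp] theorem Cmd.rep_wa (N : ℕ) (f : ℕ → Cmd) (x : Arr) :
    (Cmd.rep N f).wa x ↔ ∃ t < N, (f t).wa x := by
  induction N with
  | zero => simp [Cmd.rep]
  | succ N ih =>
    simp only [Cmd.rep, Cmd.wa, ih, Nat.lt_succ_iff_lt_or_eq]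
    exact ⟨fun h => h.elim (fun ⟨t, ht, h⟩ => ⟨t, .inl ht, h⟩) fun h => ⟨N, .inr rfl, h⟩,
      fun ⟨t, ht, h⟩ => ht.elim (fun ht => .inl ⟨t, ht, h⟩) fun e => .inr (e ▸ h)⟩

/-- The repetition is unrolled in the code: the number of digits is a constant of the program and
enters the running time through the code length, not through ticks. -/
theorem wp_rep {E : Env} (N : ℕ) {f : ℕ → Cmd} (Inv : ℕ → St → Prop) {s : St} (h0 : Inv 0 s)
    (hstep : ∀ t < N, ∀ s, Inv t s → wp E (f t) (Inv (t + 1)) s) :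
    wp E (Cmd.rep N f) (Inv N) s := by
  induction N with
  | zero => exact h0
  | succ N ih =>
    exact wp_seq.2 (wp_mono _ (ih fun t ht => hstep t (by omega)) (hstep N (by omega)))

/-! ### Programs -/

/-- The initial state on a given memory. -/
def St.start (E : Env) (μ : ℕ → ℕ) : St where
  v _ := 0
  a a i := μ (E.W * i + a.code)
  coins := 0
  ticks := 0

theorem St.start_cell (E : Env) (μ : ℕ → ℕ) (p : ℕ) : (St.start E μ).cell E p = μ p := by
  simp only [St.cell, St.start, code_decode, Nat.div_add_mod]

/-- The program of a command. -/
def Cmd.program (D : ℕ) (c : Cmd) : Program := ⟨20, c.comp D 0⟩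

/-- What is known about a command holds for the machine. -/
theorem run_of_wp {E : Env} {c : Cmd} {n σ : ℕ} {s : Fin n → Fin σ} {Q : St → Prop} {τ : ℕ}
    (hB : E.B ≤ 2 ^ E.w) (hn : n < E.B) (hσ : σ ≤ n) (hwf : c.wf E.D)
    (h : wp E c (fun s => Q s ∧ s.ticks ≤ τ)
      (St.start E (init (c.program E.D) s).mem)) {T : ℕ} (hT : c.len E.D * (1 + τ) ≤ T) :
    (run (c.program E.D) E.w s E.ω T).Halted ∧
      (run (c.program E.D) E.w s E.ω T).hi ≤ E.B ∧
      ∃ s', Q s' ∧ (run (c.program E.D) E.w s E.ω T).mem = s'.cell E := by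
  have hR : Rel E (St.start E (init (c.program E.D) s).mem) (init (c.program E.D) s) := by
    refine ⟨fun _ => rfl, fun p => (St.start_cell E _ p).symm, rfl,
      fun _ => Nat.two_pow_pos _, fun p => ?_, hn⟩
    simp only [init]
    split_ifs with h1 h2
    · omega
    · exact (s _).2.trans_le (by omega)
    · exact Nat.two_pow_pos _
  obtain ⟨t, γ, s', h1, h2, h3, ⟨h4, h5⟩, h6, -⟩ := c.sound (code := c.comp E.D 0) hB _ _
    (init (c.program E.D) s) h hR hwf (fun j _ => by
      simp only [init, zero_add])
  have hhalt : (c.program E.D).code.length ≤ γ.pc := by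
    change (c.comp E.D 0).length ≤ γ.pc
    rw [h2, Cmd.comp_length]; simp [init]
  have hfix : ∀ k, (step (c.program E.D) E.w E.ω)^[k] γ = γ := by
    intro k
    have : step (c.program E.D) E.w E.ω γ = γ := by
      simp only [step, List.getElem?_eq_none hhalt]
      rfl
    exact Function.iterate_fixed this k
  have hle : t ≤ T := by
    have : c.len E.D * (1 + s'.ticks) ≤ c.len E.D * (1 + τ) := by gcongr
    omega
  have hrun : run (c.program E.D) E.w s E.ω T = γ := by
    obtain ⟨k, rfl⟩ := Nat.exists_eq_add_of_le' hle
    rw [run, Function.iterate_add_apply]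
    have : (step (c.program E.D) E.w E.ω)^[t] (init (c.program E.D) s) = γ := h1
    rw [this, hfix]
  rw [hrun]
  exact ⟨hhalt, h3.hi, s', h4, funext h3.mem⟩

end WordRAM

namespace WordRAM

/-! ### Naming the hash values of a list of records -/

/-- The first `H` rows of the arrays are accessible. -/
structure Fits (E : Env) (H : ℕ) : Prop where
  row : ∀ i < H, E.okRow i
  -- Headroom for the largest intermediate values: output addresses such as `3 * r + 3` and the
  -- capacity `2 * u + n`.
  lt : 4 * H + 4 ≤ 2 ^ E.w

theorem Fits.w_ne {E : Env} {H : ℕ} (h : Fits E H) : E.w ≠ 0 := fun e => by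
  have := h.lt
  simp [e] at this

/-- The successor of the greatest `r < ρ` with `k r = d`, and `0` if there is none. -/
def lastIdx (k : ℕ → ℕ) : ℕ → ℕ → ℕ
  | 0, _ => 0
  | ρ + 1, d => if k ρ = d then ρ + 1 else lastIdx k ρ d

theorem lastIdx_le (k : ℕ → ℕ) (ρ d : ℕ) : lastIdx k ρ d ≤ ρ := by
  induction ρ with
  | zero => rfl
  | succ ρ ih => unfold lastIdx; split_ifs <;> omega

theorem lastIdx_hit {k : ℕ → ℕ} {ρ d : ℕ} :
    lastIdx k ρ d = 0 ∨ k (lastIdx k ρ d - 1) = d := by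
  induction ρ with
  | zero => exact .inl rfl
  | succ ρ ih =>
    unfold lastIdx
    split_ifs with h
    · exact .inr h
    · exact ih

/-- `lastIdx` describes the bucket lists, with indices shifted by one so that `0` ends a list.
Between two consecutive entries of a list no record with this digit is skipped. -/
theorem lastIdx_gap {k : ℕ → ℕ} {ρ d r : ℕ} (h : lastIdx k ρ d ≤ r) (hr : r < ρ) : k r ≠ d := by
  induction ρ with
  | zero => omega
  | succ ρ ih =>
    unfold lastIdx at h
    split_ifs at h with h'
    · omega
    · rcases Nat.lt_succ_iff_lt_or_eq.1 hr with h1 | rfl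
      · exact ih h h1
      · exact h'

/-- The record `r` has been treated when bucket `d` has been traversed down to `r₁`. -/
def Treated (k : ℕ → ℕ) (d r₁ r : ℕ) : Prop := k r < d ∨ (k r = d ∧ r₁ ≤ r)

instance (k : ℕ → ℕ) (d r₁ r : ℕ) : Decidable (Treated k d r₁ r) := by
  unfold Treated; infer_instance

/-- The number of treated records. -/
def treatedCard (k : ℕ → ℕ) (m d r₁ : ℕ) : ℕ := ((Finset.range m).filter (Treated k d r₁)).card

theorem treatedCard_le (k : ℕ → ℕ) (m d r₁ : ℕ) : treatedCard k m d r₁ ≤ m :=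
  (Finset.card_filter_le _ _).trans_eq (Finset.card_range m)

/-- The state of the refinement of the names `v` by the digits `k`, when bucket `d` has been
traversed down to `r₁`.  The old names distinguish the records up to `R`. -/
structure Refining (m : ℕ) (R : ℕ → ℕ → Prop) (k v : ℕ → ℕ) (d r₁ : ℕ) (nm nw : ℕ → ℕ) :
    Prop where
  old : ∀ r < m, ¬ Treated k d r₁ r → nm r = v r
  new : ∀ r < m, Treated k d r₁ r → nm r < m ∧ R (nm r) r ∧ k (nm r) = k r
  eq : ∀ r < m, ∀ r' < m, Treated k d r₁ r → Treated k d r₁ r' → R r r' → k r = k r' →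
    nm r = nm r'
  -- An entry may be stale, left by an earlier bucket or by the initialization. It is still a record
  -- of the old class `x`, and its digit tells whether it belongs to the current bucket; hence `nw`
  -- is not reset between buckets.
  rep : ∀ x < m, nw x < m ∧ R (nw x) x
  cur : ∀ r < m, Treated k d r₁ r → k r = d → nw (v r) = nm r

section

variable {m : ℕ} {R : ℕ → ℕ → Prop} {k v : ℕ → ℕ} {d r₁ : ℕ} {nm nw : ℕ → ℕ}

/-- An exhausted bucket has all of its records treated, and at the head of the next bucket none of
that bucket is treated yet. The condition `d + 1 < n` is there because the last advance reads an
arbitrary head in row `n`; no record has the digit `n`. -/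
theorem treated_advance {n r : ℕ} (hk : ∀ r < m, k r < n) (hr : r < m)
    (h₁ : d + 1 < n → r₁ = lastIdx k m (d + 1)) : Treated k (d + 1) r₁ r ↔ Treated k d 0 r := by
  have := hk r hr
  have h2 : d + 1 < n → r₁ ≤ r → k r ≠ d + 1 := fun h h' => lastIdx_gap (h₁ h ▸ h') hr
  unfold Treated
  constructor
  · rintro (h | ⟨h, h'⟩)
    · omega
    · exact absurd h (h2 (by omega) h')
  · omega

theorem treated_descend {r r' : ℕ} (hr : k r = d) :
    Treated k d (lastIdx k r d) r' ↔ r' = r ∨ Treated k d (r + 1) r' := by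
  have h2 : lastIdx k r d ≤ r' → r' < r → k r' ≠ d := lastIdx_gap
  have h3 := lastIdx_le k r d
  unfold Treated
  constructor
  · rintro (h | ⟨h, h'⟩)
    · omega
    · by_cases h4 : r' < r
      · exact absurd h (h2 h' h4)
      · omega
  · rintro (rfl | h | ⟨h, h'⟩) <;> omega

/-- The sum of the bucket number and the number of treated records grows by one in every round, be
it an advance or a descent. It serves both as termination measure and as tick count. -/
theorem treatedCard_advance {n : ℕ} (hk : ∀ r < m, k r < n)
    (h₁ : d + 1 < n → r₁ = lastIdx k m (d + 1)) :
    treatedCard k m (d + 1) r₁ = treatedCard k m d 0 := by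
  unfold treatedCard
  congr 1
  exact Finset.filter_congr fun r hr => treated_advance hk (Finset.mem_range.1 hr) h₁

theorem treatedCard_descend {r : ℕ} (hr : k r = d) (hm : r < m) :
    treatedCard k m d (lastIdx k r d) = treatedCard k m d (r + 1) + 1 := by
  unfold treatedCard
  rw [← Finset.card_insert_of_notMem (a := r) (by simp [Treated, hr])]
  congr 1
  ext r'
  simp only [Finset.mem_filter, Finset.mem_range, Finset.mem_insert, treated_descend hr]
  constructor
  · tauto
  · rintro (rfl | h) <;> tauto

theorem Refining.advance (h : Refining m R k v d 0 nm nw) {n : ℕ} (hk : ∀ r < m, k r < n)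
    (h₁ : d + 1 < n → r₁ = lastIdx k m (d + 1)) : Refining m R k v (d + 1) r₁ nm nw := by
  have e : ∀ r < m, (Treated k (d + 1) r₁ r ↔ Treated k d 0 r) :=
    fun r hr => treated_advance hk hr h₁
  refine ⟨fun r hr h' => h.old r hr (by rwa [e r hr] at h'),
    fun r hr h' => h.new r hr (by rwa [e r hr] at h'),
    fun r hr r' hr' h1 h2 => h.eq r hr r' hr' (by rwa [e r hr] at h1) (by rwa [e r' hr'] at h2),
    h.rep, fun r hr h' hd => ?_⟩
  have := (e r hr).1 h'
  unfold Treated at this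
  omega

variable {r x : ℕ} {nm' nw' : ℕ → ℕ}

/-- The next record of the bucket has the name of an earlier one. -/
theorem Refining.hit (h : Refining m R k v d (r + 1) nm nw) (hR : Equivalence R)
    (hv : ∀ r < m, v r < m ∧ R (v r) r) (hvR : ∀ r < m, ∀ r' < m, R r r' → v r = v r')
    (hr : r < m) (hd : k r = d) (hx : k (nw (v r)) = d)
    (hnm : ∀ j, nm' j = if j = r then nw (v r) else nm j) :
    Refining m R k v d (lastIdx k r d) nm' nw := by
  have e := fun r' => treated_descend (k := k) (r' := r') hd
  have hw := h.rep _ (hv r hr).1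
  have hcur : ∀ r' < m, Treated k d (r + 1) r' → R r r' → k r' = d → nw (v r) = nm r' := by
    intro r' hr' h1 h2 h3
    rw [hvR r hr r' hr' h2, h.cur r' hr' h1 h3]
  refine ⟨fun r' hr' h' => ?_, fun r' hr' h' => ?_, fun r' hr' r'' hr'' h' h'' hR' hk' => ?_,
    h.rep, fun r' hr' h' hk' => ?_⟩
  · rw [e, not_or] at h'
    rw [hnm, if_neg h'.1, h.old r' hr' h'.2]
  · rw [hnm]
    split_ifs with hj
    · subst hj
      exact ⟨hw.1, hR.trans hw.2 (hv r' hr').2, hx.trans hd.symm⟩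
    · exact h.new r' hr' (((e r').1 h').resolve_left hj)
  · rw [hnm, hnm]
    split_ifs with hj hj' hj'
    · rfl
    · subst hj
      exact hcur r'' hr'' (((e r'').1 h'').resolve_left hj') hR' (by rw [← hk', hd])
    · subst hj'
      exact (hcur r' hr' (((e r').1 h').resolve_left hj) (hR.symm hR') (by rw [hk', hd])).symm
    · exact h.eq r' hr' r'' hr'' (((e r').1 h').resolve_left hj)
        (((e r'').1 h'').resolve_left hj') hR' hk'
  · rw [hnm]
    split_ifs with hj
    · rw [hj]
    · exact h.cur r' hr' (((e r').1 h').resolve_left hj) hk'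

/-- The next record of the bucket obtains a new name. -/
theorem Refining.miss (h : Refining m R k v d (r + 1) nm nw) (hR : Equivalence R)
    (hv : ∀ r < m, v r < m ∧ R (v r) r) (hvR : ∀ r < m, ∀ r' < m, R r r' → v r = v r')
    (hr : r < m) (hd : k r = d) (hx : k (nw (v r)) ≠ d)
    (hnm : ∀ j, nm' j = if j = r then r else nm j)
    (hnw : ∀ j, nw' j = if j = v r then r else nw j) :
    Refining m R k v d (lastIdx k r d) nm' nw' := by
  have e := fun r' => treated_descend (k := k) (r' := r') hd
  -- A treated record of this bucket with the same old name would have left in `nw` a record whose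
  -- digit is `d`, contrary to `hx`.
  have hcur : ∀ r' < m, Treated k d (r + 1) r' → k r' = d → v r' ≠ v r := by
    intro r' hr' h1 h3 h4
    rw [← h4, h.cur r' hr' h1 h3, (h.new r' hr' h1).2.2] at hx
    exact hx h3
  refine ⟨fun r' hr' h' => ?_, fun r' hr' h' => ?_, fun r' hr' r'' hr'' h' h'' hR' hk' => ?_,
    fun y hy => ?_, fun r' hr' h' hk' => ?_⟩
  · rw [e, not_or] at h'
    rw [hnm, if_neg h'.1, h.old r' hr' h'.2]
  · rw [hnm]
    split_ifs with hj
    · subst hj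
      exact ⟨hr, hR.refl _, rfl⟩
    · exact h.new r' hr' (((e r').1 h').resolve_left hj)
  · rw [hnm, hnm]
    split_ifs with hj hj' hj'
    · rfl
    · subst hj
      exact absurd (hvR r' hr r'' hr'' hR').symm
        (hcur r'' hr'' (((e r'').1 h'').resolve_left hj') (by rw [← hk', hd]))
    · subst hj'
      exact absurd (hvR r' hr' r'' hr hR')
        (hcur r' hr' (((e r').1 h').resolve_left hj) (by rw [hk', hd]))
    · exact h.eq r' hr' r'' hr'' (((e r').1 h').resolve_left hj)
        (((e r'').1 h'').resolve_left hj') hR' hk'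
  · rw [hnw]
    split_ifs with hj
    · subst hj
      exact ⟨hr, hR.symm (hv r hr).2⟩
    · exact h.rep y hy
  · rw [hnm, hnw]
    by_cases hj : r' = r
    · subst hj; simp
    · rw [if_neg hj, if_neg (hcur r' hr' (((e r').1 h').resolve_left hj) hk')]
      exact h.cur r' hr' (((e r').1 h').resolve_left hj) hk'

end

/-! ### The bucket refinement as a program -/

/-- Emptying the buckets. -/
def clearBuckets : Cmd :=
  .asg .d (.c 0) ;;
  .loop (.v .d) (.v .n) (.st .HD (.v .d) (.c 0) ;; .asg .d (.v .d +ₑ .c 1))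

/-- Distributing the records to the buckets of their digits `t`. -/
def distribute (t : ℕ) : Cmd :=
  .asg .r (.c 0) ;;
  .loop (.v .r) (.v .m) (
    .asg .d (.ld (.K t) (.v .r)) ;;
    .st .LK (.v .r) (.ld .HD (.v .d)) ;;
    .st .HD (.v .d) (.v .r +ₑ .c 1) ;;
    .st .NW (.v .r) (.v .r) ;;
    .asg .r (.v .r +ₑ .c 1))

/-- Traversing the buckets, refining the names. -/
def traverse (t : ℕ) : Cmd :=
  .asg .d (.c 0) ;; .asg .r (.ld .HD (.c 0)) ;;
  .loop (.v .d) (.v .n) (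
    .ite (.v .r) (.c 0)
      (.asg .d (.v .d +ₑ .c 1) ;; .asg .r (.ld .HD (.v .d)))
      (.asg .r (.v .r -ₑ .c 1) ;; .asg .z (.ld .NM (.v .r)) ;; .asg .x (.ld .NW (.v .z)) ;;
        .ite (.ld (.K t) (.v .x)) (.v .d)
          (.st .NM (.v .r) (.v .x))
          (.st .NW (.v .z) (.v .r) ;; .st .NM (.v .r) (.v .r)) ;;
        .asg .r (.ld .LK (.v .r))))

/-- Naming the records by their digits. -/
def rename (D : ℕ) : Cmd :=
  .asg .r (.c 0) ;;
  .loop (.v .r) (.v .m) (.st .NM (.v .r) (.c 0) ;; .asg .r (.v .r +ₑ .c 1)) ;;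
  .rep D fun t => clearBuckets ;; distribute t ;; traverse t

section

variable {E : Env} {H n m t : ℕ} {s : St}

theorem clearBuckets_spec (hH : Fits E H) (hn : s.v .n = n) (hnH : n < H) :
    wp E clearBuckets (fun s' => (∀ d < n, s'.a .HD d = 0) ∧ s'.ticks = s.ticks + n) s := by
  have := hH.lt
  refine ⟨by simp, wp_mono _ (wp_for n (fun j s' => s'.v .d = j ∧ s'.v .n = n ∧
    (∀ d < j, s'.a .HD d = 0) ∧ s'.ticks = s.ticks + j) ?_ ?_ ?_) fun s' h => ⟨h.2.2.1, h.2.2.2⟩⟩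
  · simp [hn]
  · rintro j hj s' ⟨h1, h2, h3, h4⟩
    have := hH.row j (by omega)
    simp [h1, h2, this, hH.w_ne]
    exact ⟨by omega, by omega, fun d hd hdj => h3 d (by omega), by omega⟩
  · rintro s' ⟨h1, h2, -⟩
    simp [h1, h2]

theorem distribute_spec (hH : Fits E H) (hm : s.v .m = m) (hnH : n < H)
    (hmH : m < H) (hk : ∀ r < m, s.a (.K t) r < n) (h0 : ∀ d < n, s.a .HD d = 0) :
    wp E (distribute t) (fun s' => (∀ d < n, s'.a .HD d = lastIdx (s.a (.K t)) m d) ∧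
      (∀ r < m, s'.a .LK r = lastIdx (s.a (.K t)) r (s.a (.K t) r)) ∧
      (∀ r < m, s'.a .NW r = r) ∧ s'.ticks = s.ticks + m) s := by
  have := hH.lt
  refine ⟨by simp, wp_mono _ (wp_for m (fun j s' => s'.v .r = j ∧ s'.v .m = m ∧
    s'.a (.K t) = s.a (.K t) ∧ (∀ d < n, s'.a .HD d = lastIdx (s.a (.K t)) j d) ∧
      (∀ r < j, s'.a .LK r = lastIdx (s.a (.K t)) r (s.a (.K t) r)) ∧
      (∀ r < j, s'.a .NW r = r) ∧ s'.ticks = s.ticks + j) ?_ ?_ ?_) fun s' h => h.2.2.2⟩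
  · simpa [hm, lastIdx] using h0
  · rintro j hj s' ⟨h1, h2, h3, h4, h5, h6, h7⟩
    have r1 := hH.row j (by omega)
    have hkj := hk j hj
    have r2 := hH.row (s.a (.K t) j) (by omega)
    simp [h1, h2, h3, r1, r2, hH.w_ne]
    refine ⟨by omega, by omega, fun d hd => ?_, fun r hr => ?_,
      fun r hr => ?_, by omega⟩
    · simp only [lastIdx]
      split_ifs with h h' h'
      · rfl
      · exact absurd h.symm h'
      · exact absurd h'.symm h
      · exact h4 d hd
    · split_ifs with h
      · subst h; exact h4 _ hkj
      · exact h5 r (by omega)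
    · split_ifs with h
      · exact h.symm
      · exact h6 r (by omega)
  · rintro s' ⟨h1, h2, -⟩
    simp [h1, h2]

/-- Each round either moves to the next bucket or treats one record, whence the bound of `n + m`
rounds. The relation `R` stands for agreement in the earlier digits; the result refines it by the
digit `k`. -/
theorem traverse_spec (hH : Fits E H) (hn : s.v .n = n) (h0n : 0 < n)
    (hnH : n < H) (hmH : m < H) {k v : ℕ → ℕ} (hkt : s.a (.K t) = k) (hk : ∀ r < m, k r < n)
    {R : ℕ → ℕ → Prop} (hR : Equivalence R) (hnm : s.a .NM = v)
    (hv : ∀ r < m, v r < m ∧ R (v r) r) (hvR : ∀ r < m, ∀ r' < m, R r r' → v r = v r')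
    (hHD : ∀ d < n, s.a .HD d = lastIdx k m d)
    (hLK : ∀ r < m, s.a .LK r = lastIdx k r (k r)) (hNW : ∀ r < m, s.a .NW r = r) :
    wp E (traverse t) (fun s' => (∀ r < m, s'.a .NM r < m ∧ R (s'.a .NM r) r ∧
        k (s'.a .NM r) = k r) ∧
      (∀ r < m, ∀ r' < m, R r r' → k r = k r' → s'.a .NM r = s'.a .NM r') ∧
      s'.ticks ≤ s.ticks + n + m) s := by
  have hlt := hH.lt
  have hrow := hH.row
  have hw := hH.w_ne
  refine ⟨by simp, ?_⟩
  simp only [wp_seq, wp_asg]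
  refine ⟨by simp [hrow 0 (by omega)], wp_mono _ (wp_while (fun s' =>
    s'.v .n = n ∧ s'.a (.K t) = k ∧ s'.a .HD = s.a .HD ∧ s'.a .LK = s.a .LK ∧
    s'.v .d ≤ n ∧ (s'.v .d < n → s'.v .r ≤ m ∧ (s'.v .r = 0 ∨ k (s'.v .r - 1) = s'.v .d)) ∧
    Refining m R k v (s'.v .d) (s'.v .r) (s'.a .NM) (s'.a .NW) ∧
    s'.ticks = s.ticks + s'.v .d + treatedCard k m (s'.v .d) (s'.v .r))
    (fun s' => n + m - (s'.v .d + treatedCard k m (s'.v .d) (s'.v .r))) ?_ ?_) ?_⟩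
  · simp only [St.setV_v, St.setV_a, St.setV_ticks, Ex.eval, if_true, if_false, reduceCtorEq, hn, hkt]
    have he : ∀ r < m, ¬ Treated k 0 (s.a .HD 0) r := by
      rintro r hr (h | ⟨h, h'⟩)
      · omega
      · rw [hHD 0 h0n] at h'
        exact lastIdx_gap h' hr h
    refine ⟨trivial, trivial, trivial, trivial, by omega, fun _ => ?_, ⟨?_, ?_, ?_, ?_, ?_⟩, ?_⟩
    · rw [hHD 0 h0n]
      exact ⟨lastIdx_le .., lastIdx_hit⟩
    · intro r _ _; rw [hnm]
    · intro r hr h; exact absurd h (he r hr)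
    · intro r hr _ _ h; exact absurd h (he r hr)
    · intro x hx; rw [hNW x hx]; exact ⟨hx, hR.refl x⟩
    · intro r hr h; exact absurd h (he r hr)
    · rw [treatedCard, Finset.filter_false_of_mem fun r hr => he r (Finset.mem_range.1 hr)]
      rfl
  · rintro s' ⟨e1, e2, e3, e4, e5, e6, e7, e8⟩
    refine ⟨trivial, trivial, fun hne => ?_⟩
    simp only [Ex.eval, e1] at hne
    have hd : s'.v .d < n := by omega
    obtain ⟨g1, g2⟩ := e6 hd
    have hc := treatedCard_le k m (s'.v .d) (s'.v .r)
    refine ⟨by simp, by simp, fun hr => ?_, fun hr => ?_⟩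
    · simp at hr
      have r1 := hrow (s'.v .d + 1) (by omega)
      have hadv : s'.v .d + 1 < n → s'.a .HD (s'.v .d + 1) = lastIdx k m (s'.v .d + 1) :=
        fun h => by rw [e3, hHD _ h]
      simp [r1, hw, e1, e2, e3, e4]
      simp only [e3] at hadv
      rw [treatedCard_advance hk hadv, e8, hr]
      rw [hr] at hc
      refine ⟨by omega, ⟨by omega, fun h => ?_, Refining.advance (hr ▸ e7) hk hadv, by omega⟩,
        by omega⟩
      rw [hadv h]
      exact ⟨lastIdx_le .., lastIdx_hit⟩
    · simp at hr
      obtain ⟨r, hr'⟩ : ∃ r, s'.v .r = r + 1 := ⟨s'.v .r - 1, by omega⟩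
      rw [hr'] at e7 e8 g1 g2 hc
      have hkr : k r = s'.v .d := by simpa using g2
      have hvr := e7.old r (by omega) (by unfold Treated; omega)
      have hvl := (hv r (by omega)).1
      have hwl := (e7.rep _ hvl).1
      have r1 := hrow r (by omega)
      have r2 := hrow _ (hvl.trans hmH)
      have r3 := hrow _ (hwl.trans hmH)
      have hcard := treatedCard_descend (d := s'.v .d) hkr (show r < m by omega)
      have hle := treatedCard_le k m (s'.v .d) (lastIdx k r (s'.v .d))
      have hdes : ∀ x, x < n → lastIdx k r (s'.v .d) ≤ m := fun _ _ =>
        (lastIdx_le k r (s'.v .d)).trans (by omega)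
      have hhit := lastIdx_hit (k := k) (ρ := r) (d := s'.v .d)
      have hL := hLK r (by omega)
      rw [hkr] at hL
      simp [hr', hw, e1, e2, e3, e4, r1, r2, r3, hvr, hL]
      refine ⟨fun hx => ?_, fun hx => ?_⟩
      · refine ⟨⟨e5, fun h => ⟨hdes _ h, hhit⟩,
          e7.hit hR hv hvR (by omega) hkr hx fun j => ?_, by omega⟩, by omega⟩
        simp
      · refine ⟨⟨e5, fun h => ⟨hdes _ h, hhit⟩,
          e7.miss hR hv hvR (by omega) hkr hx (fun j => ?_) fun j => ?_, by omega⟩, by omega⟩ <;>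
        simp
  · rintro s' ⟨⟨e1, e2, e3, e4, e5, e6, e7, e8⟩, hb⟩
    simp only [Ex.eval, e1] at hb
    have ht : ∀ r < m, Treated k (s'.v .d) (s'.v .r) r := fun r hr => .inl (hb ▸ hk r hr)
    refine ⟨fun r hr => e7.new r hr (ht r hr),
      fun r hr r' hr' => e7.eq r hr r' hr' (ht r hr) (ht r' hr'), ?_⟩
    have := treatedCard_le k m (s'.v .d) (s'.v .r)
    omega

end

/-- Two records agree in their first `t` digits. -/
def SameDigits (a : Arr → ℕ → ℕ) (t r r' : ℕ) : Prop := ∀ t' < t, a (.K t') r = a (.K t') r'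

theorem sameDigits_equivalence (a : Arr → ℕ → ℕ) (t : ℕ) : Equivalence (SameDigits a t) :=
  ⟨fun _ _ _ => rfl, fun h t' ht => (h t' ht).symm, fun h h' t' ht => (h t' ht).trans (h' t' ht)⟩

/-- Records have equal names if and only if all of their digits agree, and the name of a record is
a record with the same name. -/
theorem rename_spec {E : Env} {H n m : ℕ} {s : St} (hH : Fits E H) (hn : s.v .n = n)
    (hm : s.v .m = m) (h0n : 0 < n) (hnH : n < H) (hmH : m < H)
    (hk : ∀ t < E.D, ∀ r < m, s.a (.K t) r < n) :
    wp E (rename E.D) (fun s' => (∀ r < m, s'.a .NM r < m ∧ SameDigits s.a E.D (s'.a .NM r) r) ∧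
      (∀ r < m, ∀ r' < m, SameDigits s.a E.D r r' → s'.a .NM r = s'.a .NM r') ∧
      s'.ticks ≤ s.ticks + m + E.D * (2 * (n + m))) s := by
  have := hH.lt
  refine ⟨by simp, ?_⟩
  rw [wp_seq]
  refine wp_call (wp_for m (fun j s' => s'.v .r = j ∧ (∀ r < j, s'.a .NM r = 0) ∧ s'.v .m = m ∧
    s'.ticks = s.ticks + j) ?_ ?_ ?_) ?_
  · simp [hm]
  · rintro j hj s' ⟨h1, h2, h3, h4⟩
    have := hH.row j (by omega)
    simp [h1, h3, this, hH.w_ne]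
    exact ⟨by omega, by omega, fun r hr hrj => h2 r (by omega), by omega⟩
  · rintro s' ⟨h1, h2, h3, h4⟩
    simp [h1, h3]
  rintro s1 ⟨-, h2, h3, h4⟩ f1
  refine wp_mono _ (wp_rep E.D (fun t s' => s'.v .n = n ∧ s'.v .m = m ∧
    (∀ t, s'.a (.K t) = s.a (.K t)) ∧ (∀ r < m, s'.a .NM r < m ∧
      SameDigits s.a t (s'.a .NM r) r) ∧
      (∀ r < m, ∀ r' < m, SameDigits s.a t r r' → s'.a .NM r = s'.a .NM r') ∧
      s'.ticks ≤ s.ticks + m + t * (2 * (n + m))) ?_ ?_) fun s' h => h.2.2.2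
  · refine ⟨?_, h3, fun t => ?_, fun r hr => ?_, fun r hr r' hr' _ => ?_, by omega⟩
    · rw [f1.v _ (by simp)]; simpa using hn
    · rw [f1.a _ (by simp)]; rfl
    -- Before the first digit all records are equivalent, and record `0` names them all.
    · rw [h2 r hr]; exact ⟨by omega, fun t ht => absurd ht (by omega)⟩
    · rw [h2 r hr, h2 r' hr']
  · rintro t ht s2 ⟨e1, e2, e3, e4, e5, e6⟩
    simp only [wp_seq]
    refine wp_call (clearBuckets_spec hH e1 hnH) ?_
    rintro s3 ⟨g1, g2⟩ f3
    have k3 : ∀ t, s3.a (.K t) = s.a (.K t) := fun t => by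
      rw [f3.a _ (by simp [clearBuckets]), e3]
    have n3 : s3.v .n = n := by rw [f3.v _ (by simp [clearBuckets]), e1]
    have m3 : s3.v .m = m := by rw [f3.v _ (by simp [clearBuckets]), e2]
    rw [wp_seq]
    refine wp_call (distribute_spec (t := t) hH m3 hnH hmH (by rw [k3]; exact hk t ht) g1) ?_
    rintro s4 ⟨i1, i2, i3, i4⟩ f4
    have k4 : ∀ t, s4.a (.K t) = s.a (.K t) := fun t => by
      rw [f4.a _ (by simp [distribute]), k3]
    have n4 : s4.v .n = n := by rw [f4.v _ (by simp [distribute]), n3]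
    have m4 : s4.v .m = m := by rw [f4.v _ (by simp [distribute]), m3]
    have v4 : s4.a .NM = s2.a .NM := by
      rw [f4.a _ (by simp [distribute]), f3.a _ (by simp [clearBuckets])]
    rw [k3] at i1 i2
    refine wp_call (traverse_spec (t := t) hH n4 h0n hnH hmH (k4 t) (hk t ht)
      (sameDigits_equivalence s.a t) v4 e4 e5 i1 i2 i3) ?_
    rintro s5 ⟨j1, j2, j3⟩ f5
    refine ⟨by rw [f5.v _ (by simp [traverse]), n4], by rw [f5.v _ (by simp [traverse]), m4],
      fun t => by rw [f5.a _ (by simp [traverse]), k4], fun r hr => ?_, fun r hr r' hr' h => ?_, ?_⟩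
    · obtain ⟨p1, p2, p3⟩ := j1 r hr
      refine ⟨p1, fun t' ht' => ?_⟩
      rcases Nat.lt_succ_iff_lt_or_eq.1 ht' with h | rfl
      · exact p2 t' h
      · exact p3
    · exact j2 r hr r' hr' (fun t' ht' => h t' (by omega)) (h t (by omega))
    · rw [add_one_mul]; omega

end WordRAM

namespace WordRAM

/-! ### Removing duplicate records -/

/-- Copying the digits of record `r` to record `u`. -/
def copyDigits (D : ℕ) : Cmd := .rep D fun t => .st (.K t) (.v .u) (.ld (.K t) (.v .r))

/-- Copying record `r` to record `u`. -/
def copyRecord (D : ℕ) : Cmd :=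
  .st .I (.v .u) (.ld .I (.v .r)) ;; .st .J (.v .u) (.ld .J (.v .r)) ;; copyDigits D

/-- Removing the records that are not their own name. -/
def compact (D : ℕ) : Cmd :=
  .asg .u (.c 0) ;; .asg .r (.c 0) ;;
  .loop (.v .r) (.v .m) (
    .ite (.ld .NM (.v .r)) (.v .r) (copyRecord D ;; .asg .u (.v .u +ₑ .c 1)) .skip ;;
    .asg .r (.v .r +ₑ .c 1))

/-- Removing duplicate records, and resetting the capacity of the list of records. -/
def flush (D : ℕ) : Cmd :=
  rename D ;; compact D ;; .asg .m (.v .u) ;; .asg .cap (.v .u +ₑ .v .u +ₑ .v .n)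

section

variable {E : Env} {H n m : ℕ} {s : St}

theorem copyDigits_spec {u r : ℕ} (hH : Fits E H) (hu : s.v .u = u) (hr : s.v .r = r)
    (huH : u < H) (hrH : r < H) :
    wp E (copyDigits E.D) (fun s' => (∀ t x, s'.a (.K t) x =
      if t < E.D ∧ x = u then s.a (.K t) r else s.a (.K t) x) ∧ s'.ticks = s.ticks) s := by
  refine wp_mono _ (wp_rep E.D (fun T s' => (s'.v = s.v) ∧ (∀ t x, s'.a (.K t) x =
      if t < T ∧ x = u then s.a (.K t) r else s.a (.K t) x) ∧ s'.ticks = s.ticks) ?_ ?_)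
      fun s' h => h.2
  · simp
  · rintro T hT s' ⟨h1, h2, h3⟩
    have r1 := hH.row u huH
    have r2 := hH.row r hrH
    simp [h1, h2, hu, hr, r1, r2, h3]
    intro t x
    split_ifs <;> first | rfl | omega | (simp_all; try omega)

/-- The records `0, .., u - 1` of `a'` are those records among `0, .., j - 1` of `a` that are their
own names. -/
structure Compacted (D : ℕ) (a a' : Arr → ℕ → ℕ) (j u : ℕ) : Prop where
  le : u ≤ j
  orig : ∀ x < u, ∃ r < j, a .NM r = r ∧ a' .I x = a .I r ∧ a' .J x = a .J r ∧
    ∀ t < D, a' (.K t) x = a (.K t) r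
  all : ∀ r < j, a .NM r = r → ∃ x < u, ∀ t < D, a' (.K t) x = a (.K t) r
  inj : ∀ x < u, ∀ y < u, SameDigits a' D x y → x = y

/-- The write position `u` never passes the read position, so the compaction works in place. Every
class has at most one record that is its own name, which makes the kept records distinct. -/
theorem compact_spec (hH : Fits E H) (hm : s.v .m = m) (hmH : m < H)
    (hnm : ∀ r < m, ∀ r' < m, SameDigits s.a E.D r r' → s.a .NM r = s.a .NM r') :
    wp E (compact E.D) (fun s' => Compacted E.D s.a s'.a m (s'.v .u) ∧
      s'.ticks = s.ticks + m) s := by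
  have := hH.lt
  refine ⟨by simp, ?_⟩
  rw [wp_seq]
  refine ⟨by simp, wp_mono _ (wp_for m (fun j s' => s'.v .r = j ∧ s'.v .m = m ∧
    s'.a .NM = s.a .NM ∧ (∀ x, j ≤ x → s'.a .I x = s.a .I x ∧ s'.a .J x = s.a .J x ∧
      ∀ t, s'.a (.K t) x = s.a (.K t) x) ∧ Compacted E.D s.a s'.a j (s'.v .u) ∧
    s'.ticks = s.ticks + j) ?_ ?_ ?_) fun s' h => h.2.2.2.2⟩
  · simp [hm]
    exact ⟨by omega, fun x hx => by simp at hx, fun x hx => by omega, fun x hx => by omega⟩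
  · rintro j hj s' ⟨h1, h2, h3, h4, h5, h6⟩
    have r1 := hH.row j (by omega)
    have hu := h5.le
    have r2 := hH.row (s'.v .u) (by omega)
    refine ⟨by simp, by simp, by simp [h1, h2]; omega, ?_⟩
    rw [wp_seq, wp_ite]
    refine ⟨by simp [h1, r1], by simp, fun hb => ?_, fun hb => ?_⟩
    · simp [h1, h3] at hb
      simp [copyRecord, h1, r1, r2]
      refine wp_call (copyDigits_spec hH rfl (by simpa using h1) (by simp; omega) (by omega)) ?_
      rintro s1 ⟨k1, k2⟩ f1
      have hI := f1.a .I (by simp [copyDigits])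
      have hJ := f1.a .J (by simp [copyDigits])
      have hN := f1.a .NM (by simp [copyDigits])
      have hr := f1.v .r (by simp [copyDigits])
      have hu' := f1.v .u (by simp [copyDigits])
      have hm' := f1.v .m (by simp [copyDigits])
      simp [h1, h2, h3] at hI hJ hN hr hu' hm' k1 k2
      have hI' : ∀ x, s1.a .I x = if x = s'.v .u then s'.a .I j else s'.a .I x := fun x => by
        rw [hI]; simp
      have hJ' : ∀ x, s1.a .J x = if x = s'.v .u then s'.a .J j else s'.a .J x := fun x => by
        rw [hJ]; simp
      simp [hr, hu', hm', hN, hH.w_ne]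
      refine ⟨by omega, by omega, fun x hx => ?_, ?_, by omega⟩
      · rw [hI', hJ', if_neg (by omega), if_neg (by omega)]
        refine ⟨(h4 x (by omega)).1, (h4 x (by omega)).2.1, fun t => ?_⟩
        rw [k1, if_neg (by omega)]
        exact (h4 x (by omega)).2.2 t
      · obtain ⟨hIj, hJj, hKj⟩ := h4 j le_rfl
        have hKold : ∀ x < s'.v .u, ∀ t, s1.a (.K t) x = s'.a (.K t) x := fun x hx t => by
          rw [k1, if_neg (by omega)]
        have hKnew : ∀ t < E.D, s1.a (.K t) (s'.v .u) = s.a (.K t) j := fun t ht => by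
          rw [k1, if_pos ⟨ht, rfl⟩, hKj]
        -- A kept record with the digits of `j` stems from some `r < j`. Both are their own names,
        -- and equal digits force equal names.
        have hfresh : ∀ x < s'.v .u, ¬ SameDigits s1.a E.D x (s'.v .u) := by
          intro x hx hsame
          obtain ⟨r, hr1, hr2, -, -, hr3⟩ := h5.orig x hx
          have : SameDigits s.a E.D r j := fun t ht => by
            rw [← hr3 t ht, ← hKnew t ht, ← hsame t ht, hKold x hx]
          have := hnm r (by omega) j hj this
          omega
        refine ⟨by omega, fun x hx => ?_, fun r hr hrn => ?_, fun x hx y hy hxy => ?_⟩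
        · rcases Nat.lt_succ_iff_lt_or_eq.1 hx with h | rfl
          · obtain ⟨r, hr1, hr2, hr3, hr4, hr5⟩ := h5.orig x h
            refine ⟨r, by omega, hr2, ?_, ?_, fun t ht => ?_⟩
            · rw [hI', if_neg (by omega), hr3]
            · rw [hJ', if_neg (by omega), hr4]
            · rw [hKold x h, hr5 t ht]
          · refine ⟨j, by omega, hb, ?_, ?_, hKnew⟩
            · rw [hI', if_pos rfl, hIj]
            · rw [hJ', if_pos rfl, hJj]
        · rcases Nat.lt_succ_iff_lt_or_eq.1 hr with h | rfl
          · obtain ⟨x, hx, hx'⟩ := h5.all r h hrn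
            exact ⟨x, by omega, fun t ht => by rw [hKold x hx, hx' t ht]⟩
          · exact ⟨s'.v .u, by omega, hKnew⟩
        · rcases Nat.lt_succ_iff_lt_or_eq.1 hx with h | rfl <;>
            rcases Nat.lt_succ_iff_lt_or_eq.1 hy with h' | rfl
          · exact h5.inj x h y h' fun t ht => by rw [← hKold x h, ← hKold y h', hxy t ht]
          · exact absurd hxy (hfresh x h)
          · exact absurd (fun t ht => (hxy t ht).symm) (hfresh y h')
          · rfl
    · simp [h1, h3] at hb
      simp [h1, h2, h3, hH.w_ne]
      refine ⟨by omega, fun x hx => h4 x (by omega), ⟨by omega, fun x hx => ?_, fun r hr hrn => ?_,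
        h5.inj⟩, by omega⟩
      · obtain ⟨r, hr, h⟩ := h5.orig x hx
        exact ⟨r, by omega, h⟩
      · rcases Nat.lt_succ_iff_lt_or_eq.1 hr with h | rfl
        · exact h5.all r h hrn
        · exact absurd hrn hb
  · rintro s' ⟨h1, h2, -⟩
    simp [h1, h2]

/-- The records `0, .., m' - 1` of `a'` represent the records `0, .., m - 1` of `a`, each vector of
digits once. -/
structure Deduplicated (D : ℕ) (a a' : Arr → ℕ → ℕ) (m m' : ℕ) : Prop where
  le : m' ≤ m
  orig : ∀ x < m', ∃ r < m, a' .I x = a .I r ∧ a' .J x = a .J r ∧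
    ∀ t < D, a' (.K t) x = a (.K t) r
  all : ∀ r < m, ∃ x < m', ∀ t < D, a' (.K t) x = a (.K t) r
  inj : ∀ x < m', ∀ y < m', SameDigits a' D x y → x = y

/-- The name of a record is its own name, because it has the same digits; so every class survives
the compaction. The new capacity is chosen such that `u + n` insertions precede the next removal,
enough to pay for it. -/
theorem flush_spec (hH : Fits E H) (hn : s.v .n = n) (hm : s.v .m = m) (h0n : 0 < n) (hnH : n < H)
    (hmH : m < H) (hk : ∀ t < E.D, ∀ r < m, s.a (.K t) r < n) :
    wp E (flush E.D) (fun s' => Deduplicated E.D s.a s'.a m (s'.v .m) ∧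
      s'.v .cap = 2 * s'.v .m + n ∧
      s'.ticks ≤ s.ticks + (2 * E.D + 2) * (n + m)) s := by
  have hlt := hH.lt
  rw [flush, wp_seq]
  refine wp_call (rename_spec hH hn hm h0n hnH hmH hk) ?_
  rintro s1 ⟨h1, h2, h3⟩ f1
  have hv : ∀ x : Var, x = .n ∨ x = .m → s1.v x = s.v x := by
    rintro x (rfl | rfl) <;>
      exact f1.v _ (by simp [rename, clearBuckets, distribute, traverse])
  have ha : ∀ a : Arr, (a = .I ∨ a = .J ∨ ∃ t, a = .K t) → s1.a a = s.a a := by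
    rintro a (rfl | rfl | ⟨t, rfl⟩) <;>
      exact f1.a _ (by simp [rename, clearBuckets, distribute, traverse])
  have hK : ∀ t, s1.a (.K t) = s.a (.K t) := fun t => ha _ (.inr (.inr ⟨t, rfl⟩))
  have hsame : ∀ r r', SameDigits s1.a E.D r r' ↔ SameDigits s.a E.D r r' := fun r r' => by
    simp [SameDigits, hK]
  rw [wp_seq]
  refine wp_call (compact_spec (m := m) hH (by rw [hv _ (.inr rfl), hm]) hmH
    (by simpa only [hsame] using h2)) ?_
  rintro s2 ⟨h4, h5⟩ f2
  have hn2 : s2.v .n = n := by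
    rw [f2.v _ (by simp [compact, copyRecord, copyDigits]), hv _ (.inl rfl), hn]
  have hle := h4.le
  simp [hn2]
  refine ⟨by omega, ⟨hle, fun x hx => ?_, fun r hr => ?_, h4.inj⟩, by omega, ?_⟩
  · obtain ⟨r, hr, -, e1, e2, e3⟩ := h4.orig x hx
    exact ⟨r, hr, by rw [e1, ha _ (.inl rfl)],
      by rw [e2, ha _ (.inr (.inl rfl))],
      fun t ht => by rw [e3 t ht, hK]⟩
  · obtain ⟨p1, p2⟩ := h1 r hr
    obtain ⟨x, hx, hx'⟩ := h4.all (s1.a .NM r) p1 (h2 _ p1 _ hr p2)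
    exact ⟨x, hx, fun t ht => by rw [hx' t ht, hK, p2 t ht]⟩
  · have e : (2 * E.D + 2) * (n + m) = E.D * (2 * (n + m)) + 2 * (n + m) := by ring
    omega

end

end WordRAM

namespace TextFingerprint

/-! ### First occurrences and maximal locations -/

section

variable {n σ : ℕ} {s : Fin n → Fin σ} {i j q : ℕ}

/-- The rank of the letter at position `p`. -/
def letter (s : Fin n → Fin σ) (p : ℕ) : ℕ := if h : p - 1 < n then s ⟨p - 1, h⟩ else 0

theorem letter_succ (p : Fin n) : letter s (p + 1) = s p := by
  simp [letter]

theorem letter_lt {p : ℕ} (h1 : 1 ≤ p) (hn : p ≤ n) : letter s p < σ := by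
  rw [letter, dif_pos (by omega)]; exact (s _).2

theorem letter_eq {p : ℕ} (h1 : 1 ≤ p) (hn : p ≤ n) : letter s p = s ⟨p - 1, by omega⟩ := by
  rw [letter, dif_pos]

theorem mem_fingerprint_iff {x : Fin σ} (hi : 1 ≤ i) :
    x ∈ fingerprint s i j ↔ ∃ r, i ≤ r ∧ r ≤ j ∧ r ≤ n ∧ letter s r = x := by
  simp only [fingerprint, Finset.mem_image, Finset.mem_filter, Finset.mem_univ, true_and]
  constructor
  · rintro ⟨p, ⟨h1, h2⟩, rfl⟩
    exact ⟨p + 1, h1, h2, by omega, letter_succ p⟩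
  · rintro ⟨r, h1, h2, h3, h4⟩
    refine ⟨⟨r - 1, by omega⟩, ⟨by simp; omega, by simp; omega⟩, Fin.ext ?_⟩
    rw [← h4, letter_eq (by omega) h3]

theorem isMaximalLocation_iff :
    IsMaximalLocation s i j ↔ 1 ≤ i ∧ i ≤ j ∧ j ≤ n ∧
      (1 < i → ∀ r, i ≤ r → r ≤ j → letter s r ≠ letter s (i - 1)) ∧
      (j < n → ∀ r, i ≤ r → r ≤ j → letter s r ≠ letter s (j + 1)) := by
  unfold IsMaximalLocation
  refine and_congr_right fun h1 => and_congr_right fun h2 => and_congr_right fun h3 =>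
    and_congr ⟨fun h h4 r h5 h6 e => ?_, fun h p hp hm => ?_⟩
      ⟨fun h h4 r h5 h6 e => ?_, fun h p hp hm => ?_⟩
  · refine h ⟨i - 2, by omega⟩ (by simp; omega) ((mem_fingerprint_iff h1).2 ⟨r, h5, h6, by omega, ?_⟩)
    rw [e, letter_eq (by omega) (by omega)]; rfl
  · obtain ⟨r, h4, h5, h6, h7⟩ := (mem_fingerprint_iff h1).1 hm
    exact h (by omega) r h4 h5 (by rw [h7, ← hp, letter_succ])
  · refine h ⟨j, h4⟩ rfl ((mem_fingerprint_iff h1).2 ⟨r, h5, h6, by omega, ?_⟩)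
    rw [e, letter_eq (by omega) (by omega)]; rfl
  · obtain ⟨r, h4, h5, h6, h7⟩ := (mem_fingerprint_iff h1).1 hm
    exact h (by omega) r h4 h5 (by rw [h7, ← hp, letter_succ])

theorem mem_maximalLocations {e : ℕ × ℕ} :
    e ∈ maximalLocations s ↔ IsMaximalLocation s e.1 e.2 := by
  simp only [maximalLocations, Finset.mem_filter, Finset.mem_product, Finset.mem_Icc,
    and_iff_right_iff_imp]
  rintro ⟨h1, h2, h3, -⟩
  omega

/-- Position `q` carries the first occurrence of its letter from position `i` on. -/
def IsFirst (s : Fin n → Fin σ) (i q : ℕ) : Prop :=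
  i ≤ q ∧ q ≤ n ∧ ∀ r, i ≤ r → r < q → letter s r ≠ letter s q

/-- `q` is the next first occurrence after `p`, or `n + 1`. -/
structure Link (s : Fin n → Fin σ) (i p q : ℕ) : Prop where
  lt : p < q
  le : q ≤ n + 1
  first : q = n + 1 ∨ IsFirst s i q
  gap : ∀ r, p < r → r < q → ¬ IsFirst s i r

/-- Every letter that occurs has a first occurrence. -/
theorem exists_isFirst {r : ℕ} (hr : i ≤ r) (hn : r ≤ n) :
    ∃ q, IsFirst s i q ∧ q ≤ r ∧ letter s q = letter s r := by
  induction r using Nat.strong_induction_on with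
  | _ r ih =>
    by_cases h : ∃ r', i ≤ r' ∧ r' < r ∧ letter s r' = letter s r
    · obtain ⟨r', h1, h2, h3⟩ := h
      obtain ⟨q, h4, h5, h6⟩ := ih r' h2 h1 (by omega)
      exact ⟨q, h4, by omega, h6.trans h3⟩
    · push Not at h
      exact ⟨r, ⟨hr, hn, h⟩, le_rfl, rfl⟩

theorem IsFirst.unique {q q' : ℕ} (h : IsFirst s i q) (h' : IsFirst s i q')
    (e : letter s q = letter s q') : q = q' := by
  rcases Nat.lt_trichotomy q q' with h1 | h1 | h1
  · exact absurd e (h'.2.2 q h.1 h1)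
  · exact h1
  · exact absurd e.symm (h.2.2 q' h'.1 h1)

theorem isFirst_self (hi : i ≤ n) : IsFirst s i i := ⟨le_rfl, hi, fun _ h1 h2 => by omega⟩

/-- Moving the start one step to the left adds the new position and removes at most one old one, the
former first occurrence of the same letter. -/
theorem isFirst_pred {q : ℕ} (hi : 1 ≤ i) (hin : i ≤ n) : IsFirst s (i - 1) q ↔
    q = i - 1 ∨ (IsFirst s i q ∧ letter s q ≠ letter s (i - 1)) := by
  constructor
  · rintro ⟨h1, h2, h3⟩
    by_cases h : q = i - 1
    · exact .inl h
    · exact .inr ⟨⟨by omega, h2, fun r h4 h5 => h3 r (by omega) h5⟩,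
        (h3 (i - 1) le_rfl (by omega)).symm⟩
  · rintro (rfl | ⟨⟨h1, h2, h3⟩, h4⟩)
    · exact ⟨le_rfl, by omega, fun _ h1 h2 => by omega⟩
    · refine ⟨by omega, h2, fun r h5 h6 => ?_⟩
      rcases Nat.eq_or_lt_of_le h5 with h | h
      · exact h ▸ h4.symm
      · exact h3 r (by omega) h6

/-- The fingerprint of a longer substring. -/
theorem fingerprint_link {q' : ℕ} (hi : 1 ≤ i) (hq : IsFirst s i q) (h : Link s i q q') :
    ∃ x : Fin σ, (x : ℕ) = letter s q ∧ x ∉ fingerprint s i (q - 1) ∧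
      fingerprint s i (q' - 1) = insert x (fingerprint s i (q - 1)) := by
  obtain ⟨h1, h2, h3⟩ := hq
  have hlt := h.lt
  have hle := h.le
  refine ⟨s ⟨q - 1, by omega⟩, (letter_eq (by omega) h2).symm, fun hm => ?_, ?_⟩
  · obtain ⟨r, h4, h5, h6, h7⟩ := (mem_fingerprint_iff hi).1 hm
    exact h3 r h4 (by omega) (by rw [h7, letter_eq (by omega) h2])
  · ext x
    rw [Finset.mem_insert, mem_fingerprint_iff hi, mem_fingerprint_iff hi]
    constructor
    · rintro ⟨r, h4, h5, h6, h7⟩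
      obtain ⟨r', h8, h9, h10⟩ := exists_isFirst (s := s) h4 h6
      by_cases hr : r' = q
      · left
        exact Fin.ext (by rw [← h7, ← h10, hr, letter_eq (by omega) h2])
      · right
        have : r' < q := by
          by_contra hh
          exact h.gap r' (by omega) (by omega) h8
        exact ⟨r', h8.1, by omega, by omega, by rw [h10, h7]⟩
    · rintro (rfl | ⟨r, h4, h5, h6, h7⟩)
      · exact ⟨q, h1, by omega, h2, letter_eq (by omega) h2⟩
      · exact ⟨r, h4, by omega, h6, h7⟩

/-! ### Maximal locations along the list of first occurrences -/

/-- No occurrence of the letter `y` from `i` to before `q`. -/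
def Avoids (s : Fin n → Fin σ) (i q y : ℕ) : Prop := ∀ r, i ≤ r → r < q → letter s r ≠ y

/-- Between two consecutive first occurrences only letters seen before recur, so checking the
letters at list nodes is enough. -/
theorem Avoids.link {q' y : ℕ} (h : Avoids s i q y) (hy : letter s q ≠ y)
    (hl : Link s i q q') : Avoids s i q' y := by
  intro r h1 h2 h3
  have := hl.le
  obtain ⟨r', h4, h5, h6⟩ := exists_isFirst (s := s) h1 (by omega : r ≤ n)
  rcases Nat.lt_trichotomy r' q with h7 | h7 | h7
  · exact h r' h4.1 h7 (h6.trans h3)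
  · exact hy (h7 ▸ h6.trans h3)
  · exact hl.gap r' h7 (by omega) h4

/-- The letter before position `i`, and the number `n` if there is none. -/
def precedingLetter (s : Fin n → Fin σ) (i : ℕ) : ℕ := if 1 < i then letter s (i - 1) else n

/-- The maximal locations that start at `i` and end before the next first occurrence. -/
theorem isMaximalLocation_of_link {q' : ℕ} (hi : 1 ≤ i) (hq : IsFirst s i q) (h : Link s i q q')
    (ha : Avoids s i q' (precedingLetter s i)) : IsMaximalLocation s i (q' - 1) := by
  have h1 := h.lt
  have h2 := h.le
  have h3 := hq.1
  refine isMaximalLocation_iff.2 ⟨hi, by omega, by omega, fun hi1 r h4 h5 => ?_, fun hj r h4 h5 => ?_⟩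
  · have := ha r h4 (by omega)
    rwa [precedingLetter, if_pos hi1] at this
  · rcases h.first with h6 | h6
    · omega
    · rw [show q' - 1 + 1 = q' by omega]
      exact h6.2.2 r h4 (by omega)

/-- If a location is maximal and `j < n`, then `j + 1` is a first occurrence. No first occurrence
lies strictly between `q` and `q'`, which leaves `q' - 1` as the only end in this range. -/
theorem maximal_lt_link_iff {q' : ℕ} (hi : 1 ≤ i) (hq : IsFirst s i q) (h : Link s i q q')
    (ha : Avoids s i q' (precedingLetter s i)) :
    (IsMaximalLocation s i j ∧ j < q') ↔ j = q' - 1 ∨ (IsMaximalLocation s i j ∧ j < q) := by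
  have h1 := h.lt
  have h2 := h.le
  have h3 := hq.1
  constructor
  · rintro ⟨hm, hj⟩
    by_cases hjq : j < q
    · exact .inr ⟨hm, hjq⟩
    · left
      by_contra hne
      obtain ⟨-, h4, h5, -, h6⟩ := isMaximalLocation_iff.1 hm
      exact h.gap (j + 1) (by omega) (by omega) ⟨by omega, by omega, fun r h7 h8 =>
        h6 (by omega) r h7 (by omega)⟩
  · rintro (rfl | ⟨hm, hj⟩)
    · exact ⟨isMaximalLocation_of_link hi hq h ha, by omega⟩
    · exact ⟨hm, by omega⟩

/-- All maximal locations that start at `i` end before the next occurrence of the letter before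
`i`. -/
theorem IsMaximalLocation.lt_of_letter (hσ : σ ≤ n) (h : IsMaximalLocation s i j) (hiq : i ≤ q)
    (hq : q = n + 1 ∨ letter s q = precedingLetter s i) (hqn : q ≤ n + 1) : j < q := by
  obtain ⟨h1, h2, h3, h4, -⟩ := isMaximalLocation_iff.1 h
  rcases hq with hq | hq
  · omega
  · by_contra hj
    unfold precedingLetter at hq
    split_ifs at hq with hi
    · exact h4 hi q hiq (by omega) hq
    · have := letter_lt (s := s) (p := q) (by omega) (by omega)
      omega

/-! ### Updating the list for the next start -/

/-- The successors of first occurrences. -/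
def IsFirstList (s : Fin n → Fin σ) (i : ℕ) (nx : ℕ → ℕ) : Prop :=
  ∀ p, IsFirst s i p → Link s i p (nx p)

/-- Moving a letter to the front of the list. -/
theorem IsFirstList.pred {nx nx' : ℕ → ℕ} {p : ℕ} (hi : 1 < i) (hin : i ≤ n)
    (h : IsFirstList s i nx) (hend : nx (n + 1) = n + 1)
    (hq : q = n + 1 ∨ IsFirst s i q ∧ letter s q = letter s (i - 1))
    (hp : p = i - 1 ∧ q = i ∨ IsFirst s i p ∧ nx p = q)
    (ha : Avoids s i q (letter s (i - 1)))
    (hnx : ∀ r, nx' r = if r = p then nx q else if r = i - 1 then i else nx r) :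
    IsFirstList s (i - 1) nx' := by
  have hpq : p < q := by
    rcases hp with ⟨h1, h2⟩ | ⟨h1, h2⟩
    · omega
    · rw [← h2]; exact (h p h1).lt
  have hip : i - 1 ≤ p := by
    rcases hp with ⟨h1, h2⟩ | ⟨h1, h2⟩
    · omega
    · have := h1.1; omega
  have hgap : ∀ r, p < r → r < q → ¬ IsFirst s i r := by
    rcases hp with ⟨h1, h2⟩ | ⟨h1, h2⟩
    · intros; omega
    · rw [← h2]; exact (h p h1).gap
  intro r hr
  rw [isFirst_pred (by omega) hin] at hr
  rw [hnx]
  -- The node `p` skips `q`, the old first occurrence of the letter at `i - 1`, or the sentinel `n +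
  -- 1`, which is its own successor. If `q = i`, then `p` is the new node `i - 1` itself.
  by_cases hrp : r = p
  · rw [if_pos hrp]
    subst hrp
    rcases hq with rfl | ⟨hq, hqy⟩
    · rw [hend]
      refine ⟨hpq, le_rfl, .inl rfl, fun r' h1 h2 h3 => ?_⟩
      rcases (isFirst_pred (by omega) hin).1 h3 with h4 | ⟨h4, -⟩
      · omega
      · exact hgap r' h1 h2 h4
    · obtain ⟨l1, l2, l3, l4⟩ := h q hq
      refine ⟨by omega, l2, l3.imp id fun l3 => (isFirst_pred (by omega) hin).2 (.inr ⟨l3, ?_⟩),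
        fun r' h1 h2 h3 => ?_⟩
      · rw [← hqy]
        exact (l3.2.2 q hq.1 l1).symm
      · rcases (isFirst_pred (by omega) hin).1 h3 with h4 | ⟨h4, h5⟩
        · omega
        · rcases Nat.lt_trichotomy r' q with h6 | h6 | h6
          · exact hgap r' h1 h6 h4
          · exact h5 (h6 ▸ hqy)
          · exact l4 r' h6 h2 h4
  · rw [if_neg hrp]
    by_cases hri : r = i - 1
    · rw [if_pos hri]
      -- Here `i - 1` is not `p`, so the letter at `i` differs from the one at `i - 1`, and `i`
      -- stays the successor.
      have hp' : IsFirst s i p := by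
        rcases hp with ⟨h1, -⟩ | ⟨h1, -⟩
        · omega
        · exact h1
      have := hp'.1
      refine ⟨by omega, by omega, .inr ((isFirst_pred (by omega) hin).2
        (.inr ⟨isFirst_self hin, ha i le_rfl (by omega)⟩)), fun r' h1 h2 => by omega⟩
    · rw [if_neg hri]
      obtain ⟨hf, hy⟩ := hr.resolve_left hri
      obtain ⟨l1, l2, l3, l4⟩ := h r hf
      have hfi := hf.1
      -- The successor of any other node remains valid unless it is the removed `q`, whose only
      -- predecessor is `p`.
      refine ⟨l1, l2, l3.imp id fun l3 => (isFirst_pred (by omega) hin).2 (.inr ⟨l3, fun e => ?_⟩),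
        fun r' h1 h2 h3 => ?_⟩
      · rcases hq with rfl | ⟨hq, hqy⟩
        · exact ha _ l3.1 (by have := l3.2.1; omega) e
        · have hu := l3.unique hq (e.trans hqy.symm)
          rw [hu] at l1 l4
          rcases Nat.lt_trichotomy r p with h1 | h1 | h1
          · refine l4 p h1 hpq (hp.resolve_left fun h2 => by omega).1
          · exact hrp h1
          · exact hgap r h1 l1 hf
      · rcases (isFirst_pred (by omega) hin).1 h3 with h4 | ⟨h4, -⟩
        · omega
        · exact l4 r' h1 h2 h4

/-! ### Fingerprints and maximal locations -/

/-- Every fingerprint has a maximal location. -/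
theorem exists_maximalLocation {f : Finset (Fin σ)} (hf : f ∈ fingerprints s) :
    ∃ e ∈ maximalLocations s, fingerprint s e.1 e.2 = f := by
  -- A location that is not maximal can be extended at one end without a new letter; this decreases
  -- `i + (n - j)`.
  have main : ∀ d i j, i + (n - j) = d → 1 ≤ i → i ≤ j → j ≤ n →
      ∃ e ∈ maximalLocations s, fingerprint s e.1 e.2 = fingerprint s i j := by
    intro d
    induction d using Nat.strong_induction_on with
    | _ d ih =>
      intro i j hd h1 h2 h3
      by_cases hm : IsMaximalLocation s i j
      · exact ⟨(i, j), mem_maximalLocations.2 hm, rfl⟩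
      · rw [isMaximalLocation_iff] at hm
        by_cases hl : 1 < i ∧ ∃ r, i ≤ r ∧ r ≤ j ∧ letter s r = letter s (i - 1)
        · obtain ⟨hi, r, h4, h5, h6⟩ := hl
          obtain ⟨e, he, hf⟩ := ih (i - 1 + (n - j)) (by omega) (i - 1) j rfl (by omega) (by omega)
            h3
          refine ⟨e, he, hf.trans ?_⟩
          ext x
          rw [mem_fingerprint_iff (by omega), mem_fingerprint_iff h1]
          constructor
          · rintro ⟨r', h7, h8, h9, h10⟩
            by_cases hr : r' = i - 1
            · exact ⟨r, h4, h5, by omega, by rw [h6, ← hr, h10]⟩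
            · exact ⟨r', by omega, h8, h9, h10⟩
          · rintro ⟨r', h7, h8, h9, h10⟩
            exact ⟨r', by omega, h8, h9, h10⟩
        · have hl' : 1 < i → ∀ r, i ≤ r → r ≤ j → letter s r ≠ letter s (i - 1) :=
            fun hi r h4 h5 h6 => hl ⟨hi, r, h4, h5, h6⟩
          have : ¬ (j < n → ∀ r, i ≤ r → r ≤ j → letter s r ≠ letter s (j + 1)) :=
            fun h => hm ⟨h1, h2, h3, hl', h⟩
          push Not at this
          obtain ⟨hj, r, h4, h5, h6⟩ := this
          obtain ⟨e, he, hf⟩ := ih (i + (n - (j + 1))) (by omega) i (j + 1) rfl h1 (by omega)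
            (by omega)
          refine ⟨e, he, hf.trans ?_⟩
          ext x
          rw [mem_fingerprint_iff (by omega), mem_fingerprint_iff h1]
          constructor
          · rintro ⟨r', h7, h8, h9, h10⟩
            by_cases hr : r' = j + 1
            · exact ⟨r, h4, h5, by omega, by rw [h6, ← hr, h10]⟩
            · exact ⟨r', h7, by omega, h9, h10⟩
          · rintro ⟨r', h7, h8, h9, h10⟩
            exact ⟨r', h7, by omega, h9, h10⟩
  simp only [fingerprints, Finset.mem_image, Finset.mem_filter, Finset.mem_product,
    Finset.mem_Icc] at hf
  obtain ⟨e, ⟨⟨⟨h1, -⟩, -, h2⟩, h3⟩, rfl⟩ := hf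
  exact main _ _ _ rfl h1 h3 h2

theorem fingerprint_mem_fingerprints {e : ℕ × ℕ} (he : e ∈ maximalLocations s) :
    fingerprint s e.1 e.2 ∈ fingerprints s := by
  simp only [maximalLocations, Finset.mem_filter] at he
  simp only [fingerprints, Finset.mem_image, Finset.mem_filter]
  exact ⟨e, ⟨he.1, he.2.2.1⟩, rfl⟩

theorem fingerprint_empty (hi : 1 ≤ i) : fingerprint s i (i - 1) = ∅ := by
  ext x
  rw [mem_fingerprint_iff hi]
  simp only [Finset.notMem_empty, iff_false]
  rintro ⟨r, h1, h2, -⟩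
  omega

end

end TextFingerprint

namespace WordRAM

open TextFingerprint

/-! ### Enumerating the maximal locations -/

/-- Adding the letter `x` to the current hash value, and storing the latter in record `m`. -/
def absorb (D : ℕ) : Cmd := .rep D fun t =>
  .st (.CU t) (.c 0) ((.ld (.CU t) (.c 0) +ₑ .ld (.R t) (.v .x)) %ₑ .v .n) ;;
  .st (.K t) (.v .m) (.ld (.CU t) (.c 0))

/-- Resetting the current hash value. -/
def resetHash (D : ℕ) : Cmd := .rep D fun t => .st (.CU t) (.c 0) (.c 0)

/-- Visiting the first occurrence `q`, and recording the location that ends before the next one. -/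
def visit (D : ℕ) (hook : Cmd) : Cmd :=
  .asg .x (.ld .S (.v .q)) ;; .asg .p (.v .q) ;; .asg .q (.ld .NX (.v .q)) ;; absorb D ;;
  .st .I (.v .m) (.v .i) ;; .st .J (.v .m) (.v .q -ₑ .c 1) ;; .asg .m (.v .m +ₑ .c 1) ;; hook

/-- Recording the maximal locations that start at `i`, and moving the letter before `i` to the front
of the list of first occurrences. -/
def scan (D : ℕ) (hook : Cmd) : Cmd :=
  -- The stopping letter is also written behind the sequence, at position `n + 1`, so one comparison
  -- detects both its next copy and the end of the list. Linking `i - 1` to `i` provides the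
  -- predecessor `p` of the first node.
  .asg .y (.ld .S (.v .i -ₑ .c 1)) ;; .st .S (.v .n +ₑ .c 1) (.v .y) ;;
  .st .NX (.v .i -ₑ .c 1) (.v .i) ;; .asg .p (.v .i -ₑ .c 1) ;; .asg .q (.v .i) ;;
  resetHash D ;;
  .loop (.ld .S (.v .q)) (.v .y) (visit D hook) ;;
  .st .NX (.v .p) (.ld .NX (.v .q)) ;; .asg .i (.v .i -ₑ .c 1)

/-- Recording all maximal locations. -/
def enumerate (D : ℕ) (hook : Cmd) : Cmd :=
  .asg .i (.v .n) ;; .loop (.v .i) (.c 0) (scan D hook)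

/-- Digit `t` of the hash value of a set of letters. -/
def hashDigit {σ : ℕ} (rr : ℕ → ℕ → ℕ) (n t : ℕ) (f : Finset (Fin σ)) : ℕ :=
  (∑ x ∈ f, rr t x) % n

/-- The maximal locations that start after `i`, or start at `i` and end before `q`. -/
def emitted {n σ : ℕ} (s : Fin n → Fin σ) (i q : ℕ) : Finset (ℕ × ℕ) :=
  (maximalLocations s).filter fun e => i < e.1 ∨ (e.1 = i ∧ e.2 < q)

/-- The command `hook` maintains the property `Rec F b` of the records, when `F` is the set of
locations recorded so far and `b` is the number of loop iterations outside of `hook`. -/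
structure Recorder {n σ : ℕ} (E : Env) (H : ℕ) (s : Fin n → Fin σ) (rr : ℕ → ℕ → ℕ) (hook : Cmd)
    (Rec : Finset (ℕ × ℕ) → ℕ → St → Prop) : Prop where
  stable : ∀ {F b k s₁ s₂}, Rec F b s₁ → s₂.v .m = s₁.v .m → s₂.v .cap = s₁.v .cap →
    s₂.a .I = s₁.a .I → s₂.a .J = s₁.a .J → (∀ t, s₂.a (.K t) = s₁.a (.K t)) →
    s₂.ticks ≤ s₁.ticks + k → Rec F (b + k) s₂
  room : ∀ {F b s₁}, Rec F b s₁ → F ⊆ maximalLocations s → s₁.v .m < H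
  push : ∀ {F b s₁ s₂} {e : ℕ × ℕ}, Rec F b s₁ → F ⊆ maximalLocations s →
    e ∈ maximalLocations s → e ∉ F → s₂.v .n = n → s₂.v .m = s₁.v .m + 1 →
    s₂.v .cap = s₁.v .cap →
    (∀ r, s₂.a .I r = if r = s₁.v .m then e.1 else s₁.a .I r) →
    (∀ r, s₂.a .J r = if r = s₁.v .m then e.2 else s₁.a .J r) →
    (∀ t < E.D, ∀ r, s₂.a (.K t) r = if r = s₁.v .m then
      hashDigit rr n t (fingerprint s e.1 e.2) else s₁.a (.K t) r) →
    s₂.ticks = s₁.ticks → wp E hook (Rec (insert e F) b) s₂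
  wv : ∀ x, x = .n ∨ x = .i ∨ x = .p ∨ x = .q ∨ x = .y → ¬ hook.wv x
  wa : ∀ a, (a = .S ∨ a = .NX ∨ (∃ t, a = .R t) ∨ ∃ t, a = .CU t) → ¬ hook.wa a

/-! ### Correctness of the enumeration -/

section

variable {n σ : ℕ} {s : Fin n → Fin σ} {E : Env} {H : ℕ} {rr : ℕ → ℕ → ℕ} {hook : Cmd}
  {Rec : Finset (ℕ × ℕ) → ℕ → St → Prop}

theorem emitted_self (i : ℕ) : emitted s i i = (maximalLocations s).filter fun e => i < e.1 := by
  refine Finset.filter_congr fun e he => ?_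
  have := (mem_maximalLocations.1 he).2.1
  omega

/-- Advancing by one node of the list adds exactly one location; this is what charges every round of
the traversal to an element of `L`. -/
theorem emitted_link {i q q' : ℕ} (hi : 1 ≤ i) (hq : IsFirst s i q) (h : Link s i q q')
    (ha : Avoids s i q' (precedingLetter s i)) :
    emitted s i q' = insert (i, q' - 1) (emitted s i q) := by
  ext ⟨i', j⟩
  simp only [emitted, Finset.mem_filter, Finset.mem_insert, Prod.mk.injEq, mem_maximalLocations]
  by_cases hii : i' = i
  · subst hii
    have := maximal_lt_link_iff (j := j) hi hq h ha
    simp only [lt_irrefl, false_or, true_and]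
    exact this
  · simp [hii]

/-- A maximal location that starts at `i` cannot contain the letter before `i`. Hence nothing is
lost by stopping at its next copy, and the set reached is the starting set for `i - 1`. -/
theorem emitted_end {i q : ℕ} (hi : 1 ≤ i) (hσ : σ ≤ n) (hiq : i ≤ q) (hqn : q ≤ n + 1)
    (hq : q = n + 1 ∨ letter s q = precedingLetter s i) :
    emitted s i q = emitted s (i - 1) (i - 1) := by
  rw [emitted_self]
  refine Finset.filter_congr fun e he => ?_
  have := mem_maximalLocations.1 he
  constructor
  · omega
  · intro h
    by_cases hie : i < e.1
    · exact .inl hie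
    · have hei : e.1 = i := by omega
      rw [hei] at this
      exact .inr ⟨hei, this.lt_of_letter hσ hiq hq hqn⟩

theorem absorb_spec {s₁ : St} {x m : ℕ} (hH : Fits E H) (hn : s₁.v .n = n) (hnH : n < H)
    (hx : s₁.v .x = x) (hxH : x < H) (hm : s₁.v .m = m) (hmH : m < H)
    (hR : ∀ t < E.D, s₁.a (.R t) x < n) (hC : ∀ t < E.D, s₁.a (.CU t) 0 < n) :
    wp E (absorb E.D) (fun s' => (∀ t < E.D, s'.a (.CU t) 0 =
        (s₁.a (.CU t) 0 + s₁.a (.R t) x) % n) ∧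
      (∀ t < E.D, ∀ r, s'.a (.K t) r = if r = m then (s₁.a (.CU t) 0 + s₁.a (.R t) x) % n
        else s₁.a (.K t) r) ∧ s'.ticks = s₁.ticks) s₁ := by
  refine wp_mono _ (wp_rep E.D (fun T s' => (s'.v = s₁.v ∧ ∀ t, s'.a (.R t) = s₁.a (.R t)) ∧
    (∀ t < T, s'.a (.CU t) 0 = (s₁.a (.CU t) 0 + s₁.a (.R t) x) % n) ∧
    (∀ t, T ≤ t → s'.a (.CU t) 0 = s₁.a (.CU t) 0 ∧ ∀ r, s'.a (.K t) r = s₁.a (.K t) r) ∧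
      (∀ t < T, ∀ r, s'.a (.K t) r = if r = m then (s₁.a (.CU t) 0 + s₁.a (.R t) x) % n
        else s₁.a (.K t) r) ∧ s'.ticks = s₁.ticks) ?_ ?_)
      fun s' h => ⟨h.2.1, h.2.2.2⟩
  · simp
  · rintro T hT s' ⟨⟨h1, h2⟩, h3, h4, h5, h6⟩
    have r0 := hH.row 0 (by omega)
    have r1 := hH.row x hxH
    have r2 := hH.row m hmH
    have := hH.lt
    have b1 := hR T hT
    have b2 := hC T hT
    have h7 := (h4 T le_rfl).1
    have h8 := (h4 T le_rfl).2
    simp [h1, h2, hn, hx, hm, r0, r1, r2, h7, h6]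
    refine ⟨by omega, fun t ht => ?_, fun t ht => ?_, fun t ht r => ?_⟩
    · split_ifs with h
      · rw [h]
      · exact h3 t (by omega)
    · rw [if_neg (by omega)]
      refine ⟨(h4 t (by omega)).1, fun r => ?_⟩
      rw [if_neg (by omega)]
      exact (h4 t (by omega)).2 r
    · by_cases h : t = T
      · subst h; simp [h8]
      · simp [h, h5 t (by omega)]

theorem resetHash_spec {s₁ : St} (hH : Fits E H) (h0 : 0 < H) :
    wp E (resetHash E.D) (fun s' => (∀ t < E.D, s'.a (.CU t) 0 = 0) ∧ s'.ticks = s₁.ticks)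
      s₁ := by
  refine wp_mono _ (wp_rep E.D (fun T s' => (∀ t < T, s'.a (.CU t) 0 = 0) ∧
    s'.ticks = s₁.ticks) ?_ ?_) fun s' h => h
  · simp
  · rintro T hT s' ⟨h1, h2⟩
    have r0 := hH.row 0 h0
    simp [r0, h2]
    intro t ht h
    exact h1 t (by omega)

/-- What is known when the traversal of the list of first occurrences for the starting position `i`
has reached `q`. -/
structure Scanning (E : Env) (s : Fin n → Fin σ) (rr : ℕ → ℕ → ℕ)
    (Rec : Finset (ℕ × ℕ) → ℕ → St → Prop) (i b : ℕ) (nx : ℕ → ℕ) (s₁ : St) : Prop where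
  vn : s₁.v .n = n
  vi : s₁.v .i = i
  vy : s₁.v .y = precedingLetter s i
  aS : ∀ r, 1 ≤ r → r ≤ n → s₁.a .S r = letter s r
  aS_zero : s₁.a .S 0 = n
  aS_end : s₁.a .S (n + 1) = precedingLetter s i
  aNX : s₁.a .NX = nx
  aR : ∀ t < E.D, ∀ x < n, s₁.a (.R t) x = rr t x
  aCU : ∀ t < E.D, s₁.a (.CU t) 0 = hashDigit rr n t (fingerprint s i (s₁.v .q - 1))
  le : i ≤ s₁.v .q
  le' : s₁.v .q ≤ n + 1
  first : s₁.v .q = n + 1 ∨ IsFirst s i (s₁.v .q)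
  prev : s₁.v .p = i - 1 ∧ s₁.v .q = i ∨ IsFirst s i (s₁.v .p) ∧ nx (s₁.v .p) = s₁.v .q
  avoids : Avoids s i (s₁.v .q) (precedingLetter s i)
  recd : Rec (emitted s i (s₁.v .q)) (b + (emitted s i (s₁.v .q)).card) s₁

/-- The hash sum is updated by the one letter that the step to the next node adds. The round itself
is counted by the cardinality of `emitted` inside `recd`; time spent in the hook is left to `Rec`.
-/
theorem Scanning.visit_spec {i b : ℕ} {nx : ℕ → ℕ} {s₁ : St} (hrec : Recorder E H s rr hook Rec)
    (hH : Fits E H) (hσ : σ ≤ n) (hi : 1 ≤ i) (hnH : n + 1 < H)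
    (hrr : ∀ t < E.D, ∀ x < n, rr t x < n) (hnx : ∀ p, IsFirst s i p → Link s i p (nx p))
    (h : Scanning E s rr Rec i b nx s₁) (hne : s₁.a .S (s₁.v .q) ≠ s₁.v .y) :
    wp E (visit E.D hook) (fun s₂ => Scanning E s rr Rec i b nx s₂ ∧
      n + 1 - s₂.v .q < n + 1 - s₁.v .q) s₁.tick := by
  have hlt := hH.lt
  obtain ⟨q, hq⟩ : ∃ q, s₁.v .q = q := ⟨_, rfl⟩
  obtain ⟨vn, vi, vy, aS, aS0, aSe, aNX, aR, aCU, le, le', first, prev, avoids, rec⟩ := h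
  rw [hq] at hne aCU le le' first prev avoids rec
  have hqf : IsFirst s i q := first.resolve_left fun h => hne (by rw [h, aSe, vy])
  have hqn := hqf.2.1
  have hSq := aS q (by omega) hqn
  have hy : letter s q ≠ precedingLetter s i := by rwa [hSq, vy] at hne
  have hlink := hnx q hqf
  have hlinkle := hlink.le
  have hlinklt := hlink.lt
  have havoid := avoids.link hy hlink
  have hx : letter s q < n := (letter_lt (by omega) hqn).trans_le hσ
  have rq := hH.row q (by omega)
  obtain ⟨x, hx1, hx2, hx3⟩ := fingerprint_link hi hqf hlink
  have hhash : ∀ t < E.D, (hashDigit rr n t (fingerprint s i (q - 1)) + rr t (letter s q)) % n =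
      hashDigit rr n t (fingerprint s i (nx q - 1)) := by
    intro t ht
    rw [hx3, hashDigit, hashDigit, Finset.sum_insert hx2, hx1, Nat.mod_add_mod, add_comm]
  have hsub : emitted s i q ⊆ maximalLocations s := Finset.filter_subset _ _
  have hmH := hrec.room rec hsub
  have rm := hH.row _ hmH
  have hmax : (i, nx q - 1) ∈ maximalLocations s :=
    mem_maximalLocations.2 (isMaximalLocation_of_link hi hqf hlink havoid)
  have hnot : (i, nx q - 1) ∉ emitted s i q := by
    simp only [emitted, Finset.mem_filter, not_and]
    intro _
    omega
  have hem := emitted_link hi hqf hlink havoid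
  rw [visit, wp_seq]
  refine ⟨by simp [hq, rq], ?_⟩
  simp only [wp_seq, wp_asg, Ex.ok, Ex.eval, St.setV_v, St.tick_v, St.setV_a, St.tick_a, hq, hSq,
    reduceCtorEq, if_false, aNX, true_and]
  refine ⟨rq, ?_⟩
  refine wp_call (absorb_spec (n := n) (x := letter s q) (m := s₁.v .m) hH (by simp [vn])
    (by omega) (by simp) (by omega) (by simp) hmH (fun t ht => ?_) (fun t ht => ?_)) ?_
  · simp only [St.setV_a, St.tick_a]
    rw [aR t ht _ hx]; exact hrr t ht _ hx
  · simp only [St.setV_a, St.tick_a]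
    rw [aCU t ht]; exact Nat.mod_lt _ (by omega)
  rintro s₂ ⟨k1, k2, k3⟩ f2
  have w2 : ∀ y, s₂.v y = _ := fun y => f2.v y (by simp [absorb])
  have w3 : ∀ a, (∀ t, a ≠ .CU t) → (∀ t, a ≠ .K t) → s₂.a a = _ := fun a h1 h2 =>
    f2.a a (by simp [absorb, h1, h2])
  simp only [St.setV_v, St.setV_a, St.tick_v, St.tick_a, St.setV_ticks, St.tick_ticks] at k1 k2 k3 w2 w3
  have w3I := w3 .I (by simp) (by simp)
  have w3J := w3 .J (by simp) (by simp)
  have w3S := w3 .S (by simp) (by simp)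
  have w3N := w3 .NX (by simp) (by simp)
  have w3R := fun t => w3 (.R t) (by simp) (by simp)
  simp only [wp_seq, wp_asg, wp_st]
  have hmM : s₁.v .m + 1 < 2 ^ E.w := by omega
  simp [w2, vi, rm, hH.w_ne]
  refine ⟨by omega, hmM, ?_⟩
  have rec' := hrec.stable (k := 1) (s₂ := s₁.tick) rec rfl rfl rfl rfl (fun _ => rfl) le_rfl
  refine wp_call (hrec.push (e := (i, nx q - 1)) rec' hsub hmax hnot ?_ ?_ ?_ ?_ ?_ ?_ ?_) ?_
  · simp [w2, vn]
  · simp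
  · simp [w2]
  · intro r; by_cases h : r = s₁.v .m <;> simp [w3I, h]
  · intro r; by_cases h : r = s₁.v .m <;> simp [w3J, h]
  · intro t ht r
    by_cases h : r = s₁.v .m <;> simp [k2 t ht, aR t ht _ hx, aCU t ht, hhash t ht, h]
  · simp [k3]
  rintro s₃ hR3 f3
  have u : ∀ x, x = .n ∨ x = .i ∨ x = .p ∨ x = .q ∨ x = .y → s₃.v x = _ := fun x hx =>
    f3.v x (hrec.wv x hx)
  have un := u .n (by simp)
  have ui := u .i (by simp)
  have up := u .p (by simp)
  have uq := u .q (by simp)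
  have uy := u .y (by simp)
  have aS3 := f3.a .S (hrec.wa _ (by simp))
  have aN3 := f3.a .NX (hrec.wa _ (by simp))
  have aR3 := fun t => f3.a (.R t) (hrec.wa _ (by simp))
  have aC3 := fun t => f3.a (.CU t) (hrec.wa _ (by simp))
  simp [w2, w3S, w3N, w3R, vn, vi, vy, aNX] at un ui up uq uy aS3 aN3 aR3 aC3
  refine ⟨⟨un, ui, uy, ?_, ?_, ?_, aN3, ?_, ?_, ?_, ?_, ?_, ?_, ?_, ?_⟩, ?_⟩
  · rw [aS3]; exact aS
  · rw [aS3]; exact aS0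
  · rw [aS3]; exact aSe
  · intro t ht; rw [aR3]; exact aR t ht
  · intro t ht; rw [aC3, uq, k1 t ht, aR t ht _ hx, aCU t ht, hhash t ht]
  · omega
  · omega
  · rw [uq]; exact hlink.first
  · rw [up, uq]; exact .inr ⟨hqf, rfl⟩
  · rw [uq]; exact havoid
  · rw [uq, hem, Finset.card_insert_of_notMem hnot, ← add_assoc]; exact hR3
  · omega

/-- What is known when the maximal locations that start after `i` have been recorded. -/
structure Enumerating (E : Env) (s : Fin n → Fin σ) (rr : ℕ → ℕ → ℕ)
    (Rec : Finset (ℕ × ℕ) → ℕ → St → Prop) (b i : ℕ) (s₁ : St) : Prop where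
  vn : s₁.v .n = n
  vi : s₁.v .i = i
  aS : ∀ r, 1 ≤ r → r ≤ n → s₁.a .S r = letter s r
  aS_zero : s₁.a .S 0 = n
  aNX_end : s₁.a .NX (n + 1) = n + 1
  aR : ∀ t < E.D, ∀ x < n, s₁.a (.R t) x = rr t x
  list : 1 ≤ i → IsFirstList s i (s₁.a .NX)
  recd : Rec (emitted s i i) (b + (emitted s i i).card) s₁

/-- The additional unit in `b + 1` pays for the round of the outer loop. The rounds of the inner one
are covered by the growth of `emitted`. -/
theorem Enumerating.scan_spec {i b : ℕ} {s₁ : St} (hrec : Recorder E H s rr hook Rec)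
    (hH : Fits E H) (hσ : σ ≤ n) (hi : 1 ≤ i) (hin : i ≤ n) (hnH : n + 1 < H)
    (hrr : ∀ t < E.D, ∀ x < n, rr t x < n) (h : Enumerating E s rr Rec b i s₁) :
    wp E (scan E.D hook) (Enumerating E s rr Rec (b + 1) (i - 1)) s₁.tick := by
  have hlt := hH.lt
  obtain ⟨vn, vi, aS, aS0, aNe, aR, list, rec⟩ := h
  have list := list hi
  have hSi : s₁.a .S (i - 1) = precedingLetter s i := by
    unfold precedingLetter
    split_ifs with h
    · exact aS _ (by omega) (by omega)
    · rw [show i - 1 = 0 by omega, aS0]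
  have r1 := hH.row (i - 1) (by omega)
  have r2 := hH.row (n + 1) (by omega)
  set nx : ℕ → ℕ := fun r => if r = i - 1 then i else s₁.a .NX r with hnxdef
  have hnx : ∀ p, IsFirst s i p → Link s i p (nx p) := fun p hp => by
    have := hp.1
    rw [hnxdef]
    simp only [if_neg (show p ≠ i - 1 by omega)]
    exact list p hp
  rw [scan]
  simp only [wp_seq, wp_asg, wp_st]
  simp [vi, vn, r1, r2, hH.w_ne]
  refine ⟨hi, by omega, hi, ?_⟩
  refine wp_call (resetHash_spec hH (by omega)) ?_
  rintro s₂ ⟨k1, k2⟩ f2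
  have w2 : ∀ y, s₂.v y = _ := fun y => f2.v y (by simp [resetHash])
  have w3 : ∀ a, (∀ t, a ≠ .CU t) → s₂.a a = _ := fun a h1 => f2.a a (by simp [resetHash, h1])
  simp at k2
  have w3S : ∀ r, s₂.a .S r = if r = n + 1 then precedingLetter s i else s₁.a .S r := fun r => by
    rw [w3 .S (by simp)]; simp [hSi]
  have w3N : s₂.a .NX = nx := by
    rw [w3 .NX (by simp)]; ext r; simp [hnxdef]
  have w3R : ∀ t, s₂.a (.R t) = s₁.a (.R t) := fun t => by rw [w3 (.R t) (by simp)]; simp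
  have hinit : Scanning E s rr Rec i (b + 1) nx s₂ := by
    have hq : s₂.v .q = i := by rw [w2]; simp
    refine ⟨?_, ?_, ?_, fun r h1 h2 => ?_, ?_, ?_, w3N, fun t ht x hx => ?_, fun t ht => ?_, ?_, ?_,
      ?_, ?_, ?_, ?_⟩
    · rw [w2]; simpa using vn
    · rw [w2]; simpa using vi
    · rw [w2]; simpa using hSi
    · rw [w3S, if_neg (by omega)]; exact aS r h1 h2
    · rw [w3S, if_neg (by omega)]; exact aS0
    · rw [w3S, if_pos rfl]
    · rw [w3R]; exact aR t ht x hx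
    · rw [hq, fingerprint_empty hi, k1 t ht]; simp [hashDigit]
    · omega
    · omega
    · rw [hq]; exact .inr (isFirst_self hin)
    · rw [hq, w2]; simp
    · rw [hq]; intro r; omega
    · rw [hq, add_right_comm]
      refine hrec.stable rec ?_ ?_ ?_ ?_ ?_ (by rw [k2])
      · rw [w2]; simp
      · rw [w2]; simp
      · rw [w3 .I (by simp)]; simp
      · rw [w3 .J (by simp)]; simp
      · intro t; rw [w3 (.K t) (by simp)]; simp
  rw [wp_seq]
  refine wp_mono _ (wp_while (Scanning E s rr Rec i (b + 1) nx) (fun s' => n + 1 - s'.v .q) hinit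
    fun s₃ h3 => ?_) ?_
  · have := h3.le'
    exact ⟨⟨trivial, hH.row _ (by simp only [Ex.eval]; omega)⟩, trivial, fun hne =>
      h3.visit_spec hrec hH hσ hi hnH hrr hnx (by simpa using hne)⟩
  · rintro s₃ ⟨h3, hb⟩
    simp only [Ex.eval, h3.vy] at hb
    obtain ⟨q, hq⟩ : ∃ q, s₃.v .q = q := ⟨_, rfl⟩
    obtain ⟨p, hp⟩ : ∃ p, s₃.v .p = p := ⟨_, rfl⟩
    obtain ⟨vn, vi, vy, aS, aS0, aSe, aNX, aR, aCU, le, le', first, prev, avoids, rec⟩ := h3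
    rw [hq] at aCU le le' first prev avoids rec hb
    rw [hp] at prev
    have hqy : q = n + 1 ∨ letter s q = precedingLetter s i :=
      first.imp id fun h => by rwa [aS q (by omega) h.2.1] at hb
    have hpn : p < n + 1 := by
      rcases prev with ⟨h1, h2⟩ | ⟨h1, h2⟩
      · omega
      · have := h1.2.1; omega
    have r3 := hH.row p (by omega)
    have r4 := hH.row q (by omega)
    have hend : nx (n + 1) = n + 1 := by
      rw [hnxdef]
      simp only [if_neg (show n + 1 ≠ i - 1 by omega), aNe]
    simp [hp, hq, r3, r4, vi, aNX, hH.w_ne]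
    refine ⟨hi, by simpa using vn, by simp, ?_, ?_, ?_, ?_, fun h1 => ?_, ?_⟩
    · simpa using aS
    · simpa using aS0
    · simp [show n + 1 ≠ p by omega, aNX, hend]
    · simpa using aR
    · have hpl : precedingLetter s i = letter s (i - 1) := by
        rw [precedingLetter, if_pos (by omega)]
      rw [hpl] at hqy avoids
      refine list.pred (q := q) (p := p) (by omega) hin aNe ?_ ?_ avoids fun r => ?_
      · rcases first with h | h
        · exact .inl h
        · exact hqy.imp id fun h' => ⟨h, h'⟩
      · refine prev.imp id fun ⟨h2, h3⟩ => ⟨h2, ?_⟩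
        have := h2.1
        rw [← h3, hnxdef]
        simp only [if_neg (show p ≠ i - 1 by omega)]
      · simp [aNX, hnxdef, show q ≠ i - 1 by omega]
    · rw [emitted_end hi hσ le le' hqy] at rec
      exact hrec.stable (k := 0) rec (by simp) (by simp) (by simp) (by simp) (by simp) (by simp)

/-- All maximal locations are recorded. -/
theorem enumerate_spec {b : ℕ} {s₁ : St} (hrec : Recorder E H s rr hook Rec)
    (hH : Fits E H) (hσ : σ ≤ n) (h0 : 0 < n) (hnH : n + 1 < H)
    (hrr : ∀ t < E.D, ∀ x < n, rr t x < n) (hn : s₁.v .n = n)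
    (aS : ∀ r, 1 ≤ r → r ≤ n → s₁.a .S r = letter s r) (aS0 : s₁.a .S 0 = n)
    (aNX : s₁.a .NX n = n + 1) (aNXe : s₁.a .NX (n + 1) = n + 1)
    (aR : ∀ t < E.D, ∀ x < n, s₁.a (.R t) x = rr t x) (hR : Rec ∅ b s₁) :
    wp E (enumerate E.D hook) (fun s₂ => s₂.v .n = n ∧
      Rec (maximalLocations s) (b + n + (maximalLocations s).card) s₂) s₁ := by
  have hlt := hH.lt
  refine ⟨by simp, wp_mono _ (wp_for n (fun j => Enumerating E s rr Rec (b + j) (n - j))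
    ?_ ?_ ?_) ?_⟩
  · have he : emitted s n n = ∅ := by
      rw [emitted_self, Finset.filter_eq_empty_iff]
      intro e he
      have hm := mem_maximalLocations.1 he
      have := hm.2.1
      have := hm.2.2.1
      omega
    refine ⟨by simpa using hn, by simpa using hn, by simpa using aS, by simpa using aS0,
      by simpa using aNXe, by simpa using aR, fun _ p hp => ?_, ?_⟩
    · obtain rfl : p = n := le_antisymm hp.2.1 hp.1
      simp [aNX]
      exact ⟨by omega, le_rfl, .inl rfl, fun r h1 h2 => by omega⟩
    · simp only [Nat.sub_zero, he, Finset.card_empty]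
      exact hrec.stable (k := 0) hR (by simp) (by simp) (by simp) (by simp) (by simp) (by simp)
  · intro j hj s₂ h
    refine ⟨trivial, by simp, by simp [h.vi]; omega, ?_⟩
    have := h.scan_spec hrec hH hσ (by omega) (by omega) hnH hrr
    rwa [add_assoc, Nat.sub_sub] at this
  · intro s₂ h
    have := h.vi
    simp [this]
  · intro s₂ h
    refine ⟨h.vn, ?_⟩
    have := h.recd
    rwa [Nat.sub_self, emitted_self, Finset.filter_true_of_mem] at this
    intro e he
    exact (mem_maximalLocations.1 he).1

end

end WordRAM

namespace WordRAM

open TextFingerprint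

/-! ### Input and output -/

/-- Moving the input to the array `S`. -/
def loadInput : Cmd :=
  .asg .i (.v .n) ;;
  .loop (.v .i) (.c 0) (.st .S (.v .i) (.raw (.v .i)) ;; .asg .i (.v .i -ₑ .c 1))

/-- Drawing the digits of the hash values of the letters. -/
def drawHashes (D : ℕ) : Cmd :=
  .asg .x (.c 0) ;;
  .loop (.v .x) (.v .n) (
    .rep D (fun t => .rand .z ;; .st (.R t) (.v .x) (.v .z %ₑ .v .n)) ;;
    .asg .x (.v .x +ₑ .c 1))

/-- Initializing the data structures. -/
def prepare (D : ℕ) : Cmd :=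
  -- The value `n` exceeds every rank because `σ ≤ n`; as the letter before position `1` it stops
  -- the last traversal only at the sentinel. The sentinel `n + 1` is its own successor, so
  -- unlinking it is harmless.
  loadInput ;; .st .S (.c 0) (.v .n) ;; .st .NX (.v .n +ₑ .c 1) (.v .n +ₑ .c 1) ;;
  .st .NX (.v .n) (.v .n +ₑ .c 1) ;; drawHashes D ;; .asg .m (.c 0) ;; .asg .cap (.v .n)

/-- Writing the pairs. -/
def writePairs : Cmd :=
  .asg .r (.c 0) ;;
  .loop (.v .r) (.v .m) (
    .asg .x (.ld .I (.v .r)) ;; .asg .y (.ld .J (.v .r)) ;;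
    .raw (.v .r +ₑ .v .r +ₑ .c 1) (.v .x) ;; .raw (.v .r +ₑ .v .r +ₑ .c 2) (.v .y) ;;
    .asg .r (.v .r +ₑ .c 1)) ;;
  .raw (.c 0) (.v .m)

/-- Writing the triples. -/
def writeTriples : Cmd :=
  .asg .r (.c 0) ;;
  .loop (.v .r) (.v .m) (
    .asg .x (.ld .I (.v .r)) ;; .asg .y (.ld .J (.v .r)) ;; .asg .z (.ld .NM (.v .r)) ;;
    .raw (.v .r +ₑ .v .r +ₑ .v .r +ₑ .c 1) (.v .x) ;;
    .raw (.v .r +ₑ .v .r +ₑ .v .r +ₑ .c 2) (.v .y) ;;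
    .raw (.v .r +ₑ .v .r +ₑ .v .r +ₑ .c 3) (.v .z) ;;
    .asg .r (.v .r +ₑ .c 1)) ;;
  .raw (.c 0) (.v .m)

/-- Digit `t` of the hash value of the letter `x`. -/
def letterDigit {w : ℕ} (ω : ℕ → Fin (2 ^ w)) (D n t x : ℕ) : ℕ := ω (x * D + t) % n

section

variable {n σ : ℕ} {s : Fin n → Fin σ} {E : Env} {H : ℕ} {s₁ : St} {m : ℕ}

attribute [simp] cell_setA

theorem cell_setA_row {a : Arr} (ha : a.code < E.W) (i p v : ℕ) :
    (s₁.setA a i v).cell E p = if p = E.W * i + a.code then v else s₁.cell E p := by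
  have := cell_setA E s₁ (E.W * i + a.code) p v
  rwa [row_mod ha, row_div ha, decode_code] at this

theorem Fits.lt_B (hH : Fits E H) {p : ℕ} (hp : p < H) : p < E.B := by
  have := (hH.row p hp).2
  have : p ≤ E.W * p := Nat.le_mul_of_pos_left p (by simp only [Env.W]; omega)
  simp only [Env.W] at *
  omega

/-- Input and arrays share the memory. Entry `i` of `S` lies at or beyond cell `i`, so moving the
letters from right to left overwrites none that is still needed. -/
theorem loadInput_spec (hH : Fits E H) (hnH : n < H) (hn : s₁.v .n = n)
    (hin : ∀ p, 1 ≤ p → p ≤ n → s₁.cell E p = letter s p) :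
    wp E loadInput (fun s₂ => (∀ p, 1 ≤ p → p ≤ n → s₂.a .S p = letter s p) ∧
      s₂.ticks = s₁.ticks + n) s₁ := by
  refine ⟨by simp, wp_mono _ (wp_for n (fun j s₂ => s₂.v .i = n - j ∧
    (∀ p, 1 ≤ p → p ≤ n - j → s₂.cell E p = letter s p) ∧
    (∀ p, n - j < p → p ≤ n → s₂.a .S p = letter s p) ∧ s₂.ticks = s₁.ticks + j) ?_ ?_ ?_) ?_⟩
  · simp only [St.setV_v, if_true, Ex.eval, hn, St.setV_cell, St.setV_a, St.setV_ticks,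
      Nat.sub_zero, add_zero, and_true, true_and]
    exact ⟨hin, fun p h1 h2 => by omega⟩
  · rintro j hj s₂ ⟨h1, h2, h3, h4⟩
    have r1 := hH.row (n - j) (by omega)
    have hle : n - j ≤ E.W * (n - j) := Nat.le_mul_of_pos_left _ (by simp only [Env.W]; omega)
    have hcell := h2 (n - j) (by omega) le_rfl
    have hc : Arr.S.code < E.W := by simp only [Arr.code, Env.W]; omega
    simp [h1, r1, hH.w_ne, hcell]
    refine ⟨by omega, hH.lt_B (by omega), by omega, by omega, fun p h5 h6 => ?_,
      fun p h5 h6 => ?_, by omega⟩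
    · rw [cell_setA_row hc, if_neg (by simp only [Arr.code]; omega)]
      exact h2 p h5 (by omega)
    · split_ifs with h
      · rw [h]
      · exact h3 p (by omega) h6
  · rintro s₂ ⟨h1, -⟩
    simp [h1]
  · rintro s₂ ⟨h1, h2, h3, h4⟩
    exact ⟨fun p h5 h6 => h3 p (by omega) h6, h4⟩

theorem drawHashes_spec (hH : Fits E H) (hnH : n < H) (hn : s₁.v .n = n)
    (hc : s₁.coins = 0) :
    wp E (drawHashes E.D) (fun s₂ => (∀ t < E.D, ∀ x < n,
      s₂.a (.R t) x = letterDigit E.ω E.D n t x) ∧ s₂.ticks = s₁.ticks + n) s₁ := by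
  have := hH.lt
  refine ⟨by simp, wp_mono _ (wp_for n (fun j s₂ => s₂.v .x = j ∧ s₂.v .n = n ∧
    s₂.coins = j * E.D ∧ (∀ t < E.D, ∀ x < j, s₂.a (.R t) x = letterDigit E.ω E.D n t x) ∧
    s₂.ticks = s₁.ticks + j) ?_ ?_ ?_) fun s₂ h => h.2.2.2⟩
  · simp [hn, hc]
  · rintro j hj s₂ ⟨h1, h2, h3, h4, h5⟩
    refine ⟨trivial, trivial, by simp [h1, h2]; omega, wp_seq.2 <|
      wp_mono _ (wp_rep E.D (fun T s₃ =>
      s₃.v .x = j ∧ s₃.v .n = n ∧ s₃.coins = j * E.D + T ∧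
      (∀ t < E.D, ∀ x < j, s₃.a (.R t) x = letterDigit E.ω E.D n t x) ∧
      (∀ t < T, s₃.a (.R t) j = letterDigit E.ω E.D n t j) ∧ s₃.ticks = s₁.ticks + j + 1) ?_ ?_)
      ?_⟩
    · simp [h1, h2, h3, h5]
      exact h4
    · rintro T hT s₃ ⟨k1, k2, k3, k4, k5, k6⟩
      have r1 := hH.row j (by omega)
      simp [k1, k2, k3, k6, r1]
      refine ⟨rfl, fun t ht x hx => ?_, fun t ht => ?_⟩
      · rw [if_neg (by omega)]
        exact k4 t ht x hx
      · split_ifs with h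
        · rw [h]; rfl
        · exact k5 t (by omega)
    · rintro s₃ ⟨k1, k2, k3, k4, k5, k6⟩
      simp [k1, k2, k3, hH.w_ne]
      refine ⟨by omega, by ring, fun t ht x hx => ?_, by omega⟩
      rcases Nat.lt_succ_iff_lt_or_eq.1 (Nat.lt_succ_of_le hx) with h | rfl
      · exact k4 t ht x h
      · exact k5 t ht
  · rintro s₂ ⟨h1, h2, -⟩
    simp [h1, h2]

theorem prepare_spec (hH : Fits E H) (hnH : n + 1 < H) (h0 : 0 < n) (hn : s₁.v .n = n)
    (hc : s₁.coins = 0) (hin : ∀ p, 1 ≤ p → p ≤ n → s₁.cell E p = letter s p) :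
    wp E (prepare E.D) (fun s₂ => s₂.v .n = n ∧ s₂.v .m = 0 ∧ s₂.v .cap = n ∧
      (∀ p, 1 ≤ p → p ≤ n → s₂.a .S p = letter s p) ∧ s₂.a .S 0 = n ∧
      s₂.a .NX n = n + 1 ∧ s₂.a .NX (n + 1) = n + 1 ∧
      (∀ t < E.D, ∀ x < n, s₂.a (.R t) x = letterDigit E.ω E.D n t x) ∧
      s₂.ticks = s₁.ticks + 2 * n) s₁ := by
  have := hH.lt
  rw [prepare, wp_seq]
  -- Frame conditions do not speak of the random words; that none is drawn here is shown by running
  -- through the loop.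
  have hcoins : ∀ Q, wp E loadInput Q s₁ → wp E loadInput (fun s₂ => Q s₂ ∧ s₂.coins = 0) s₁ := by
    rintro Q ⟨h1, k, h2⟩
    refine ⟨h1, k, ?_⟩
    have : (s₁.setV .i (Ex.eval E s₁ (.v .n))).coins = 0 := hc
    clear hin hn
    generalize s₁.setV .i (Ex.eval E s₁ (.v .n)) = s₃ at h2 this
    induction k generalizing s₃ with
    | zero => exact ⟨h2.1, h2.2.1, h2.2.2.1, h2.2.2.2, this⟩
    | succ k ih =>
      obtain ⟨g1, g2, g3, g4, g5, g6, g7, g8⟩ := h2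
      exact ⟨g1, g2, g3, g4, g5, g6, g7, ih _ g8 this⟩
  refine wp_call (hcoins _ (loadInput_spec hH (by omega) hn hin)) ?_
  rintro s₂ ⟨⟨h1, h2⟩, h3⟩ f2
  have hn2 : s₂.v .n = n := by rw [f2.v _ (by simp [loadInput]), hn]
  have r0 := hH.row 0 (by omega)
  have r1 := hH.row n (by omega)
  have r2 := hH.row (n + 1) (by omega)
  simp only [wp_seq, wp_st]
  simp [hn2, r0, r1, r2, hH.w_ne]
  refine ⟨by omega, ?_⟩
  refine wp_call (drawHashes_spec (n := n) hH (by omega) (by simpa using hn2) (by simpa using h3)) ?_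
  rintro s₃ ⟨h4, h5⟩ f3
  have g1 := f3.v .n (by simp [drawHashes])
  have g2 := f3.a .S (by simp [drawHashes])
  have g3 := f3.a .NX (by simp [drawHashes])
  simp at h5
  have g2' : ∀ p, s₃.a .S p = if p = 0 then n else s₂.a .S p := fun p => by
    rw [g2]; by_cases h : p = 0 <;> simp [h]
  simp [g1, g3, hn2]
  refine ⟨fun p h6 h7 => ?_, by simp [g2'], h4, by omega⟩
  rw [g2', if_neg (by omega)]
  exact h1 p h6 h7

theorem div_row_ne {W b j q : ℕ} (h : b < W * (j + 1)) (hq : j < q) : q ≠ b / W := by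
  have := Nat.div_lt_of_lt_mul h
  omega

/-- A row has at least eight cells, so the output of record `r` stays within the rows up to `r`.
These have been read before, row `r` into variables, and the later records are intact. -/
theorem writePairs_spec (hH : Fits E H) (hm : s₁.v .m = m) (hmH : m < H) :
    wp E writePairs (fun s₂ => s₂.cell E 0 = m ∧
      (∀ q < m, s₂.cell E (2 * q + 1) = s₁.a .I q ∧ s₂.cell E (2 * q + 2) = s₁.a .J q) ∧
      s₂.ticks = s₁.ticks + m) s₁ := by
  have := hH.lt
  refine ⟨by simp, ?_⟩
  rw [wp_seq]
  refine wp_mono _ (wp_for m (fun j s₂ => s₂.v .r = j ∧ s₂.v .m = m ∧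
    (∀ q < j, s₂.cell E (2 * q + 1) = s₁.a .I q ∧ s₂.cell E (2 * q + 2) = s₁.a .J q) ∧
    (∀ q, j ≤ q → s₂.a .I q = s₁.a .I q ∧ s₂.a .J q = s₁.a .J q) ∧
    s₂.ticks = s₁.ticks + j) ?_ ?_ ?_) ?_
  · simp [hm]
  · rintro j hj s₂ ⟨h1, h2, h3, h4, h5⟩
    have r1 := hH.row j (by omega)
    have rB := r1.2
    have hle : 8 * j ≤ E.W * j := Nat.mul_le_mul_right j (by simp only [Env.W]; omega)
    have hW : 8 ≤ E.W := by simp only [Env.W]; omega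
    have e := h4 j le_rfl
    have b1 : j + j + 1 < E.W * (j + 1) := by rw [mul_add]; omega
    have b2 : j + j + 2 < E.W * (j + 1) := by rw [mul_add]; omega
    have hw2 : 2 < 2 ^ E.w := by omega
    simp [h1, h2, r1, hH.w_ne, e, hw2]
    refine ⟨by omega, ⟨by omega, by omega⟩, by omega, ⟨by omega, by omega⟩, by omega, by omega,
      fun q hq => ?_, fun q hq => ?_, by omega⟩
    · rcases Nat.lt_or_eq_of_le hq with h | rfl
      · rw [if_neg (by omega), if_neg (by omega), if_neg (by omega), if_neg (by omega)]
        exact h3 q h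
      · rw [if_neg (by omega), if_pos (by omega), if_pos (by omega)]
        exact ⟨rfl, rfl⟩
    · have n1 : q ≠ (j + j + 1) / E.W := div_row_ne b1 (by omega)
      have n2 : q ≠ (j + j + 2) / E.W := div_row_ne b2 (by omega)
      simp only [n1, n2, and_false, if_false]
      exact h4 q (by omega)
  · rintro s₂ ⟨h1, h2, -⟩
    simp [h1, h2]
  · rintro s₂ ⟨h1, h2, h3, h4, h5⟩
    have hB := hH.lt_B (p := 0) (by omega)
    rw [wp_raw]
    refine ⟨by simp, trivial, hB, ?_, fun q hq => ?_, h5⟩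
    · rw [cell_setA]; simpa using h2
    · rw [cell_setA, cell_setA, if_neg (by simp), if_neg (by simp)]
      exact h3 q hq

/-- As for pairs, the output does not overtake the reading, since `3 * r + 3 < 8 * (r + 1)`. -/
theorem writeTriples_spec (hH : Fits E H) (hm : s₁.v .m = m) (hmH : m < H) :
    wp E writeTriples (fun s₂ => s₂.cell E 0 = m ∧
      (∀ q < m, s₂.cell E (3 * q + 1) = s₁.a .I q ∧ s₂.cell E (3 * q + 2) = s₁.a .J q ∧
        s₂.cell E (3 * q + 3) = s₁.a .NM q) ∧
      s₂.ticks = s₁.ticks + m) s₁ := by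
  have := hH.lt
  refine ⟨by simp, ?_⟩
  rw [wp_seq]
  refine wp_mono _ (wp_for m (fun j s₂ => s₂.v .r = j ∧ s₂.v .m = m ∧
    (∀ q < j, s₂.cell E (3 * q + 1) = s₁.a .I q ∧ s₂.cell E (3 * q + 2) = s₁.a .J q ∧
      s₂.cell E (3 * q + 3) = s₁.a .NM q) ∧
    (∀ q, j ≤ q → s₂.a .I q = s₁.a .I q ∧ s₂.a .J q = s₁.a .J q ∧ s₂.a .NM q = s₁.a .NM q) ∧
    s₂.ticks = s₁.ticks + j) ?_ ?_ ?_) ?_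
  · simp [hm]
  · rintro j hj s₂ ⟨h1, h2, h3, h4, h5⟩
    have r1 := hH.row j (by omega)
    have rB := r1.2
    have hle : 8 * j ≤ E.W * j := Nat.mul_le_mul_right j (by simp only [Env.W]; omega)
    have hW : 8 ≤ E.W := by simp only [Env.W]; omega
    have e := h4 j le_rfl
    have b1 : j + j + j + 1 < E.W * (j + 1) := by rw [mul_add]; omega
    have b2 : j + j + j + 2 < E.W * (j + 1) := by rw [mul_add]; omega
    have b3 : j + j + j + 3 < E.W * (j + 1) := by rw [mul_add]; omega
    have hw2 : 2 < 2 ^ E.w := by omega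
    have hw3 : 3 < 2 ^ E.w := by omega
    simp [h1, h2, r1, hH.w_ne, e, hw2, hw3]
    refine ⟨by omega, ⟨⟨by omega, by omega⟩, by omega⟩, by omega, by omega, by omega, by omega,
      by omega, by omega, fun q hq => ?_, fun q hq => ?_, by omega⟩
    · rcases Nat.lt_or_eq_of_le hq with h | rfl
      · rw [if_neg (by omega), if_neg (by omega), if_neg (by omega), if_neg (by omega),
          if_neg (by omega), if_neg (by omega), if_neg (by omega), if_neg (by omega),
          if_neg (by omega)]
        exact h3 q h
      · rw [if_neg (by omega), if_neg (by omega), if_pos (by omega), if_neg (by omega),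
          if_pos (by omega), if_pos (by omega)]
        exact ⟨rfl, rfl, rfl⟩
    · have n1 : q ≠ (j + j + j + 1) / E.W := div_row_ne b1 (by omega)
      have n2 : q ≠ (j + j + j + 2) / E.W := div_row_ne b2 (by omega)
      have n3 : q ≠ (j + j + j + 3) / E.W := div_row_ne b3 (by omega)
      simp only [n1, n2, n3, and_false, if_false]
      exact h4 q (by omega)
  · rintro s₂ ⟨h1, h2, -⟩
    simp [h1, h2]
  · rintro s₂ ⟨h1, h2, h3, h4, h5⟩
    have hB := hH.lt_B (p := 0) (by omega)
    rw [wp_raw]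
    refine ⟨by simp, trivial, hB, ?_, fun q hq => ?_, h5⟩
    · rw [cell_setA]; simpa using h2
    · rw [cell_setA, cell_setA, cell_setA, if_neg (by simp), if_neg (by simp), if_neg (by simp)]
      exact h3 q hq

end

end WordRAM

namespace WordRAM

open TextFingerprint

/-! ### The two programs -/

/-- Removing duplicate records when the list of records is full. -/
def flushIfFull (D : ℕ) : Cmd := .ite (.v .m) (.v .cap) (flush D) .skip

/-- Halting if `n < 2 ^ k`, otherwise recording the maximal locations and running `c`. -/
def mainCmd (D k : ℕ) (hook c : Cmd) : Cmd :=
  .asg .n (.raw (.c 0)) ;; .asg .z (.v .n) ;; .rep k (fun _ => .asg .z (.v .z /ₑ .c 2)) ;;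
  .ite (.v .z) (.c 0) .skip (prepare D ;; enumerate D hook ;; c)

/-- Computing the fingerprints. -/
def fingerprintsCmd (D k : ℕ) : Cmd := mainCmd D k (flushIfFull D) (flush D ;; writePairs)

/-- Computing the maximal locations and their names. -/
def locationsCmd (D k : ℕ) : Cmd := mainCmd D k .skip (rename D ;; writeTriples)

/-! ### Invariants of the list of records -/

section

variable {n σ : ℕ} {s : Fin n → Fin σ} {E : Env} {H : ℕ} {rr : ℕ → ℕ → ℕ}

/-- The digits of record `r` are those of the fingerprint of `e`. -/
def HasDigits (E : Env) (s : Fin n → Fin σ) (rr : ℕ → ℕ → ℕ) (s₁ : St) (r : ℕ) (e : ℕ × ℕ) :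
    Prop :=
  ∀ t < E.D, s₁.a (.K t) r = hashDigit rr n t (fingerprint s e.1 e.2)

/-- The first `m` records are locations from `F`, and all digits of fingerprints of these locations
occur. -/
structure Records (E : Env) (s : Fin n → Fin σ) (rr : ℕ → ℕ → ℕ) (F : Finset (ℕ × ℕ)) (m : ℕ)
    (s₁ : St) : Prop where
  mem : ∀ r < m, (s₁.a .I r, s₁.a .J r) ∈ F
  digits : ∀ r < m, HasDigits E s rr s₁ r (s₁.a .I r, s₁.a .J r)
  all : ∀ e ∈ F, ∃ r < m, HasDigits E s rr s₁ r e

theorem Records.congr {F : Finset (ℕ × ℕ)} {m : ℕ} {s₁ s₂ : St} (h : Records E s rr F m s₁)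
    (hI : s₂.a .I = s₁.a .I) (hJ : s₂.a .J = s₁.a .J) (hK : ∀ t, s₂.a (.K t) = s₁.a (.K t)) :
    Records E s rr F m s₂ := by
  obtain ⟨h1, h2, h3⟩ := h
  refine ⟨?_, ?_, ?_⟩
  · rwa [hI, hJ]
  · simpa only [HasDigits, hI, hJ, hK] using h2
  · simpa only [HasDigits, hK] using h3

theorem Records.push {F : Finset (ℕ × ℕ)} {m : ℕ} {s₁ s₂ : St} {e : ℕ × ℕ}
    (h : Records E s rr F m s₁)
    (hI : ∀ r, s₂.a .I r = if r = m then e.1 else s₁.a .I r)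
    (hJ : ∀ r, s₂.a .J r = if r = m then e.2 else s₁.a .J r)
    (hK : ∀ t < E.D, ∀ r, s₂.a (.K t) r = if r = m then
      hashDigit rr n t (fingerprint s e.1 e.2) else s₁.a (.K t) r) :
    Records E s rr (insert e F) (m + 1) s₂ := by
  have hd : HasDigits E s rr s₂ m e := fun t ht => by rw [hK t ht, if_pos rfl]
  have hd' : ∀ r < m, ∀ e', HasDigits E s rr s₁ r e' → HasDigits E s rr s₂ r e' :=
    fun r hr e' h t ht => by rw [hK t ht, if_neg hr.ne]; exact h t ht
  refine ⟨fun r hr => ?_, fun r hr => ?_, fun e' he' => ?_⟩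
  · rcases Nat.lt_succ_iff_lt_or_eq.1 hr with hr | rfl
    · rw [hI, hJ, if_neg hr.ne, if_neg hr.ne]
      exact Finset.mem_insert_of_mem (h.mem r hr)
    · rw [hI, hJ, if_pos rfl, if_pos rfl]
      exact Finset.mem_insert_self _ _
  · rcases Nat.lt_succ_iff_lt_or_eq.1 hr with hr | rfl
    · rw [hI, hJ, if_neg hr.ne, if_neg hr.ne]
      exact hd' r hr _ (h.digits r hr)
    · rw [hI, hJ, if_pos rfl, if_pos rfl]
      exact hd
  · rcases Finset.mem_insert.1 he' with rfl | he'
    · exact ⟨m, by omega, hd⟩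
    · obtain ⟨r, hr, h1⟩ := h.all e' he'
      exact ⟨r, by omega, hd' r hr _ h1⟩

theorem Records.digit_lt {F : Finset (ℕ × ℕ)} {m : ℕ} {s₁ : St} (h : Records E s rr F m s₁)
    (h0 : 0 < n) : ∀ t < E.D, ∀ r < m, s₁.a (.K t) r < n := fun t ht r hr => by
  rw [h.digits r hr t ht]; exact Nat.mod_lt _ h0

theorem Records.deduplicated {F : Finset (ℕ × ℕ)} {m m' : ℕ} {s₁ s₂ : St}
    (h : Records E s rr F m s₁) (hd : Deduplicated E.D s₁.a s₂.a m m') :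
    Records E s rr F m' s₂ := by
  refine ⟨fun x hx => ?_, fun x hx => ?_, fun e he => ?_⟩
  · obtain ⟨r, hr, h1, h2, h3⟩ := hd.orig x hx
    rw [h1, h2]; exact h.mem r hr
  · obtain ⟨r, hr, h1, h2, h3⟩ := hd.orig x hx
    rw [h1, h2]
    intro t ht
    rw [h3 t ht]
    exact h.digits r hr t ht
  · obtain ⟨r, hr, h1⟩ := h.all e he
    obtain ⟨x, hx, h2⟩ := hd.all r hr
    exact ⟨x, hx, fun t ht => (h2 t ht).trans (h1 t ht)⟩

/-- The digits are a function of the fingerprint, so distinct digit vectors belong to distinct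
fingerprints. This needs no injectivity of the hash function, and therefore the space bound holds
for all random words. -/
theorem Records.card_le {F : Finset (ℕ × ℕ)} {m u : ℕ} {s₁ : St} (h : Records E s rr F m s₁)
    (hF : F ⊆ maximalLocations s) (hu : u ≤ m)
    (hinj : ∀ x < u, ∀ y < u, SameDigits s₁.a E.D x y → x = y) :
    u ≤ (fingerprints s).card := by
  rw [← Finset.card_range u]
  refine Finset.card_le_card_of_injOn (fun r => fingerprint s (s₁.a .I r) (s₁.a .J r))
    (fun r hr => ?_) fun x hx y hy hxy => ?_
  · exact fingerprint_mem_fingerprints (hF (h.mem r (by have := Finset.mem_range.1 hr; omega)))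
  · have hx := Finset.mem_range.1 hx
    have hy := Finset.mem_range.1 hy
    refine hinj x hx y hy fun t ht => ?_
    rw [h.digits x (by omega) t ht, h.digits y (by omega) t ht]
    exact congrArg _ hxy

/-- The property of the records that the program for fingerprints maintains: the first `u` records
have distinct digits, and the records after these pay for the next removal of duplicates. -/
structure SpaceBounded (E : Env) (s : Fin n → Fin σ) (rr : ℕ → ℕ → ℕ) (F : Finset (ℕ × ℕ)) (b : ℕ)
    (s₁ : St) : Prop where
  records : Records E s rr F (s₁.v .m) s₁
  distinct : ∃ u ≤ s₁.v .m, (∀ x < u, ∀ y < u, SameDigits s₁.a E.D x y → x = y) ∧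
    s₁.v .cap = 2 * u + n ∧ s₁.v .m < s₁.v .cap ∧
    s₁.ticks + (4 * E.D + 4) * s₁.v .m ≤ b + (4 * E.D + 4) * F.card + (4 * E.D + 4) * u

/-- Amortization with credit `4 * D + 4` per record beyond the first `u`. When the list is full, `m
= 2 * u + n`, so that `n + m = 2 * (m - u)`, and the removal cost `(2 * D + 2) * (n + m)` equals the
credit of the `m - u` newer records. -/
theorem flushIfFull_recorder (hH : Fits E H) (h0 : 0 < n) (hnH : n < H)
    (hroom : 2 * (fingerprints s).card + n < H) :
    Recorder E H s rr (flushIfFull E.D) (SpaceBounded E s rr) where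
  stable {F b k s₁ s₂} h hm hcap hI hJ hK ht := by
    obtain ⟨h1, u, h2, h3, h4, h5, h6⟩ := h
    refine ⟨by rw [hm]; exact h1.congr hI hJ hK, u, by rwa [hm], ?_, by rwa [hcap],
      by rwa [hm, hcap], by rw [hm]; omega⟩
    simpa only [SameDigits, hK] using h3
  room {F b s₁} h hF := by
    obtain ⟨h1, u, h2, h3, h4, h5, h6⟩ := h
    have := h1.card_le hF h2 h3
    omega
  push {F b s₁ s₂ e} h hF he heF hn hm hcap hI hJ hK ht := by
    obtain ⟨h1, u, h2, h3, h4, h5, h6⟩ := h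
    have hu := h1.card_le hF h2 h3
    have h1' := h1.push hI hJ hK
    rw [← hm] at h1'
    have hcard := Finset.card_insert_of_notMem heF
    rw [flushIfFull, wp_ite]
    refine ⟨trivial, trivial, fun hfull => ?_, fun hfull => ?_⟩
    · simp only [Ex.eval] at hfull
      refine wp_mono _ (flush_spec hH hn rfl h0 hnH (by omega) (h1'.digit_lt h0)) ?_
      rintro s₃ ⟨k1, k2, k3⟩
      refine ⟨h1'.deduplicated k1, s₃.v .m, le_rfl, k1.inj, k2, by omega, ?_⟩
      obtain ⟨d, hd⟩ : ∃ d, s₁.v .m + 1 = u + d := ⟨s₁.v .m + 1 - u, by omega⟩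
      have e1 : n + s₂.v .m = 2 * d := by omega
      rw [e1] at k3
      have e2 : (4 * E.D + 4) * (s₁.v .m + 1) = (4 * E.D + 4) * u + (4 * E.D + 4) * d := by
        rw [hd, mul_add]
      rw [hcard]
      have e3 : (2 * E.D + 2) * (2 * d) = (4 * E.D + 4) * d := by ring
      rw [mul_add] at e2
      rw [mul_add]
      omega
    · simp only [Ex.eval] at hfull
      refine ⟨h1', u, by omega, fun x hx y hy hxy => h3 x hx y hy fun t ht' => ?_, by omega,
        by omega, ?_⟩
      · have := hxy t ht'
        rwa [hK t ht', hK t ht', if_neg (by omega), if_neg (by omega)] at this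
      · rw [hcard, hm, ht, mul_add, mul_add]
        omega
  wv x hx := by
    rcases hx with rfl | rfl | rfl | rfl | rfl <;>
      simp [flushIfFull, flush, rename, compact, copyRecord, copyDigits, clearBuckets, distribute,
        traverse]
  wa a ha := by
    rcases ha with rfl | rfl | ⟨t, rfl⟩ | ⟨t, rfl⟩ <;>
      simp [flushIfFull, flush, rename, compact, copyRecord, copyDigits, clearBuckets, distribute,
        traverse]

/-- The property of the records that the program for locations maintains. -/
structure Complete (E : Env) (s : Fin n → Fin σ) (rr : ℕ → ℕ → ℕ) (F : Finset (ℕ × ℕ)) (b : ℕ)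
    (s₁ : St) : Prop where
  records : Records E s rr F (s₁.v .m) s₁
  card : s₁.v .m = F.card
  surj : ∀ e ∈ F, ∃ r < s₁.v .m, (s₁.a .I r, s₁.a .J r) = e
  ticks : s₁.ticks ≤ b

theorem skip_recorder (hroom : (maximalLocations s).card < H) :
    Recorder E H s rr .skip (Complete E s rr) where
  stable {F b k s₁ s₂} h hm hcap hI hJ hK ht := by
    obtain ⟨h1, h2, h3, h4⟩ := h
    exact ⟨by rw [hm]; exact h1.congr hI hJ hK, by rw [hm, h2], by rwa [hm, hI, hJ], by omega⟩
  room {F b s₁} h hF := by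
    have := Finset.card_le_card hF
    have := h.card
    omega
  push {F b s₁ s₂ e} h hF he heF hn hm hcap hI hJ hK ht := by
    obtain ⟨h1, h2, h3, h4⟩ := h
    refine ⟨by rw [hm]; exact h1.push hI hJ hK, by rw [Finset.card_insert_of_notMem heF, hm, h2],
      fun e' he' => ?_, by omega⟩
    rcases Finset.mem_insert.1 he' with rfl | he'
    · exact ⟨s₁.v .m, by omega, by rw [hI, hJ, if_pos rfl, if_pos rfl]⟩
    · obtain ⟨r, hr, h5⟩ := h3 e' he'
      exact ⟨r, by omega, by rw [hI, hJ, if_neg hr.ne, if_neg hr.ne, h5]⟩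
  wv x hx := by simp
  wa a ha := by simp

/-! ### Correctness of the two programs -/

/-- The hash function is injective on the fingerprints of `s`. -/
def HashInjective (D : ℕ) (s : Fin n → Fin σ) (rr : ℕ → ℕ → ℕ) : Prop :=
  ∀ f ∈ fingerprints s, ∀ f' ∈ fingerprints s,
    (∀ t < D, hashDigit rr n t f = hashDigit rr n t f') → f = f'

/-- After `k` unrolled halvings, `z` is zero exactly if `n < 2 ^ k`. The test uses no constant above
`2`, so it is safe even if `2 ^ k` does not fit into a word. -/
theorem start_wp_mainCmd {k : ℕ} {hook c : Cmd} {Q : St → Prop} {μ : ℕ → ℕ} (hw : 2 < 2 ^ E.w)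
    (hB : 0 < E.B) (hμ : μ 0 = n)
    (h : ∀ s₁ : St, s₁.v .n = n → s₁.coins = 0 → s₁.ticks = 0 → (∀ p, s₁.cell E p = μ p) →
      (n < 2 ^ k → Q s₁) ∧
      (2 ^ k ≤ n → wp E (prepare E.D ;; enumerate E.D hook ;; c) Q s₁)) :
    wp E (mainCmd E.D k hook c) Q (St.start E μ) := by
  rw [mainCmd]
  simp only [wp_seq, wp_asg]
  refine ⟨?_, trivial, wp_mono _ (wp_rep k (fun j s₁ => s₁.v .z = n / 2 ^ j ∧ s₁.v .n = n ∧
    s₁.coins = 0 ∧ s₁.ticks = 0 ∧ ∀ p, s₁.cell E p = μ p) ?_ ?_) ?_⟩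
  · exact ⟨by simp only [Ex.ok]; omega, hB⟩
  · have h0 : (St.start E μ).cell E 0 = n := (St.start_cell E μ 0).trans hμ
    simp [Ex.eval, h0, St.start_cell]
    exact ⟨rfl, rfl⟩
  · rintro j hj s₁ ⟨h1, h2, h3, h4, h5⟩
    rw [wp_asg]
    refine ⟨?_, ?_, ?_, ?_, ?_, ?_⟩
    · simp [hw]
    · simp [h1, Nat.div_div_eq_div_mul, pow_succ]
    · simpa using h2
    · simpa using h3
    · simpa using h4
    · simpa using h5
  · rintro s₁ ⟨h1, h2, h3, h4, h5⟩
    obtain ⟨k1, k2⟩ := h s₁ h2 h3 h4 h5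
    refine ⟨trivial, by simp only [Ex.ok]; omega, fun hz => k1 ?_, fun hz => k2 ?_⟩
    · simp only [Ex.eval, h1] at hz
      simpa using (Nat.div_eq_zero_iff.1 hz)
    · simp only [Ex.eval, h1] at hz
      by_contra hlt
      exact hz (Nat.div_eq_of_lt (by omega))

theorem prepare_enumerate_spec {hook c : Cmd} {Rec : Finset (ℕ × ℕ) → ℕ → St → Prop}
    {Q : St → Prop} {s₁ : St}
    (hrec : Recorder E H s (letterDigit E.ω E.D n) hook Rec)
    (hH : Fits E H) (hσ : σ ≤ n) (h0 : 0 < n) (hnH : n + 1 < H) (hn : s₁.v .n = n)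
    (hc : s₁.coins = 0) (ht : s₁.ticks = 0)
    (hin : ∀ p, 1 ≤ p → p ≤ n → s₁.cell E p = letter s p)
    (hempty : ∀ s₂ : St, s₂.v .m = 0 → s₂.v .cap = n → s₂.ticks = 2 * n → Rec ∅ (2 * n) s₂)
    (h : ∀ s₂ : St, s₂.v .n = n → Rec (maximalLocations s) (3 * n + (maximalLocations s).card) s₂ →
      wp E c Q s₂) :
    wp E (prepare E.D ;; enumerate E.D hook ;; c) Q s₁ := by
  rw [wp_seq]
  refine wp_mono _ (prepare_spec hH hnH h0 hn hc hin) ?_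
  rintro s₂ ⟨h1, h2, h3, h4, h5, h6, h7, h8, h9⟩
  rw [wp_seq]
  refine wp_mono _ (enumerate_spec (b := 2 * n) hrec hH hσ h0 hnH
    (fun t _ x _ => Nat.mod_lt _ h0) h1 h4 h5 h6 h7 h8 (hempty s₂ h2 h3 (by omega))) ?_
  rintro s₃ ⟨k1, k2⟩
  exact h s₃ k1 (by rwa [show 2 * n + n = 3 * n by ring] at k2)

/-- Distinctness of the digits keeps any fingerprint from being listed twice. Injectivity of the
hash is needed only for completeness: the record with the digits of a given fingerprint must have
that fingerprint. -/
theorem Records.holdsFingerprints {m : ℕ} {s₁ : St} {μ : ℕ → ℕ}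
    (hinj : HashInjective E.D s rr) (h : Records E s rr (maximalLocations s) m s₁)
    (hd : ∀ x < m, ∀ y < m, SameDigits s₁.a E.D x y → x = y) (h0 : μ 0 = m)
    (hμ : ∀ q < m, μ (2 * q + 1) = s₁.a .I q ∧ μ (2 * q + 2) = s₁.a .J q) :
    HoldsFingerprints s μ := by
  have hmem : ∀ q < m, fingerprint s (s₁.a .I q) (s₁.a .J q) ∈ fingerprints s :=
    fun q hq => fingerprint_mem_fingerprints (h.mem q hq)
  rw [HoldsFingerprints, h0]
  refine ⟨fun q hq => ?_, fun q hq => ?_, fun q hq r hr hqr => ?_, fun f hf => ?_⟩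
  · rw [(hμ q hq).1, (hμ q hq).2]; exact h.mem q hq
  · simp only [(hμ q hq).1, (hμ q hq).2]
    exact hmem q hq
  · simp only [(hμ q hq).1, (hμ q hq).2, (hμ r hr).1, (hμ r hr).2] at hqr
    refine hd q hq r hr fun t ht => ?_
    rw [h.digits q hq t ht, h.digits r hr t ht]
    exact congrArg _ hqr
  · obtain ⟨e, he, rfl⟩ := exists_maximalLocation (Finset.mem_coe.1 hf)
    obtain ⟨r, hr, h1⟩ := h.all e he
    refine ⟨r, hr, ?_⟩
    simp only [(hμ r hr).1, (hμ r hr).2]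
    refine hinj _ (hmem r hr) _ (fingerprint_mem_fingerprints he) fun t ht => ?_
    rw [← h1 t ht, ← h.digits r hr t ht]

theorem Complete.holdsMaximalLocations {b m : ℕ} {s₁ : St} {μ name : ℕ → ℕ}
    (hinj : HashInjective E.D s rr) (h : Complete E s rr (maximalLocations s) b s₁)
    (hm : s₁.v .m = m)
    (hname : ∀ r < m, ∀ r' < m, name r = name r' ↔ SameDigits s₁.a E.D r r') (h0 : μ 0 = m)
    (hμ : ∀ q < m, μ (3 * q + 1) = s₁.a .I q ∧ μ (3 * q + 2) = s₁.a .J q ∧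
      μ (3 * q + 3) = name q) :
    HoldsMaximalLocations s μ := by
  obtain ⟨h1, h2, h3, -⟩ := h
  rw [hm] at h1 h2 h3
  rw [HoldsMaximalLocations, h0]
  have hmaps : Set.MapsTo (fun q => (μ (3 * q + 1), μ (3 * q + 2))) (Set.Iio m)
      (maximalLocations s : Set (ℕ × ℕ)) := fun q hq => by
    simp only [(hμ q hq).1, (hμ q hq).2.1]
    exact h1.mem q hq
  have hsurj : Set.SurjOn (fun q => (μ (3 * q + 1), μ (3 * q + 2))) (Set.Iio m)
      (maximalLocations s : Set (ℕ × ℕ)) := fun e he => by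
    obtain ⟨r, hr, rfl⟩ := h3 e he
    exact ⟨r, hr, by simp only [(hμ r hr).1, (hμ r hr).2.1]⟩
  refine ⟨⟨hmaps, ?_, hsurj⟩, fun q hq r hr => ?_⟩
  -- The number of records equals the number of locations, so listing all of them lists each one
  -- once.
  · rw [← Finset.coe_range] at hmaps hsurj ⊢
    exact Finset.injOn_of_surjOn_of_card_le _ hmaps hsurj (by simp [h2])
  · rw [(hμ q hq).1, (hμ q hq).2.1, (hμ q hq).2.2, (hμ r hr).1, (hμ r hr).2.1, (hμ r hr).2.2,
      hname q hq r hr]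
    have hK : ∀ t < E.D, (s₁.a (.K t) q = s₁.a (.K t) r ↔
        hashDigit rr n t (fingerprint s (s₁.a .I q) (s₁.a .J q)) =
          hashDigit rr n t (fingerprint s (s₁.a .I r) (s₁.a .J r))) := fun t ht => by
      rw [h1.digits q hq t ht, h1.digits r hr t ht]
    constructor
    · intro hs
      exact hinj _ (fingerprint_mem_fingerprints (h1.mem q hq)) _
        (fingerprint_mem_fingerprints (h1.mem r hr)) fun t ht => (hK t ht).1 (hs t ht)
    · intro hs t ht
      exact (hK t ht).2 (by rw [hs])

theorem init_mem_zero (P : Program) : (init P s).mem 0 = n := rfl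

theorem init_mem (P : Program) {p : ℕ} (h1 : 1 ≤ p) (hp : p ≤ n) :
    (init P s).mem p = letter s p := by
  rw [letter_eq h1 hp]
  simp only [init]
  rw [if_neg (by omega), dif_pos]

/-- A last removal leaves distinct digits. The list is then no longer than `2 * |F| + n`, and since
`|F| ≤ |L|` this removal and the output are linear in `n + |L|`, like the amortized rest. -/
theorem fingerprintsCmd_spec {k : ℕ} (P : Program) (hH : Fits E H) (hσ : σ ≤ n) (h0 : 0 < n)
    (hk : 2 ^ k ≤ n) (hnH : n + 1 < H) (hroom : 2 * (fingerprints s).card + n < H) :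
    wp E (fingerprintsCmd E.D k) (fun s₁ =>
      (HashInjective E.D s (letterDigit E.ω E.D n) → HoldsFingerprints s (s₁.cell E)) ∧
      s₁.ticks ≤ (8 * E.D + 16) * (n + (maximalLocations s).card)) (St.start E (init P s).mem) := by
  have hlt := hH.lt
  have hcard : (fingerprints s).card ≤ (maximalLocations s).card := by
    refine Finset.card_le_card_of_surjOn (fun e => fingerprint s e.1 e.2) fun f hf => ?_
    obtain ⟨e, he, rfl⟩ := exists_maximalLocation (Finset.mem_coe.1 hf)
    exact ⟨e, he, rfl⟩
  refine start_wp_mainCmd (by omega) (hH.lt_B (by omega)) (init_mem_zero P) ?_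
  intro s₁ hn hc ht hcell
  refine ⟨fun h => by omega, fun _ => ?_⟩
  refine prepare_enumerate_spec (flushIfFull_recorder hH h0 (by omega) hroom) hH hσ h0 hnH hn hc ht
    (fun p h1 h2 => by rw [hcell, init_mem P h1 h2]) (fun s₂ h1 h2 h3 => ?_) fun s₂ hn2 hs2 => ?_
  · refine ⟨⟨?_, ?_, ?_⟩, 0, by omega, ?_, by omega, by omega, ?_⟩
    · intro r hr; omega
    · intro r hr; omega
    · simp
    · intro x hx; omega
    · simp [h1, h3]
  · obtain ⟨h1, u, h2, h3, h4, h5, h6⟩ := hs2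
    have hu := h1.card_le subset_rfl h2 h3
    rw [wp_seq]
    refine wp_mono _ (flush_spec hH hn2 rfl h0 (by omega) (by omega) (h1.digit_lt h0)) ?_
    rintro s₃ ⟨k1, k2, k3⟩
    have k4 := h1.deduplicated k1
    have := k1.le
    refine wp_mono _ (writePairs_spec hH rfl (by omega)) ?_
    rintro s₄ ⟨g1, g2, g3⟩
    refine ⟨fun hinj => k4.holdsFingerprints hinj k1.inj g1 g2, ?_⟩
    set L := (maximalLocations s).card
    have e1 : (4 * E.D + 4) * u ≤ (4 * E.D + 4) * s₂.v .m := Nat.mul_le_mul_left _ h2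
    have e2 : (2 * E.D + 2) * (n + s₂.v .m) ≤ (2 * E.D + 2) * (2 * n + 2 * L) :=
      Nat.mul_le_mul_left _ (by omega)
    have e3 : (8 * E.D + 16) * (n + L) = (4 * E.D + 4) * L + (2 * E.D + 2) * (2 * n + 2 * L) +
      (4 * E.D + 12) * n + 8 * L := by ring
    have e4 : 12 * n ≤ (4 * E.D + 12) * n := Nat.mul_le_mul_right _ (by omega)
    omega

theorem locationsCmd_spec {k : ℕ} (P : Program) (hH : Fits E H) (hσ : σ ≤ n) (h0 : 0 < n)
    (hk : 2 ^ k ≤ n) (hnH : n + 1 < H) (hroom : (maximalLocations s).card < H) :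
    wp E (locationsCmd E.D k) (fun s₁ =>
      (HashInjective E.D s (letterDigit E.ω E.D n) → HoldsMaximalLocations s (s₁.cell E)) ∧
      s₁.ticks ≤ (8 * E.D + 16) * (n + (maximalLocations s).card)) (St.start E (init P s).mem) := by
  have hlt := hH.lt
  refine start_wp_mainCmd (by omega) (hH.lt_B (by omega)) (init_mem_zero P) ?_
  intro s₁ hn hc ht hcell
  refine ⟨fun h => by omega, fun _ => ?_⟩
  refine prepare_enumerate_spec (skip_recorder hroom) hH hσ h0 hnH hn hc ht
    (fun p h1 h2 => by rw [hcell, init_mem P h1 h2]) (fun s₂ h1 h2 h3 => ?_) fun s₂ hn2 hs2 => ?_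
  · refine ⟨⟨?_, ?_, ?_⟩, ?_, ?_, ?_⟩
    · intro r hr; omega
    · intro r hr; omega
    · simp
    · simp [h1]
    · simp
    · omega
  · have hm := hs2.card
    have htk := hs2.ticks
    rw [wp_seq]
    refine wp_call (rename_spec hH hn2 rfl h0 (by omega) (by omega) (hs2.records.digit_lt h0)) ?_
    rintro s₃ ⟨k1, k2, k3⟩ f3
    have hm3 : s₃.v .m = s₂.v .m :=
      f3.v _ (by simp [rename, clearBuckets, distribute, traverse])
    have hI : s₃.a .I = s₂.a .I := f3.a _ (by simp [rename, clearBuckets, distribute, traverse])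
    have hJ : s₃.a .J = s₂.a .J := f3.a _ (by simp [rename, clearBuckets, distribute, traverse])
    refine wp_mono _ (writeTriples_spec hH hm3 (by omega)) ?_
    rintro s₄ ⟨g1, g2, g3⟩
    rw [hI, hJ] at g2
    refine ⟨fun hinj => hs2.holdsMaximalLocations hinj rfl (fun r hr r' hr' => ⟨fun he => ?_,
      k2 r hr r' hr'⟩) g1 g2, ?_⟩
    · have e := sameDigits_equivalence s₂.a E.D
      have h1 := (k1 r hr).2
      rw [he] at h1
      exact e.trans (e.symm h1) (k1 r' hr').2
    · set L := (maximalLocations s).card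
      have e1 : (8 * E.D + 16) * (n + L) = E.D * (2 * (n + L)) + 6 * (E.D * n) + 6 * (E.D * L) +
        16 * n + 16 * L := by ring
      rw [hm] at k3 g3
      omega

theorem mainCmd_small {k : ℕ} {hook c : Cmd} (P : Program) (hw : 2 < 2 ^ E.w) (hB : 0 < E.B)
    (hk : n < 2 ^ k) :
    wp E (mainCmd E.D k hook c) (fun s₁ => True ∧ s₁.ticks ≤ 0) (St.start E (init P s).mem) :=
  start_wp_mainCmd hw hB (init_mem_zero P) fun _ _ _ ht _ =>
    ⟨fun _ => ⟨trivial, ht.le⟩, fun h => by omega⟩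

end

theorem fingerprintsCmd_wf (D k : ℕ) : (fingerprintsCmd D k).wf D := by
  simp [fingerprintsCmd, mainCmd, flushIfFull, flush, rename, compact, copyRecord, copyDigits,
    clearBuckets, distribute, traverse, prepare, loadInput, drawHashes, enumerate, scan, visit,
    absorb, resetHash, writePairs, Cmd.wf, Ex.wf, Cmd.rep_wf, Arr.code]
  and_intros <;> intros <;> and_intros <;> omega

theorem locationsCmd_wf (D k : ℕ) : (locationsCmd D k).wf D := by
  simp [locationsCmd, mainCmd, rename,
    clearBuckets, distribute, traverse, prepare, loadInput, drawHashes, enumerate, scan, visit,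
    absorb, resetHash, writeTriples, Cmd.wf, Ex.wf, Cmd.rep_wf, Arr.code]
  and_intros <;> intros <;> and_intros <;> omega

end WordRAM

namespace WordRAM

open TextFingerprint MeasureTheory

/-! ### Hash collisions -/

instance (w : ℕ) : IsProbabilityMeasure (coinLaw w) := by
  unfold coinLaw; infer_instance

/-- An event on finitely many words reduces to counting. -/
theorem coinLaw_cylinder {w : ℕ} (s : Finset ℕ) (S : Finset (s → Fin (2 ^ w))) :
    (coinLaw w).real (cylinder s (S : Set (s → Fin (2 ^ w)))) = S.card / (2 ^ w) ^ s.card := by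
  rw [measureReal_def, coinLaw, Measure.infinitePi_cylinder _ S.measurableSet,
    ← sum_measure_singleton, ENNReal.toReal_sum (fun _ _ => measure_ne_top _ _)]
  have h : ∀ g : s → Fin (2 ^ w), (Measure.pi fun _ : s =>
      (PMF.uniformOfFintype (Fin (2 ^ w))).toMeasure) {g} = (((2 ^ w : ℕ) : ENNReal)⁻¹) ^ s.card := by
    intro g
    rw [Measure.pi_singleton]
    simp
  simp [h]
  rw [div_eq_mul_inv]

/-- The measure of an event for which the words at the positions in `I` are determined modulo `n` by
the other ones. -/
theorem coinLaw_le {w N n : ℕ} {I : Finset ℕ} (hI : I ⊆ Finset.range N) (h0 : 0 < n)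
    (hn : n ≤ 2 ^ w) {A : Set (ℕ → Fin (2 ^ w))}
    (h : ∀ ω ∈ A, ∀ ω' ∈ A, (∀ i < N, i ∉ I → ω i = ω' i) → ∀ i ∈ I, (ω i : ℕ) ≡ ω' i [MOD n]) :
    (coinLaw w).real A ≤ (2 / n : ℝ) ^ I.card := by
  classical
  obtain ⟨M, hM⟩ : ∃ M, M = 2 ^ w := ⟨_, rfl⟩
  set s := Finset.range N with hs
  set S : Finset (s → Fin (2 ^ w)) := Finset.univ.filter fun g => ∃ ω ∈ A, s.restrict ω = g with hS
  have hsub : A ⊆ cylinder s (S : Set (s → Fin (2 ^ w))) := fun ω hω => by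
    simp only [mem_cylinder, hS, Finset.coe_filter, Finset.mem_univ, true_and]
    exact ⟨ω, hω, rfl⟩
  have hcard : S.card ≤ ∏ i : s, if (i : ℕ) ∈ I then M / n + 1 else M := by
    have e : ∀ i : s, (if (i : ℕ) ∈ I then M / n + 1 else M) =
        (if (i : ℕ) ∈ I then Finset.range (M / n + 1) else Finset.range M).card := fun i => by
      split_ifs <;> simp
    rw [Finset.prod_congr rfl fun i _ => e i, ← Fintype.card_piFinset]
    -- Words outside `I` are kept, those in `I` are replaced by their quotients by `n`. This loses
    -- nothing on `A`, where the outer words determine the residues.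
    refine Finset.card_le_card_of_injOn
      (fun g i => if (i : ℕ) ∈ I then (g i : ℕ) / n else g i) (fun g _ => ?_) ?_
    · rw [Finset.mem_coe, Fintype.mem_piFinset]
      intro i
      by_cases hi : (i : ℕ) ∈ I
      · simp only [hi, if_true, Finset.mem_range]
        exact Nat.lt_succ_of_le (Nat.div_le_div_right (hM ▸ (g i).2.le))
      · simp only [hi, if_false, Finset.mem_range]
        exact hM ▸ (g i).2
    · intro g hg g' hg' hgg
      simp only [hS, Finset.coe_filter, Set.mem_ofPred_eq, Finset.mem_univ, true_and] at hg hg'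
      obtain ⟨ω, hω, rfl⟩ := hg
      obtain ⟨ω', hω', rfl⟩ := hg'
      have key : ∀ i < N, (if i ∈ I then (ω i : ℕ) / n else ω i) =
          if i ∈ I then (ω' i : ℕ) / n else ω' i := fun i hi =>
        congrFun hgg ⟨i, Finset.mem_range.2 hi⟩
      have hoff : ∀ i < N, i ∉ I → ω i = ω' i := fun i hi hiI => by
        have := key i hi
        rw [if_neg hiI, if_neg hiI] at this
        exact Fin.ext this
      funext ⟨i, hi⟩
      by_cases hiI : i ∈ I
      · have h1 := key i (Finset.mem_range.1 hi)
        rw [if_pos hiI, if_pos hiI] at h1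
        have h2 := h ω hω ω' hω' hoff i hiI
        refine Fin.ext ?_
        change (ω i : ℕ) = ω' i
        rw [← Nat.div_add_mod (ω i : ℕ) n, h1, h2, Nat.div_add_mod]
      · exact hoff i (Finset.mem_range.1 hi) hiI
  have hM0 : (0 : ℝ) < M := by rw [hM]; positivity
  have hn0 : (0 : ℝ) < n := by exact_mod_cast h0
  calc (coinLaw w).real A ≤ (coinLaw w).real (cylinder s (S : Set (s → Fin (2 ^ w)))) :=
        measureReal_mono hsub
    _ = S.card / (M : ℝ) ^ s.card := by rw [coinLaw_cylinder, hM]; push_cast; rfl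
    _ ≤ (∏ i : s, if (i : ℕ) ∈ I then ((M / n + 1 : ℕ) : ℝ) else M) / (M : ℝ) ^ s.card := by
        gcongr
        exact_mod_cast hcard
    _ = ∏ i : s, if (i : ℕ) ∈ I then ((M / n + 1 : ℕ) : ℝ) / M else 1 := by
        have : (M : ℝ) ^ s.card = ∏ i : s, (M : ℝ) := by simp
        rw [this, ← Finset.prod_div_distrib]
        refine Finset.prod_congr rfl fun i _ => ?_
        split_ifs
        · rfl
        · exact div_self hM0.ne'
    _ = (((M / n + 1 : ℕ) : ℝ) / M) ^ I.card := by
        rw [Finset.prod_coe_sort s (fun i => if i ∈ I then ((M / n + 1 : ℕ) : ℝ) / M else 1),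
          Finset.prod_ite_mem, Finset.inter_eq_right.2 hI, Finset.prod_const]
    _ ≤ (2 / n : ℝ) ^ I.card := by
        gcongr ?_ ^ _
        -- Since `n ≤ M`, there are at most `M / n + 1 ≤ 2 * M / n` quotients, read as a real bound;
        -- the factor `2` covers the bias of reducing a random word modulo `n`.
        rw [div_le_div_iff₀ hM0 hn0]
        have h1 : (M / n + 1) * n ≤ 2 * M := by
          have := Nat.div_mul_le_self M n
          rw [add_mul]; omega
        exact_mod_cast h1

/-- Take a letter in only one of the two sets. Once all other words are fixed, equality of digit `t`
determines the residue of word `t` of this letter, because its value is a lone summand. -/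
theorem coinLaw_collision_le {σ w D n : ℕ} (h0 : 0 < n) (hn : n ≤ 2 ^ w)
    {f f' : Finset (Fin σ)} (hf : f ≠ f') :
    (coinLaw w).real {ω | ∀ t < D, hashDigit (letterDigit ω D n) n t f =
      hashDigit (letterDigit ω D n) n t f'} ≤ (2 / n : ℝ) ^ D := by
  wlog hx : ∃ x ∈ f, x ∉ f' generalizing f f'
  · have hx' : ∃ x ∈ f', x ∉ f := by
      by_contra hc
      push Not at hx hc
      exact hf (Finset.Subset.antisymm hx hc)
    simpa only [eq_comm] using this hf.symm hx'
  obtain ⟨x, hx, hx'⟩ := hx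
  set I : Finset ℕ := (Finset.range D).image fun t => x * D + t with hI
  have hIcard : I.card = D := by
    rw [hI, Finset.card_image_of_injective _ (add_right_injective _), Finset.card_range]
  have key := @coinLaw_le w (σ * D) n I (fun i hi => ?_) h0 hn
    {ω | ∀ t < D, hashDigit (letterDigit ω D n) n t f = hashDigit (letterDigit ω D n) n t f'} ?_
  · rwa [hIcard] at key
  · simp only [hI, Finset.mem_image, Finset.mem_range] at hi ⊢
    obtain ⟨t, ht, rfl⟩ := hi
    calc (x : ℕ) * D + t < (x + 1) * D := by rw [add_mul]; omega
      _ ≤ σ * D := Nat.mul_le_mul_right _ x.2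
  · intro ω hω ω' hω' hoff i hi
    simp only [hI, Finset.mem_image, Finset.mem_range] at hi
    obtain ⟨t, ht, rfl⟩ := hi
    -- Word `t` of the letter `y` has index `y * D + t`, and division by `D` recovers the letter; so
    -- letters do not share words.
    have heq : ∀ y : Fin σ, y ≠ x → letterDigit ω D n t y = letterDigit ω' D n t y := by
      intro y hy
      rw [letterDigit, letterDigit, hoff]
      · calc (y : ℕ) * D + t < (y + 1) * D := by rw [add_mul]; omega
          _ ≤ σ * D := Nat.mul_le_mul_right _ y.2
      · simp only [hI, Finset.mem_image, Finset.mem_range, not_exists, not_and]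
        intro t' ht' he
        have h1 : ((y : ℕ) * D + t) / D = y := by
          rw [mul_comm, Nat.mul_add_div (by omega), Nat.div_eq_of_lt ht, add_zero]
        have h2 : ((x : ℕ) * D + t') / D = x := by
          rw [mul_comm, Nat.mul_add_div (by omega), Nat.div_eq_of_lt ht', add_zero]
        exact hy (Fin.ext (by rw [← h1, ← he, h2]))
    have e1 := hω t ht
    have e2 := hω' t ht
    simp only [hashDigit] at e1 e2
    have e3 : ∑ y ∈ f', letterDigit ω D n t y = ∑ y ∈ f', letterDigit ω' D n t y :=
      Finset.sum_congr rfl fun y hy => heq y fun e => hx' (e ▸ hy)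
    have e4 : ∑ y ∈ f.erase x, letterDigit ω D n t y = ∑ y ∈ f.erase x, letterDigit ω' D n t y :=
      Finset.sum_congr rfl fun y hy => heq y (Finset.ne_of_mem_erase hy)
    rw [e3, ← e2, ← Finset.add_sum_erase f _ hx, ← Finset.add_sum_erase f _ hx, e4] at e1
    have e5 : letterDigit ω D n t x ≡ letterDigit ω' D n t x [MOD n] :=
      Nat.ModEq.add_right_cancel' _ e1
    simpa [letterDigit, Nat.ModEq] using e5

theorem card_fingerprints_le {n σ : ℕ} (s : Fin n → Fin σ) : (fingerprints s).card ≤ n ^ 2 := by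
  refine Finset.card_image_le.trans ((Finset.card_filter_le _ _).trans ?_)
  simp [sq]

theorem card_maximalLocations_le {n σ : ℕ} (s : Fin n → Fin σ) :
    (maximalLocations s).card ≤ n ^ 2 := by
  refine (Finset.card_filter_le _ _).trans ?_
  simp [sq]

theorem coinLaw_not_hashInjective_le {n σ w D : ℕ} (s : Fin n → Fin σ) (h0 : 0 < n)
    (hn : n ≤ 2 ^ w) :
    (coinLaw w).real {ω | ¬ HashInjective D s (letterDigit ω D n)} ≤
      (n : ℝ) ^ 4 * (2 / n : ℝ) ^ D := by
  set F := (fingerprints s ×ˢ fingerprints s).filter fun q => q.1 ≠ q.2 with hF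
  have hsub : {ω | ¬ HashInjective D s (letterDigit ω D n)} ⊆
      ⋃ q ∈ F, {ω : ℕ → Fin (2 ^ w) | ∀ t < D, hashDigit (letterDigit ω D n) n t q.1 =
        hashDigit (letterDigit ω D n) n t q.2} := by
    intro ω hω
    simp only [HashInjective, Set.mem_ofPred_eq] at hω
    push Not at hω
    obtain ⟨f, hf, f', hf', h1, h2⟩ := hω
    simp only [Set.mem_iUnion]
    exact ⟨(f, f'), by simp [hF, hf, hf', h2], h1⟩
  have hcard : F.card ≤ n ^ 4 := by
    refine (Finset.card_filter_le _ _).trans ?_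
    rw [Finset.card_product]
    calc _ ≤ n ^ 2 * n ^ 2 := Nat.mul_le_mul (card_fingerprints_le s) (card_fingerprints_le s)
      _ = n ^ 4 := by ring
  calc _ ≤ _ := measureReal_mono hsub (measure_ne_top _ _)
    _ ≤ ∑ q ∈ F, _ := measureReal_biUnion_finset_le _ _
    _ ≤ ∑ q ∈ F, (2 / n : ℝ) ^ D := Finset.sum_le_sum fun q hq =>
        coinLaw_collision_le h0 hn (Finset.mem_filter.1 hq).2
    _ = F.card * (2 / n : ℝ) ^ D := by simp
    _ ≤ _ := by
        gcongr
        exact_mod_cast hcard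

end WordRAM

namespace WordRAM

open TextFingerprint MeasureTheory

/-! ### Running time, space and error probability -/

/-- The constant of the bounds for the program of `c₀` with `D` digits that ignores the inputs of
length less than `2 ^ k`. -/
noncomputable def boundConst (D k : ℕ) (c₀ : Cmd) (c A : ℝ) : ℝ :=
  -- One summand each for time, space, the error on long inputs and the error on short ones.
  c₀.len D * (8 * D + 17) + |A| * (28 + 6 * D) + 2 ^ D + (2 ^ k : ℝ) ^ |c|

section

variable {D k n σ w X : ℕ} {hook c₀ : Cmd} {s : Fin n → Fin σ} {Good : (ℕ → ℕ) → Prop} {c A : ℝ}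

theorem pow_le_two_pow (hn : 2 ≤ n) (hw : 6 * Real.logb 2 n ≤ w) : n ^ 6 ≤ 2 ^ w := by
  have h0 : (0 : ℝ) < n := by positivity
  have h1 : ((n : ℝ)) ^ 6 ≤ (2 : ℝ) ^ w := by
    rw [← Real.rpow_natCast 2 w, ← Real.logb_le_iff_le_rpow (by norm_num) (by positivity),
      Real.logb_pow]
    exact_mod_cast hw
  exact_mod_cast h1

/-- The row width is at most `n` and there are at most `3 * n ^ 2` rows, so `n ^ 4` cells suffice.
The exponent `6` is generous and covers the headroom in `Fits` as well. -/
theorem fits_of_pow_le {ω : ℕ → Fin (2 ^ w)} (h8 : 8 ≤ n) (hW : 8 + 3 * D ≤ n) (hX : X ≤ n ^ 2)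
    (hw : n ^ 6 ≤ 2 ^ w) :
    Fits ⟨w, D, (8 + 3 * D) * (2 * X + n + 2), ω⟩ (2 * X + n + 2) ∧
      (8 + 3 * D) * (2 * X + n + 2) ≤ 2 ^ w := by
  have h2 : n * 8 ≤ n ^ 2 := by rw [sq]; exact Nat.mul_le_mul_left _ h8
  have hH : 2 * X + n + 2 ≤ 3 * n ^ 2 := by omega
  have h3 : n ^ 2 * 4096 ≤ n ^ 6 := by
    calc n ^ 2 * 4096 = n ^ 2 * 8 ^ 4 := by norm_num
      _ ≤ n ^ 2 * n ^ 4 := Nat.mul_le_mul_left _ (Nat.pow_le_pow_left h8 4)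
      _ = n ^ 6 := by ring
  have h4 : (8 + 3 * D) * (2 * X + n + 2) ≤ n ^ 6 := by
    calc (8 + 3 * D) * (2 * X + n + 2) ≤ n * (n * n ^ 2) :=
          Nat.mul_le_mul hW (hH.trans (Nat.mul_le_mul_right _ (by omega)))
      _ = n ^ 4 * 1 := by ring
      _ ≤ n ^ 4 * n ^ 2 := Nat.mul_le_mul_left _ (Nat.one_le_pow _ _ (by omega))
      _ = n ^ 6 := by ring
  refine ⟨⟨fun i hi => ⟨?_, ?_⟩, ?_⟩, h4.trans hw⟩
  · simp only [Env.W]; omega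
  · simp only [Env.W]
    calc (8 + 3 * D) * i + (8 + 3 * D) = (8 + 3 * D) * (i + 1) := by ring
      _ ≤ _ := Nat.mul_le_mul_left _ hi
  · change 4 * (2 * X + n + 2) + 4 ≤ 2 ^ w
    omega

/-- Four digits outweigh the `n ^ 4` pairs of fingerprints, and the other `⌈c⌉₊` digits provide the
error `n ^ (-c)`. -/
theorem error_bound (hn : 1 ≤ n) (hD : D = ⌈c⌉₊ + 4) :
    (n : ℝ) ^ 4 * (2 / n : ℝ) ^ D ≤ 2 ^ D * (n : ℝ) ^ (-c) := by
  have h1 : (1 : ℝ) ≤ n := by exact_mod_cast hn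
  have h0 : (0 : ℝ) < n := by linarith
  have e : (n : ℝ) ^ 4 * (2 / n : ℝ) ^ D = 2 ^ D * ((n : ℝ) ^ ⌈c⌉₊)⁻¹ := by
    have : (n : ℝ) ^ D = (n : ℝ) ^ ⌈c⌉₊ * (n : ℝ) ^ 4 := by rw [hD, pow_add]
    rw [div_pow, this]
    field_simp
  rw [e, Real.rpow_neg h0.le, ← Real.rpow_natCast (n : ℝ)]
  gcongr 2 ^ D * ?_⁻¹
  exact Real.rpow_le_rpow_of_exponent_le h1 (Nat.le_ceil c)

/-- On bounded inputs a constant makes the allowed error at least `1`. The absolute value takes care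
of negative `c`. -/
theorem one_le_small_error (hn : 1 ≤ n) (hk : n < 2 ^ k) :
    1 ≤ (2 ^ k : ℝ) ^ |c| * (n : ℝ) ^ (-c) := by
  have h1 : (1 : ℝ) ≤ n := by exact_mod_cast hn
  have h0 : (0 : ℝ) < n := by linarith
  have h2 : (n : ℝ) ≤ 2 ^ k := by exact_mod_cast hk.le
  rw [Real.rpow_neg h0.le, ← div_eq_mul_inv, one_le_div (by positivity)]
  calc (n : ℝ) ^ c ≤ (n : ℝ) ^ |c| := Real.rpow_le_rpow_of_exponent_le h1 (le_abs_self c)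
    _ ≤ (2 ^ k : ℝ) ^ |c| := Real.rpow_le_rpow h0.le h2 (abs_nonneg c)

/-- `X` bounds the memory: `|F|` for the first program, `|L|` for the second. Halting and space are
shown for every stream of random words, and failure is contained in the event that the hash is not
injective. -/
theorem monteCarlo_mainCmd (hD : D = ⌈c⌉₊ + 4) (hk : k = 8 + 3 * D)
    (hwf : (mainCmd D k hook c₀).wf D) (hX : X ≤ n ^ 2)
    (hlarge : ∀ (ω : ℕ → Fin (2 ^ w)) (B : ℕ), Fits ⟨w, D, B, ω⟩ (2 * X + n + 2) → 2 ^ k ≤ n →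
      wp ⟨w, D, B, ω⟩ (mainCmd D k hook c₀) (fun s₁ =>
        (HashInjective D s (letterDigit ω D n) → Good (s₁.cell ⟨w, D, B, ω⟩)) ∧
        s₁.ticks ≤ (8 * D + 16) * (n + (maximalLocations s).card))
        (St.start ⟨w, D, B, ω⟩ (init ((mainCmd D k hook c₀).program D) s).mem))
    (hn : 2 ≤ n) (hσ : σ ≤ n) (hw : 6 * Real.logb 2 n ≤ w) (hA : (w : ℝ) ≤ A * Real.logb 2 n) :
    MonteCarlo ((mainCmd D k hook c₀).program D) w s Good
      (boundConst D k (mainCmd D k hook c₀) c A * ((n : ℝ) + (maximalLocations s).card))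
      (boundConst D k (mainCmd D k hook c₀) c A * (((n : ℝ) + X) * Real.logb 2 n))
      (boundConst D k (mainCmd D k hook c₀) c A * (n : ℝ) ^ (-c)) := by
  set c₁ := mainCmd D k hook c₀
  set L := (maximalLocations s).card
  have hpow := pow_le_two_pow hn hw
  have hn1 : (2 : ℝ) ≤ n := by exact_mod_cast hn
  have hlog : 0 ≤ Real.logb 2 n := Real.logb_nonneg (by norm_num) (by linarith)
  have hp1 : (0 : ℝ) ≤ c₁.len D * (8 * D + 17) := by positivity
  have hp2 : (0 : ℝ) ≤ |A| * (28 + 6 * D) := by positivity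
  have hp3 : (0 : ℝ) ≤ 2 ^ D := by positivity
  have hp4 : (0 : ℝ) ≤ (2 ^ k : ℝ) ^ |c| := by positivity
  set t := c₁.len D * (1 + (8 * D + 16) * (n + L)) with ht
  have key : ∀ ω : ℕ → Fin (2 ^ w), (run (c₁.program D) w s ω t).Halted ∧
      (run (c₁.program D) w s ω t).hi + 20 ≤ (28 + 6 * D) * (n + X) ∧
      (2 ^ k ≤ n → HashInjective D s (letterDigit ω D n) →
        Good (run (c₁.program D) w s ω t).mem) := by
    intro ω
    -- A short input is only inspected in cell `0`, so its own cells suffice as memory and no loop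
    -- is run.
    rcases Nat.lt_or_ge n (2 ^ k) with hnk | hnk
    · have h64 : 2 ^ 6 ≤ n ^ 6 := Nat.pow_le_pow_left hn 6
      have h7 : n * 1 ≤ n * n ^ 5 := Nat.mul_le_mul_left _ (Nat.one_le_pow _ _ (by omega))
      have h8 : n ≠ 2 ^ w := fun h => by
        have : n * 2 ≤ n * n ^ 5 := Nat.mul_le_mul_left _
          (hn.trans (Nat.le_self_pow (by norm_num) n))
        have : n * n ^ 5 = n ^ 6 := by ring
        omega
      have h9 : n * n ^ 5 = n ^ 6 := by ring
      obtain ⟨g1, g2, -⟩ := run_of_wp (E := ⟨w, D, n + 1, ω⟩) (c := c₁) (s := s) (τ := 0) (T := t)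
        (by change n + 1 ≤ 2 ^ w; omega) (by change n < n + 1; omega) hσ hwf
        (mainCmd_small (E := ⟨w, D, n + 1, ω⟩) _ (by change 2 < 2 ^ w; omega) (Nat.succ_pos n) hnk)
        (Nat.mul_le_mul_left _ (by omega))
      refine ⟨g1, ?_, fun h => by omega⟩
      change (run (c₁.program D) w s ω t).hi ≤ n + 1 at g2
      have : 28 * (n + X) ≤ (28 + 6 * D) * (n + X) := Nat.mul_le_mul_right _ (by omega)
      omega
    · have hkn : k < n := (Nat.lt_two_pow_self).trans_le hnk
      obtain ⟨hF, hB⟩ := fits_of_pow_le (D := D) (ω := ω) (by omega) (by omega) hX hpow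
      obtain ⟨g1, g2, s', g3, g4⟩ := run_of_wp
        (E := ⟨w, D, (8 + 3 * D) * (2 * X + n + 2), ω⟩) (c := c₁) (s := s) (T := t)
        hB (hF.lt_B (by omega)) hσ hwf (hlarge ω _ hF hnk) le_rfl
      refine ⟨g1, ?_, fun _ hinj => ?_⟩
      · refine (Nat.add_le_add_right g2 20).trans ?_
        -- The summand `20` counts the registers; `n ≥ 2` turns the additive constants into
        -- multiples of `n + X`.
        calc (8 + 3 * D) * (2 * X + n + 2) + 20
            ≤ (8 + 3 * D) * (2 * (n + X)) + 12 * (n + X) :=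
              Nat.add_le_add (Nat.mul_le_mul_left _ (by omega)) (by omega)
          _ = (28 + 6 * D) * (n + X) := by ring
      · change (run (c₁.program D) w s ω t).mem = _ at g4
        rw [g4]
        exact g3 hinj
  refine ⟨t, ?_, fun ω => ⟨(key ω).1, ?_⟩, ?_⟩
  · have h1 : (t : ℝ) ≤ c₁.len D * (8 * D + 17) * (n + L) := by
      rw [ht]
      push_cast
      rw [mul_assoc]
      gcongr
      have : (0 : ℝ) ≤ L := by positivity
      linarith
    refine h1.trans ?_
    gcongr
    simp only [boundConst]
    linarith
  · have h1 : (((run (c₁.program D) w s ω t).hi + 20 : ℕ) : ℝ) ≤ (28 + 6 * D) * (n + X) := by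
      exact_mod_cast (key ω).2.1
    have h2 : (w : ℝ) ≤ |A| * Real.logb 2 n :=
      hA.trans (mul_le_mul_of_nonneg_right (le_abs_self A) hlog)
    calc (((run (c₁.program D) w s ω t).bits w : ℕ) : ℝ)
        = w * (((run (c₁.program D) w s ω t).hi + 20 : ℕ) : ℝ) := by
          rw [add_comm, ← Nat.cast_mul]; rfl
      _ ≤ |A| * Real.logb 2 n * ((28 + 6 * D) * (n + X)) := by gcongr
      _ = |A| * (28 + 6 * D) * ((n + X) * Real.logb 2 n) := by ring
      _ ≤ _ := by
          gcongr
          simp only [boundConst]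
          linarith
  · rcases Nat.lt_or_ge n (2 ^ k) with hnk | hnk
    · refine measureReal_le_one.trans ((one_le_small_error (c := c) (by omega) hnk).trans ?_)
      gcongr
      simp only [boundConst]
      linarith
    · have hle : n ≤ 2 ^ w := (Nat.le_self_pow (by norm_num) n).trans hpow
      have hsub : {ω | ¬ Good (run (c₁.program D) w s ω t).mem} ⊆
          {ω | ¬ HashInjective D s (letterDigit ω D n)} :=
        fun ω hω hinj => hω ((key ω).2.2 hnk hinj)
      refine (measureReal_mono hsub (measure_ne_top _ _)).trans
        ((coinLaw_not_hashInjective_le s (by omega) hle).trans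
          ((error_bound (c := c) (by omega) hD).trans ?_))
      gcongr
      simp only [boundConst]
      linarith

end

end WordRAM

open TextFingerprint WordRAM in
theorem theorem7 :
    ∃ a : ℝ, ∀ c : ℝ,
      (∃ P : Program, ∀ A : ℝ, ∃ C : ℝ, ∀ (n σ w : ℕ) (s : Fin n → Fin σ),
        2 ≤ n → σ ≤ n → a * Real.logb 2 n ≤ w → (w : ℝ) ≤ A * Real.logb 2 n →
        MonteCarlo P w s (HoldsFingerprints s)
          (C * ((n : ℝ) + (maximalLocations s).card))
          (C * (((n : ℝ) + (fingerprints s).card) * Real.logb 2 n))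
          (C * (n : ℝ) ^ (-c))) ∧
      (∃ P : Program, ∀ A : ℝ, ∃ C : ℝ, ∀ (n σ w : ℕ) (s : Fin n → Fin σ),
        2 ≤ n → σ ≤ n → a * Real.logb 2 n ≤ w → (w : ℝ) ≤ A * Real.logb 2 n →
        MonteCarlo P w s (HoldsMaximalLocations s)
          (C * ((n : ℝ) + (maximalLocations s).card))
          (C * (((n : ℝ) + (maximalLocations s).card) * Real.logb 2 n))
          (C * (n : ℝ) ^ (-c))) := by
  refine ⟨6, fun c => ?_⟩
  obtain ⟨D, hD⟩ : ∃ D, D = ⌈c⌉₊ + 4 := ⟨_, rfl⟩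
  -- With this `k`, inputs of length at least `2 ^ k` are longer than a row is wide, as
  -- `fits_of_pow_le` requires.
  obtain ⟨k, hk⟩ : ∃ k, k = 8 + 3 * D := ⟨_, rfl⟩
  refine ⟨⟨(fingerprintsCmd D k).program D, fun A => ⟨boundConst D k (fingerprintsCmd D k) c A,
    fun n σ w s hn hσ hw hA => ?_⟩⟩, ⟨(locationsCmd D k).program D, fun A =>
    ⟨boundConst D k (locationsCmd D k) c A, fun n σ w s hn hσ hw hA => ?_⟩⟩⟩
  · exact monteCarlo_mainCmd hD hk (fingerprintsCmd_wf D k) (card_fingerprints_le s)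
      (fun ω B hF hnk => fingerprintsCmd_spec (E := ⟨w, D, B, ω⟩) _ hF hσ (by omega) hnk
        (by omega) (by omega)) hn hσ hw hA
  · exact monteCarlo_mainCmd hD hk (locationsCmd_wf D k) (card_maximalLocations_le s)
      (fun ω B hF hnk => locationsCmd_spec (E := ⟨w, D, B, ω⟩) _ hF hσ (by omega) hnk
        (by omega) (by omega)) hn hσ hw hA
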